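/- Let $R$ be a ring with unit and $G$ a profinite group. Let $\mathcal{S}G$ be the space of closed subgroups of $G$, with the topology having as basis the sets $\{L \mid LN/N = KN/N\}$ ($N$ an open normal subgroup, $K$ a closed subgroup of $G$), on which $G$ acts by conjugation. A $G$-sheaf of (left) $R$-modules over $\mathcal{S}G$ is a $G$-equivariant local homeomorphism $p\colon E\to\mathcal{S}G$ of spaces with continuous $G$-action, whose stalks $E_K=p^{-1}(K)$ are $R$-modules, such that fibrewise subtraction and fibrewise multiplication by each $r\in R$ are continuous and each $g\colon E_K\to E_{gKg^{-1}}$ is $R$-linear; morphisms are continuous $G$-equivariant maps over $\mathcal{S}G$ that are $R$-linear on stalks. A Weyl-$G$-sheaf of $R$-modules is such an $E$ for which $K$ acts trivially on $E_K$ for every $K$; Weyl-$G$-sheaves form a full subcategory. Write $N_GK$ for the normaliser of $K$ and $W_GK=N_GK/K$. A discrete $R[W_GK]$-module is an $R$-module with an $R$-linear action of $W_GK$ that is continuous for the discrete topology on the module. For such a module $A$, the Weyl skyscraper sheaf of $A$ at $K$ is $i_*(G\times_{N_GK}A)$, the extension by zero of the sheaf $G\times_{N_GK}A\to G/N_GK$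 along the closed embedding $i\colon G/N_GK\to\mathcal{S}G$, $gN_GK\mapsto gKg^{-1}$, onto the conjugacy class of $K$. Then: 1. For every closed subgroup $K$ of $G$ and every injective object $A$ of the category of discrete $R[W_GK]$-modules, the Weyl skyscraper sheaf $i_*(G\times_{N_GK}A)$ is an injective object of the category of Weyl-$G$-sheaves of $R$-modules. 2. The category of Weyl-$G$-sheaves of $R$-modules has enough injectives. 3. Every Weyl-$G$-sheaf $E$ of $R$-modules has a Godement resolution, that is, an injective resolution $0\to E\to I^0\to I^1\to\cdots$ of the following form. Call a morphism $\delta\colon F\to I$ of Weyl-$G$-sheaves a Godement embedding if there are a representative $K$ of each conjugacy class of closed subgroups and an injective homomorphism $j_K\colon F_K\to A_K$ into an injective discrete $R[W_GK]$-module for each of these $K$, such that $I$ is the product, in Weyl-$G$-sheaves, of the Weyl skyscrapers of the $A_K$ over all the classes, and the component of $\delta$ at $K$ induces $j_K$ on the stalks at $K$. Then $E\to I^0$ is a Godement embedding, and each later map is the composite of the cokernel of the preceding map with a Godement embedding of that cokernel. -/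

import Mathlib

open CategoryTheory CategoryTheory.Limits Topology

universe u

set_option linter.unusedSectionVars false

namespace WeylSheaves

/-! ### Equivariant sheaves of modules, as sheaf spaces -/

/-- The fibre of `p : E → X` over `x`. -/
abbrev Fib {E X : Type u} (p : E → X) (x : X) : Type u := {e : E // p e = x}

/-- A `G`-equivariant sheaf of (left) `R`-modules over a `G`-space `X`: an equivariant local
homeomorphism `p : E → X` of spaces with continuous `G`-action, whose fibres are `R`-modules, such
that fibrewise subtraction and fibrewise multiplication by each `r : R` are continuous and each
`g : p ⁻¹ x → p ⁻¹ (g x)` is `R`-linear. -/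
structure EqSheaf (R G X : Type u) [Ring R] [Group G] [TopologicalSpace G] [TopologicalSpace X]
    [MulAction G X] where
  E : Type u
  [top : TopologicalSpace E]
  [act : MulAction G E]
  [contAct : ContinuousSMul G E]
  p : E → X
  p_smul : ∀ (g : G) (e : E), p (g • e) = g • p e
  isLocalHomeo : IsLocalHomeomorph p
  [grp : ∀ x, AddCommGroup (Fib p x)]
  [mod : ∀ x, Module R (Fib p x)]
  continuous_sub : Continuous fun z : {z : E × E // p z.1 = p z.2} =>
    ((⟨z.1.1, z.2⟩ : Fib p (p z.1.2)) - ⟨z.1.2, rfl⟩).1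
  continuous_scalar : ∀ r : R, Continuous fun e : E => (r • (⟨e, rfl⟩ : Fib p (p e))).1
  smul_add_fib : ∀ (g : G) (x : X) (a b : Fib p x),
    g • (a + b).1 = ((⟨g • a.1, by rw [p_smul, a.2]⟩ : Fib p (g • x)) +
      ⟨g • b.1, by rw [p_smul, b.2]⟩).1
  smul_scalar_fib : ∀ (g : G) (x : X) (r : R) (a : Fib p x),
    g • (r • a).1 = (r • (⟨g • a.1, by rw [p_smul, a.2]⟩ : Fib p (g • x))).1

attribute [instance] EqSheaf.top EqSheaf.act EqSheaf.contAct EqSheaf.grp EqSheaf.mod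

namespace EqSheaf

variable {R G X : Type u} [Ring R] [Group G] [TopologicalSpace G] [TopologicalSpace X]
  [MulAction G X]

/-- The stalk of an equivariant sheaf. -/
abbrev Stalk (F : EqSheaf R G X) (x : X) : Type u := Fib F.p x

/-- A morphism of equivariant sheaves: a continuous equivariant map over `X`, linear on stalks. -/
@[ext]
structure Hom (F F' : EqSheaf R G X) where
  toFun : F.E → F'.E
  continuous_toFun : Continuous toFun
  map_smul : ∀ (g : G) (e : F.E), toFun (g • e) = g • toFun e
  map_p : ∀ e : F.E, F'.p (toFun e) = F.p e
  map_add_fib : ∀ (x : X) (a b : F.Stalk x),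
    toFun (a + b).1 = ((⟨toFun a.1, by rw [map_p, a.2]⟩ : F'.Stalk x) +
      ⟨toFun b.1, by rw [map_p, b.2]⟩).1
  map_scalar_fib : ∀ (x : X) (r : R) (a : F.Stalk x),
    toFun (r • a).1 = (r • (⟨toFun a.1, by rw [map_p, a.2]⟩ : F'.Stalk x)).1

instance : Category (EqSheaf R G X) where
  Hom := Hom
  id F :=
    { toFun := id
      continuous_toFun := continuous_id
      map_smul := fun _ _ => rfl
      map_p := fun _ => rfl
      map_add_fib := fun _ _ _ => rfl
      map_scalar_fib := fun _ _ _ => rfl }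
  comp f g :=
    { toFun := g.toFun ∘ f.toFun
      continuous_toFun := g.continuous_toFun.comp f.continuous_toFun
      map_smul := fun a e => by simp [f.map_smul, g.map_smul]
      map_p := fun e => by simp [f.map_p, g.map_p]
      map_add_fib := fun x a b => by simp [f.map_add_fib, g.map_add_fib]
      map_scalar_fib := fun x r a => by simp [f.map_scalar_fib, g.map_scalar_fib] }

/-- The map on stalks induced by a morphism. -/
def Hom.stalk {F F' : EqSheaf R G X} (f : F ⟶ F') (x : X) (e : F.Stalk x) : F'.Stalk x :=
  ⟨Hom.toFun f e.1, by rw [Hom.map_p f, e.2]⟩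

end EqSheaf

/-! ### Facts on local homeomorphisms with fibrewise subtraction -/

section Local

variable {E X : Type u} [TopologicalSpace E] [TopologicalSpace X]

theorem isLocalHomeomorph_of_sections {p : E → X} (hp : Continuous p)
    (h : ∀ e, ∃ (U : Set X) (s : X → E), IsOpen U ∧ p e ∈ U ∧ s (p e) = e ∧ ContinuousOn s U ∧
      (∀ x ∈ U, p (s x) = x) ∧ IsOpen (s '' U)) : IsLocalHomeomorph p := by
  refine IsLocalHomeomorph.mk _ fun e => ?_
  obtain ⟨U, s, hU, heU, hse, hs, hps, ho⟩ := h e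
  refine ⟨{ toFun := p, invFun := s, source := s '' U, target := U,
            map_source' := ?_, map_target' := ?_, left_inv' := ?_, right_inv' := ?_,
            open_source := ho, open_target := hU, continuousOn_toFun := hp.continuousOn,
            continuousOn_invFun := hs }, ?_, ?_⟩
  · rintro _ ⟨x, hx, rfl⟩
    rwa [hps x hx]
  · intro x hx
    exact ⟨x, hx, rfl⟩
  · rintro _ ⟨x, hx, rfl⟩
    rw [hps x hx]
  · exact hps
  · exact ⟨p e, heU, hse⟩
  · intro _ _
    rfl

theorem eventually_section_eq {p : E → X} (hp : IsLocalHomeomorph p) {U : Set X} (hU : IsOpen U)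
    {s : X → E} (hs : ContinuousOn s U) (hps : ∀ x ∈ U, p (s x) = x) {e : E} (heU : p e ∈ U)
    (hse : s (p e) = e) : ∀ᶠ e' in 𝓝 e, p e' ∈ U ∧ s (p e') = e' := by
  obtain ⟨φ, heφ, hφ⟩ := hp e
  have h1 : ∀ᶠ e' in 𝓝 e, p e' ∈ U := hp.continuous.continuousAt (hU.mem_nhds heU)
  have h2 : ∀ᶠ e' in 𝓝 e, e' ∈ φ.source := φ.open_source.mem_nhds heφ
  have hc : ContinuousAt (fun e' => s (p e')) e :=
    ContinuousAt.comp (f := p) (g := s) (hs.continuousAt (hU.mem_nhds heU))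
      hp.continuous.continuousAt
  have h3 : ∀ᶠ e' in 𝓝 e, s (p e') ∈ φ.source := by
    apply hc
    simp only [hse]
    exact φ.open_source.mem_nhds heφ
  filter_upwards [h1, h2, h3] with e' a b c
  refine ⟨a, φ.injOn c b ?_⟩
  rw [← hφ]
  exact hps _ a

theorem continuous_sub_of_sections {p : E → X} (hp : IsLocalHomeomorph p)
    [∀ x, AddCommGroup (Fib p x)]
    (h : ∀ (x : X) (a b : Fib p x), ∃ (U : Set X) (s t w : X → E), IsOpen U ∧ x ∈ U ∧
      ContinuousOn s U ∧ ContinuousOn t U ∧ ContinuousOn w U ∧ s x = a.1 ∧ t x = b.1 ∧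
      ∀ y ∈ U, ∃ (hs : p (s y) = y) (ht : p (t y) = y),
        w y = ((⟨s y, hs⟩ : Fib p y) - ⟨t y, ht⟩).1) :
    Continuous fun z : {z : E × E // p z.1 = p z.2} =>
      ((⟨z.1.1, z.2⟩ : Fib p (p z.1.2)) - ⟨z.1.2, rfl⟩).1 := by
  rw [continuous_iff_continuousAt]
  intro z
  obtain ⟨U, s, t, w, hU, hx, hs, ht, hw, hsx, htx, hst⟩ := h (p z.1.2) ⟨z.1.1, z.2⟩ ⟨z.1.2, rfl⟩
  have h1 := eventually_section_eq hp hU hs (fun y hy => (hst y hy).1) (e := z.1.1)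
    (by rw [z.2]; exact hx) (by rw [z.2]; exact hsx)
  have h2 := eventually_section_eq hp hU ht (fun y hy => (hst y hy).2.1) (e := z.1.2) hx htx
  have c1 : Continuous fun z : {z : E × E // p z.1 = p z.2} => z.1.1 :=
    continuous_fst.comp continuous_subtype_val
  have c2 : Continuous fun z : {z : E × E // p z.1 = p z.2} => z.1.2 :=
    continuous_snd.comp continuous_subtype_val
  have hc : ContinuousAt (fun z : {z : E × E // p z.1 = p z.2} => w (p z.1.2)) z :=
    ContinuousAt.comp (f := fun z : {z : E × E // p z.1 = p z.2} => p z.1.2) (g := w)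
      (hw.continuousAt (hU.mem_nhds hx)) (hp.continuous.comp c2).continuousAt
  refine hc.congr ?_
  filter_upwards [c1.continuousAt.eventually h1, c2.continuousAt.eventually h2] with z' a b
  obtain ⟨p1, p2, p3⟩ := hst (p z'.1.2) b.1
  rw [p3]
  congr 3
  · rw [← z'.2]; exact a.2
  · exact b.2

theorem continuous_scalar_of_sections {R : Type u} {p : E → X} (hp : IsLocalHomeomorph p)
    [∀ x, SMul R (Fib p x)] (r : R)
    (h : ∀ (x : X) (a : Fib p x), ∃ (U : Set X) (s w : X → E), IsOpen U ∧ x ∈ U ∧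
      ContinuousOn s U ∧ ContinuousOn w U ∧ s x = a.1 ∧
      ∀ y ∈ U, ∃ (hs : p (s y) = y), w y = (r • (⟨s y, hs⟩ : Fib p y)).1) :
    Continuous fun e : E => (r • (⟨e, rfl⟩ : Fib p (p e))).1 := by
  rw [continuous_iff_continuousAt]
  intro e
  obtain ⟨U, s, w, hU, hx, hs, hw, hsx, hst⟩ := h (p e) ⟨e, rfl⟩
  have h1 := eventually_section_eq hp hU hs (fun y hy => (hst y hy).1) (e := e) hx hsx
  have hc : ContinuousAt (fun e => w (p e)) e :=
    ContinuousAt.comp (f := p) (g := w) (hw.continuousAt (hU.mem_nhds hx))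
      hp.continuous.continuousAt
  refine hc.congr ?_
  filter_upwards [h1] with e' a
  obtain ⟨p1, p3⟩ := hst (p e') a.1
  rw [p3]
  congr 2
  exact Subtype.ext a.2

/-- Two lifts of the same map along a local homeomorphism agree on an open set. -/
theorem isOpen_lift_eq {p : E → X} (hp : IsLocalHomeomorph p) {Z : Type u} [TopologicalSpace Z]
    {D : Set Z} (hD : IsOpen D) {a b : Z → E} (ha : ContinuousOn a D) (hb : ContinuousOn b D)
    (hab : ∀ z ∈ D, p (a z) = p (b z)) : IsOpen {z | z ∈ D ∧ a z = b z} := by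
  rw [isOpen_iff_mem_nhds]
  rintro z ⟨hz, hst⟩
  obtain ⟨φ, heφ, hφ⟩ := hp (a z)
  have h1 := (ha.continuousAt (hD.mem_nhds hz)).eventually (φ.open_source.mem_nhds heφ)
  have h2 := (hb.continuousAt (hD.mem_nhds hz)).eventually
    (φ.open_source.mem_nhds (by rwa [← hst]))
  filter_upwards [h1, h2, hD.mem_nhds hz] with y c d e
  refine ⟨e, φ.injOn c d ?_⟩
  rw [← hφ]
  exact hab y e

end Local

namespace EqSheaf

variable {R G X : Type u} [Ring R] [Group G] [TopologicalSpace G] [TopologicalSpace X]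
  [MulAction G X]

theorem continuous_p (F : EqSheaf R G X) : Continuous F.p := F.isLocalHomeo.continuous

/-- Through each point of a sheaf space there is a local section. -/
theorem exists_section (F : EqSheaf R G X) (e : F.E) : ∃ (U : Set X) (s : ∀ x, F.Stalk x),
    IsOpen U ∧ F.p e ∈ U ∧ ContinuousOn (fun x => (s x).1) U ∧ (s (F.p e)).1 = e := by
  classical
  obtain ⟨φ, heφ, hφ⟩ := F.isLocalHomeo e
  have hr : ∀ x ∈ φ.target, F.p (φ.symm x) = x := by
    intro x hx
    rw [hφ]
    exact φ.right_inv hx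
  refine ⟨φ.target, fun x => if h : F.p (φ.symm x) = x then ⟨φ.symm x, h⟩ else 0,
    φ.open_target, ?_, ?_, ?_⟩
  · rw [hφ]
    exact φ.map_source heφ
  · refine φ.continuousOn_symm.congr fun x hx => ?_
    simp only [dif_pos (hr x hx)]
  · have h1 : F.p e ∈ φ.target := by
      rw [hφ]
      exact φ.map_source heφ
    simp only [dif_pos (hr _ h1)]
    rw [hφ]
    exact φ.left_inv heφ

theorem continuousOn_sub (F : EqSheaf R G X) {U : Set X} {s t : ∀ x, F.Stalk x}
    (hs : ContinuousOn (fun x => (s x).1) U) (ht : ContinuousOn (fun x => (t x).1) U) :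
    ContinuousOn (fun x => (s x - t x).1) U := by
  rw [continuousOn_iff_continuous_domRestrict] at hs ht ⊢
  have := F.continuous_sub.comp (Continuous.subtype_mk (hs.prodMk ht)
    (fun x => ((s x.1).2.trans (t x.1).2.symm)))
  refine this.congr fun x => ?_
  have key : ∀ (y z : X) (h : y = z) (a b : F.E) (ha : F.p a = y) (hb : F.p b = y)
      (ha' : F.p a = z) (hb' : F.p b = z),
      ((⟨a, ha⟩ : F.Stalk y) - ⟨b, hb⟩).1 = ((⟨a, ha'⟩ : F.Stalk z) - ⟨b, hb'⟩).1 := by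
    intro y z h a b ha hb ha' hb'
    subst h
    rfl
  exact key _ _ (t x.1).2 _ _ _ _ (s x.1).2 (t x.1).2

theorem continuousOn_scalar (F : EqSheaf R G X) (r : R) {U : Set X} {s : ∀ x, F.Stalk x}
    (hs : ContinuousOn (fun x => (s x).1) U) :
    ContinuousOn (fun x => (r • s x).1) U := by
  rw [continuousOn_iff_continuous_domRestrict] at hs ⊢
  refine ((F.continuous_scalar r).comp hs).congr fun x => ?_
  have key : ∀ (y z : X) (h : y = z) (a : F.E) (ha : F.p a = y) (ha' : F.p a = z),
      (r • (⟨a, ha⟩ : F.Stalk y)).1 = (r • (⟨a, ha'⟩ : F.Stalk z)).1 := by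
    intro y z h a ha ha'
    subst h
    rfl
  exact key _ _ (s x.1).2 _ _ (s x.1).2

/-- The global zero section is continuous. -/
theorem continuous_zero (F : EqSheaf R G X) : Continuous fun x => (0 : F.Stalk x).1 := by
  rw [continuous_iff_continuousAt]
  intro x
  obtain ⟨U, s, hU, hx, hs, -⟩ := F.exists_section (0 : F.Stalk x).1
  rw [(0 : F.Stalk x).2] at hx
  have := F.continuousOn_sub hs hs
  simp only [sub_self] at this
  exact this.continuousAt (hU.mem_nhds hx)

/-- The linear map `g : F_x → F_(g x)`. -/
def translate (F : EqSheaf R G X) (g : G) (x : X) : F.Stalk x →ₗ[R] F.Stalk (g • x) where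
  toFun a := ⟨g • a.1, by rw [F.p_smul, a.2]⟩
  map_add' a b := Subtype.ext (F.smul_add_fib g x a b)
  map_smul' r a := Subtype.ext (F.smul_scalar_fib g x r a)

theorem smul_zero_stalk (F : EqSheaf R G X) (g : G) (x : X) :
    g • (0 : F.Stalk x).1 = (0 : F.Stalk (g • x)).1 :=
  congrArg Subtype.val (F.translate g x).map_zero

/-- The zero morphism: the projection followed by the global zero section. -/
def zeroHom (F F' : EqSheaf R G X) : Hom F F' where
  toFun e := (0 : F'.Stalk (F.p e)).1
  continuous_toFun := F'.continuous_zero.comp F.continuous_p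
  map_smul g e := by
    rw [F'.smul_zero_stalk, F.p_smul]
  map_p e := (0 : F'.Stalk (F.p e)).2
  map_add_fib x a b := by
    have key : ∀ c : F.Stalk x, (⟨(0 : F'.Stalk (F.p c.1)).1, (0 : F'.Stalk (F.p c.1)).2.trans c.2⟩ :
        F'.Stalk x) = 0 := by
      rintro ⟨c, rfl⟩
      rfl
    rw [key a, key b, add_zero]
    exact congrArg Subtype.val (key (a + b))
  map_scalar_fib x r a := by
    have key : ∀ c : F.Stalk x, (⟨(0 : F'.Stalk (F.p c.1)).1, (0 : F'.Stalk (F.p c.1)).2.trans c.2⟩ :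
        F'.Stalk x) = 0 := by
      rintro ⟨c, rfl⟩
      rfl
    rw [key a, smul_zero]
    exact congrArg Subtype.val (key (r • a))

theorem Hom.map_zero {F F' : EqSheaf R G X} (f : Hom F F') (x : X) :
    f.toFun (0 : F.Stalk x).1 = (0 : F'.Stalk x).1 := by
  have h := f.map_scalar_fib x 0 0
  rw [zero_smul, zero_smul] at h
  exact h

instance : HasZeroMorphisms (EqSheaf R G X) where
  zero F F' := ⟨zeroHom F F'⟩
  comp_zero {F F'} f F'' := by
    apply Hom.ext
    funext e
    change (0 : F''.Stalk (F'.p (Hom.toFun f e))).1 = (0 : F''.Stalk (F.p e)).1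
    rw [Hom.map_p f]
  zero_comp F {F' F''} f := by
    apply Hom.ext
    funext e
    exact Hom.map_zero f (F.p e)

/-- The fibres of the identity are one-point sets, hence zero modules. -/
def fibId (x : X) : Fib (id : X → X) x ≃ PUnit.{u + 1} where
  toFun _ := ⟨⟩
  invFun _ := ⟨x, rfl⟩
  left_inv e := Subtype.ext e.2.symm
  right_inv _ := rfl

/-- The zero sheaf `X → X`. -/
def zero [ContinuousSMul G X] : EqSheaf R G X :=
  letI _g (x : X) : AddCommGroup (Fib (id : X → X) x) := (fibId x).addCommGroup
  letI _m (x : X) : Module R (Fib (id : X → X) x) := (fibId x).module R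
  { E := X
    p := id
    p_smul := fun _ _ => rfl
    isLocalHomeo := (Homeomorph.refl X).isLocalHomeomorph
    continuous_sub := continuous_snd.comp continuous_subtype_val
    continuous_scalar := fun _ => continuous_id
    smul_add_fib := fun _ _ _ _ => rfl
    smul_scalar_fib := fun _ _ _ _ => rfl }

theorem isZero_zero [ContinuousSMul G X] : IsZero (zero : EqSheaf R G X) := by
  rw [IsZero.iff_id_eq_zero]
  apply Hom.ext
  funext e
  exact ((0 : (zero : EqSheaf R G X).Stalk ((zero : EqSheaf R G X).p e)).2).symm

end EqSheaf

/-! ### Discrete modules -/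

/-- A discrete `R[Γ]`-module: an `R`-module with a commuting linear action of `Γ` that is continuous
for the discrete topology. -/
structure DiscMod (R Γ : Type u) [Ring R] [Group Γ] [TopologicalSpace Γ] where
  M : Type u
  [grp : AddCommGroup M]
  [mod : Module R M]
  [act : DistribMulAction Γ M]
  [comm : SMulCommClass Γ R M]
  [top : TopologicalSpace M]
  [disc : DiscreteTopology M]
  [contAct : ContinuousSMul Γ M]

attribute [instance] DiscMod.grp DiscMod.mod DiscMod.act DiscMod.comm DiscMod.top DiscMod.disc
  DiscMod.contAct

namespace DiscMod

variable {R Γ Δ : Type u} [Ring R] [Group Γ] [TopologicalSpace Γ] [Group Δ] [TopologicalSpace Δ]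

/-- Morphisms of discrete modules: equivariant `R`-linear maps. -/
@[ext]
structure Hom (A B : DiscMod R Γ) where
  toLin : A.M →ₗ[R] B.M
  map_smul : ∀ (γ : Γ) (a : A.M), toLin (γ • a) = γ • toLin a

instance : Category (DiscMod R Γ) where
  Hom := Hom
  id _ := ⟨LinearMap.id, fun _ _ => rfl⟩
  comp f g := ⟨g.toLin.comp f.toLin, fun γ a => by simp [f.map_smul, g.map_smul]⟩

/-- Restriction of a discrete module along a continuous homomorphism. -/
def res (φ : Δ →* Γ) (hφ : Continuous φ) (A : DiscMod R Γ) : DiscMod R Δ :=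
  letI := DistribMulAction.compHom A.M φ
  { M := A.M
    comm := ⟨fun d r a => smul_comm (φ d) r a⟩
    contAct := ⟨(hφ.comp continuous_fst).smul continuous_snd⟩ }

theorem isOpen_stabilizer (A : DiscMod R Γ) (a : A.M) : IsOpen {γ : Γ | γ • a = a} :=
  (isOpen_discrete {a}).preimage (continuous_id.smul continuous_const : Continuous fun γ : Γ => γ • a)

end DiscMod

/-! ### The sheaf `G ×_H M` over `G / H` -/

namespace Ind

variable {R G : Type u} [Ring R] [Group G] [TopologicalSpace G]
  {H : Subgroup G} (M : DiscMod R H)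

/-- The relation `(g h, m) ∼ (g, h m)` on `G × M`. -/
def setoid : Setoid (G × M.M) where
  r a b := ∃ h : H, b.1 = a.1 * h ∧ a.2 = h • b.2
  iseqv :=
    { refl := fun a => ⟨1, by simp⟩
      symm := by
        rintro ⟨g, m⟩ ⟨g', m'⟩ ⟨h, h1, h2⟩
        refine ⟨h⁻¹, ?_, ?_⟩
        · simp only at h1
          simp [h1]
        · simp only at h2
          simp [h2]
      trans := by
        rintro ⟨g, m⟩ ⟨g', m'⟩ ⟨g'', m''⟩ ⟨h, h1, h2⟩ ⟨k, k1, k2⟩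
        refine ⟨h * k, ?_, ?_⟩
        · simp only at h1 k1
          simp [h1, k1, mul_assoc]
        · simp only at h2 k2
          simp [h2, k2, mul_smul] }

/-- The space `G ×_H M`, with the quotient topology. -/
def Space : Type u := Quotient (setoid M)

instance : TopologicalSpace (Space M) := inferInstanceAs (TopologicalSpace (Quotient (setoid M)))

/-- The class `[g, m]`. -/
def mk (g : G) (m : M.M) : Space M := Quotient.mk (setoid M) (g, m)

variable {M}

theorem mk_eq {g g' : G} {m m' : M.M} :
    mk M g m = mk M g' m' ↔ ∃ h : H, g' = g * h ∧ m = h • m' := Quotient.eq (r := setoid M)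

theorem mk_mul (g : G) (h : H) (m : M.M) : mk M (g * h) m = mk M g (h • m) :=
  (mk_eq.2 ⟨h, rfl, rfl⟩).symm

theorem mk_surj (e : Space M) : ∃ g m, mk M g m = e := by
  obtain ⟨⟨g, m⟩, h⟩ := Quotient.exists_rep e
  exact ⟨g, m, h⟩

theorem mk_inj {g : G} {m m' : M.M} : mk M g m = mk M g m' ↔ m = m' := by
  rw [mk_eq]
  constructor
  · rintro ⟨h, h1, rfl⟩
    have : h = 1 := Subtype.ext (by simpa using h1)
    simp [this]
  · rintro rfl
    exact ⟨1, by simp⟩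

theorem continuous_mk : Continuous fun z : G × M.M => mk M z.1 z.2 := continuous_quot_mk

variable (M) in
/-- The projection `[g, m] ↦ g H`. -/
def proj : Space M → G ⧸ H :=
  Quotient.lift (fun z : G × M.M => (z.1 : G ⧸ H)) (by
    rintro ⟨g, m⟩ ⟨g', m'⟩ ⟨h, h1, -⟩
    simp only at h1
    simp [h1])

@[simp]
theorem proj_mk (g : G) (m : M.M) : proj M (mk M g m) = (g : G ⧸ H) := rfl

theorem continuous_proj : Continuous (proj M) :=
  continuous_quot_lift _ (QuotientGroup.continuous_mk.comp continuous_fst)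

theorem exists_mk_of_proj {e : Space M} {g : G} (h : proj M e = (g : G ⧸ H)) :
    ∃ m, mk M g m = e := by
  obtain ⟨g', m, rfl⟩ := mk_surj e
  rw [proj_mk, QuotientGroup.eq] at h
  refine ⟨(⟨g'⁻¹ * g, h⟩ : H)⁻¹ • m, ?_⟩
  rw [← mk_mul]
  congr 1
  simp

section Top

variable [IsTopologicalGroup G]

theorem isOpenMap_mk : IsOpenMap fun z : G × M.M => mk M z.1 z.2 := by
  intro S hS
  change IsOpen ((fun z : G × M.M => mk M z.1 z.2) ⁻¹' _)
  have : (fun z : G × M.M => mk M z.1 z.2) ⁻¹' ((fun z : G × M.M => mk M z.1 z.2) '' S) =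
      ⋃ h : H, (fun z : G × M.M => (z.1 * h, h⁻¹ • z.2)) ⁻¹' S := by
    ext ⟨g, m⟩
    simp only [Set.mem_preimage, Set.mem_image, Set.mem_iUnion, Prod.exists]
    constructor
    · rintro ⟨a, b, hab, h⟩
      obtain ⟨k, k1, k2⟩ := mk_eq.1 h.symm
      refine ⟨k, ?_⟩
      rw [k2, inv_smul_smul, ← k1]
      exact hab
    · rintro ⟨h, hh⟩
      refine ⟨_, _, hh, ?_⟩
      rw [mk_mul, smul_inv_smul]
  rw [this]
  refine isOpen_iUnion fun h => hS.preimage ?_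
  exact (continuous_fst.mul continuous_const).prodMk (continuous_snd.const_smul _)

theorem isOpenQuotientMap_mk : IsOpenQuotientMap fun z : G × M.M => mk M z.1 z.2 :=
  ⟨fun e => by
    obtain ⟨g, m, h⟩ := mk_surj e
    exact ⟨(g, m), h⟩, continuous_mk, isOpenMap_mk⟩

end Top

instance : MulAction G (Space M) where
  smul g := Quotient.map' (fun z => (g * z.1, z.2)) (by
    rintro ⟨a, m⟩ ⟨a', m'⟩ ⟨h, h1, h2⟩
    simp only at h1 h2
    exact ⟨h, by simp [h1, mul_assoc], h2⟩)
  one_smul e := by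
    obtain ⟨g, m, rfl⟩ := mk_surj e
    change mk M (1 * g) m = _
    rw [one_mul]
  mul_smul a b e := by
    obtain ⟨g, m, rfl⟩ := mk_surj e
    change mk M (a * b * g) m = mk M (a * (b * g)) m
    rw [mul_assoc]

theorem smul_mk (g a : G) (m : M.M) : g • mk M a m = mk M (g * a) m := rfl

theorem proj_smul (g : G) (e : Space M) : proj M (g • e) = g • proj M e := by
  obtain ⟨a, m, rfl⟩ := mk_surj e
  rfl

section Top

variable [IsTopologicalGroup G]

instance : ContinuousSMul G (Space M) where
  continuous_smul := by
    have h : IsOpenQuotientMap (Prod.map (id : G → G) fun z : G × M.M => mk M z.1 z.2) :=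
      IsOpenQuotientMap.id.prodMap isOpenQuotientMap_mk
    rw [h.isQuotientMap.continuous_iff]
    exact continuous_mk.comp (((continuous_fst.mul (continuous_fst.comp continuous_snd))).prodMk
      (continuous_snd.comp continuous_snd))

/-- Finitely many elements of `M` extend simultaneously to local sections `g H ↦ [g, m]`. -/
theorem exists_nhds (g : G) (S : Finset M.M) : ∃ (U : Set (G ⧸ H)) (r : G ⧸ H → G),
    IsOpen U ∧ (g : G ⧸ H) ∈ U ∧ (∀ x, (r x : G ⧸ H) = x) ∧ r (g : G ⧸ H) = g ∧
    ∀ m ∈ S, ContinuousOn (fun x => mk M (r x) m) U ∧ IsOpen ((fun x => mk M (r x) m) '' U) := by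
  classical
  have hW : IsOpen {h : H | ∀ m ∈ S, h • m = m} := by
    have : {h : H | ∀ m ∈ S, h • m = m} = ⋂ m ∈ S, {h : H | h • m = m} := by
      ext
      simp
    rw [this]
    exact isOpen_biInter_finset fun m _ => M.isOpen_stabilizer m
  obtain ⟨W, hWo, hW⟩ := isOpen_induced_iff.1 hW
  have hd : Continuous fun z : G × G => z.1⁻¹ * z.2 := continuous_fst.inv.mul continuous_snd
  have h1 : (g, g) ∈ (fun z : G × G => z.1⁻¹ * z.2) ⁻¹' W := by
    have : (1 : H) ∈ Subtype.val ⁻¹' W := by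
      rw [hW]
      simp
    simpa using this
  obtain ⟨V, V', hV, hV', hgV, hgV', hVV⟩ := isOpen_prod_iff.1 (hWo.preimage hd) g g h1
  have hmk : ∀ k ∈ V ∩ V', ∀ k' ∈ V ∩ V', (k : G ⧸ H) = k' → ∀ m ∈ S, mk M k m = mk M k' m := by
    intro k hk k' hk' e m hm
    rw [QuotientGroup.eq] at e
    refine mk_eq.2 ⟨⟨k⁻¹ * k', e⟩, by simp, ?_⟩
    have h2 : k⁻¹ * k' ∈ W := hVV (Set.mk_mem_prod hk.1 hk'.2)
    have h3 : (⟨k⁻¹ * k', e⟩ : H) ∈ Subtype.val ⁻¹' W := h2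
    rw [hW] at h3
    exact (h3 m hm).symm
  let U : Set (G ⧸ H) := (fun k : G => (k : G ⧸ H)) '' (V ∩ V')
  let r : G ⧸ H → G := fun x => if x = (g : G ⧸ H) then g else
    if h : ∃ k ∈ V ∩ V', (k : G ⧸ H) = x then h.choose else x.out
  have hr : ∀ x, (r x : G ⧸ H) = x := by
    intro x
    by_cases hx : x = (g : G ⧸ H)
    · simp only [r, if_pos hx]
      exact hx.symm
    · by_cases h : ∃ k ∈ V ∩ V', (k : G ⧸ H) = x
      · simp only [r, if_neg hx, dif_pos h]
        exact h.choose_spec.2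
      · simp only [r, if_neg hx, dif_neg h]
        exact QuotientGroup.out_eq' x
  have hrV : ∀ x ∈ U, r x ∈ V ∩ V' := by
    intro x h
    by_cases hx : x = (g : G ⧸ H)
    · simp only [r, if_pos hx]
      exact ⟨hgV, hgV'⟩
    · have h' : ∃ k ∈ V ∩ V', (k : G ⧸ H) = x := h
      simp only [r, if_neg hx, dif_pos h']
      exact h'.choose_spec.1
  have hVo := hV.inter hV'
  refine ⟨U, r, QuotientGroup.isOpenMap_coe _ hVo, ⟨g, ⟨hgV, hgV'⟩, rfl⟩, hr, by simp [r], ?_⟩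
  intro m hm
  have key : ∀ k ∈ V ∩ V', mk M (r (k : G ⧸ H)) m = mk M k m := fun k hk =>
    hmk _ (hrV _ ⟨k, hk, rfl⟩) _ hk (hr _) m hm
  constructor
  · rw [continuousOn_iff']
    intro t ht
    refine ⟨(fun k : G => (k : G ⧸ H)) '' (V ∩ V' ∩ {k | mk M k m ∈ t}), ?_, ?_⟩
    · refine QuotientGroup.isOpenMap_coe _ (hVo.inter (ht.preimage ?_))
      exact continuous_mk.comp (continuous_id.prodMk continuous_const)
    · ext x
      constructor
      · rintro ⟨hx, k, hk, rfl⟩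
        refine ⟨⟨k, ⟨hk, ?_⟩, rfl⟩, k, hk, rfl⟩
        simpa [key k hk] using hx
      · rintro ⟨⟨k, hk, rfl⟩, -⟩
        refine ⟨?_, k, hk.1, rfl⟩
        simpa [key k hk.1] using hk.2
  · have : (fun x => mk M (r x) m) '' U = (fun z : G × M.M => mk M z.1 z.2) '' ((V ∩ V') ×ˢ {m}) := by
      ext e
      constructor
      · rintro ⟨_, ⟨k, hk, rfl⟩, rfl⟩
        exact ⟨(k, m), ⟨hk, rfl⟩, (key k hk).symm⟩
      · rintro ⟨⟨k, m'⟩, ⟨hk, hm'⟩, rfl⟩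
        obtain rfl : m' = m := hm'
        exact ⟨_, ⟨k, hk, rfl⟩, key k hk⟩
    rw [this]
    exact isOpenMap_mk _ (hVo.prod (isOpen_discrete _))

theorem isLocalHomeomorph_proj : IsLocalHomeomorph (proj M) := by
  refine isLocalHomeomorph_of_sections continuous_proj fun e => ?_
  obtain ⟨g, m, rfl⟩ := mk_surj e
  obtain ⟨U, r, hU, hg, hr, hrg, h⟩ := exists_nhds (M := M) g {m}
  obtain ⟨h1, h2⟩ := h m (by simp)
  exact ⟨U, fun x => mk M (r x) m, hU, hg, by simp only [proj_mk, hrg], h1,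
    fun x _ => by simp only [proj_mk, hr], h2⟩

end Top

/-- Each representative `g` of `x` gives a bijection `m ↦ [g, m]` from `M` to the fibre. -/
noncomputable def fibEquivOf (x : G ⧸ H) (g : G) (hg : (g : G ⧸ H) = x) : M.M ≃ Fib (proj M) x :=
  Equiv.ofBijective (fun m => ⟨mk M g m, hg⟩) (by
    constructor
    · intro a b h
      exact mk_inj.1 (congrArg Subtype.val h)
    · rintro ⟨e, he⟩
      obtain ⟨m, hm⟩ := exists_mk_of_proj (he.trans hg.symm)
      exact ⟨m, Subtype.ext hm⟩)

/-- The module structure on the fibre over `x`, transported along `m ↦ [g, m]` for a representative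
`g` of `x`; it does not depend on `g`, see `mk_add_mk` and `scalar_mk`. -/
noncomputable instance fibGroup (x : G ⧸ H) : AddCommGroup (Fib (proj M) x) :=
  (fibEquivOf x x.out (QuotientGroup.out_eq' x)).symm.addCommGroup

noncomputable instance fibModule (x : G ⧸ H) : Module R (Fib (proj M) x) :=
  (fibEquivOf x x.out (QuotientGroup.out_eq' x)).symm.module R

theorem exists_out (g : G) : ∃ h : H, ∀ m : M.M, mk M g m = mk M (g : G ⧸ H).out (h • m) := by
  have : ((g : G ⧸ H).out)⁻¹ * g ∈ H := by
    rw [← QuotientGroup.eq]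
    exact QuotientGroup.out_eq' _
  refine ⟨⟨_, this⟩, fun m => ?_⟩
  rw [← mk_mul]
  simp

theorem fib_add_eq (x : G ⧸ H) (a b : M.M) :
    (fibEquivOf x x.out (QuotientGroup.out_eq' x)) a +
      (fibEquivOf x x.out (QuotientGroup.out_eq' x)) b =
      (fibEquivOf x x.out (QuotientGroup.out_eq' x)) (a + b) := by
  simp [Equiv.add_def]

theorem fib_scalar_eq (x : G ⧸ H) (r : R) (a : M.M) :
    r • (fibEquivOf x x.out (QuotientGroup.out_eq' x)) a =
      (fibEquivOf x x.out (QuotientGroup.out_eq' x)) (r • a) := by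
  simp [Equiv.smul_def]

theorem mk_add_mk (x : G ⧸ H) (g : G) (hg : (g : G ⧸ H) = x) (a b : M.M) :
    (⟨mk M g a, hg⟩ : Fib (proj M) x) + ⟨mk M g b, hg⟩ = ⟨mk M g (a + b), hg⟩ := by
  subst hg
  obtain ⟨h, hh⟩ := exists_out (M := M) g
  have key : ∀ m, (⟨mk M g m, rfl⟩ : Fib (proj M) (g : G ⧸ H)) =
      fibEquivOf (g : G ⧸ H) (g : G ⧸ H).out (QuotientGroup.out_eq' _) (h • m) := fun m =>
    Subtype.ext (hh m)
  rw [key a, key b, key (a + b), fib_add_eq, smul_add]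

theorem scalar_mk (x : G ⧸ H) (g : G) (hg : (g : G ⧸ H) = x) (r : R) (a : M.M) :
    r • (⟨mk M g a, hg⟩ : Fib (proj M) x) = ⟨mk M g (r • a), hg⟩ := by
  subst hg
  obtain ⟨h, hh⟩ := exists_out (M := M) g
  have key : ∀ m, (⟨mk M g m, rfl⟩ : Fib (proj M) (g : G ⧸ H)) =
      fibEquivOf (g : G ⧸ H) (g : G ⧸ H).out (QuotientGroup.out_eq' _) (h • m) := fun m =>
    Subtype.ext (hh m)
  rw [key a, key (r • a), fib_scalar_eq, smul_comm h r a]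

theorem mk_sub_mk (x : G ⧸ H) (g : G) (hg : (g : G ⧸ H) = x) (a b : M.M) :
    (⟨mk M g a, hg⟩ : Fib (proj M) x) - ⟨mk M g b, hg⟩ = ⟨mk M g (a - b), hg⟩ := by
  rw [sub_eq_iff_eq_add, mk_add_mk, sub_add_cancel]

end Ind

/-- The equivariant sheaf `G ×_H M → G / H`. -/
noncomputable def indSheaf {R G : Type u} [Ring R] [Group G] [TopologicalSpace G]
    [IsTopologicalGroup G] {H : Subgroup G} (M : DiscMod R H) : EqSheaf R G (G ⧸ H) where
  E := Ind.Space M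
  p := Ind.proj M
  p_smul := Ind.proj_smul
  isLocalHomeo := Ind.isLocalHomeomorph_proj
  continuous_sub := by
    classical
    refine continuous_sub_of_sections Ind.isLocalHomeomorph_proj ?_
    rintro x ⟨a, ha⟩ ⟨b, hb⟩
    obtain ⟨g, rfl⟩ := QuotientGroup.mk_surjective x
    obtain ⟨m, rfl⟩ := Ind.exists_mk_of_proj ha
    obtain ⟨n, rfl⟩ := Ind.exists_mk_of_proj hb
    obtain ⟨U, r, hU, hg, hr, hrg, h⟩ := Ind.exists_nhds (M := M) g {m, n, m - n}
    refine ⟨U, fun x => Ind.mk M (r x) m, fun x => Ind.mk M (r x) n,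
      fun x => Ind.mk M (r x) (m - n), hU, hg, (h m (by simp)).1, (h n (by simp)).1,
      (h (m - n) (by simp)).1, by simp only [hrg], by simp only [hrg], ?_⟩
    intro y hy
    exact ⟨hr y, hr y, by rw [Ind.mk_sub_mk]⟩
  continuous_scalar s := by
    classical
    refine continuous_scalar_of_sections Ind.isLocalHomeomorph_proj s ?_
    rintro x ⟨a, ha⟩
    obtain ⟨g, rfl⟩ := QuotientGroup.mk_surjective x
    obtain ⟨m, rfl⟩ := Ind.exists_mk_of_proj ha
    obtain ⟨U, r, hU, hg, hr, hrg, h⟩ := Ind.exists_nhds (M := M) g {m, s • m}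
    refine ⟨U, fun x => Ind.mk M (r x) m, fun x => Ind.mk M (r x) (s • m), hU, hg,
      (h m (by simp)).1, (h (s • m) (by simp)).1, by simp only [hrg], ?_⟩
    intro y hy
    exact ⟨hr y, by rw [Ind.scalar_mk]⟩
  smul_add_fib := by
    rintro g x ⟨a, ha⟩ ⟨b, hb⟩
    obtain ⟨k, rfl⟩ := QuotientGroup.mk_surjective x
    obtain ⟨m, rfl⟩ := Ind.exists_mk_of_proj ha
    obtain ⟨n, rfl⟩ := Ind.exists_mk_of_proj hb
    rw [Ind.mk_add_mk (k : G ⧸ H) k rfl m n]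
    exact (congrArg Subtype.val (Ind.mk_add_mk (g • (k : G ⧸ H)) (g * k) rfl m n)).symm
  smul_scalar_fib := by
    rintro g x r ⟨a, ha⟩
    obtain ⟨k, rfl⟩ := QuotientGroup.mk_surjective x
    obtain ⟨m, rfl⟩ := Ind.exists_mk_of_proj ha
    rw [Ind.scalar_mk (k : G ⧸ H) k rfl r m]
    exact (congrArg Subtype.val (Ind.scalar_mk (g • (k : G ⧸ H)) (g * k) rfl r m)).symm

/-! ### Extension by zero along an equivariant closed embedding -/

namespace Ext

variable {R G X Y : Type u} [Ring R] [Group G] [TopologicalSpace G]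
  [TopologicalSpace X] [MulAction G X] [TopologicalSpace Y] [MulAction G Y]
  (f : Y →[G] X) (F : EqSheaf R G Y)

/-- The sheaf space of the push forward of `F` along a closed embedding `f`. A point over `x` is a
section of `F` over `f ⁻¹ x`; so the fibre over `f y` is `F_y`, and the fibre over a point outside
the image of `f` is zero. -/
structure Space : Type u where
  pt : X
  val : ∀ y : Y, f y = pt → F.Stalk y

variable {f F}

theorem Space.ext_val {a b : Space f F} (h : a.pt = b.pt)
    (h' : ∀ y (ha : f y = a.pt) (hb : f y = b.pt), a.val y ha = b.val y hb) : a = b := by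
  obtain ⟨x, v⟩ := a
  obtain ⟨x', v'⟩ := b
  obtain rfl : x = x' := h
  congr 1
  funext y hy
  exact h' y hy hy

theorem Space.val_congr (a : Space f F) {y y' : Y} (h : y = y') (hy : f y = a.pt)
    (hy' : f y' = a.pt) : (a.val y hy).1 = (a.val y' hy').1 := by
  subst h
  rfl

variable (f) in
/-- The germ at `x` of the section of the push forward given by a section `s` of `F`. -/
def sec (s : ∀ y, F.Stalk y) (x : X) : Space f F := ⟨x, fun y _ => s y⟩

/-- The topology of a sheaf space: a basis is given by the sets of germs `{s_x | x ∈ U}`, for `U`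
open in `X` and `s` a continuous section of `F` on `f ⁻¹ U` (extended arbitrarily to a function on
`Y`, which does not affect its germs on `U`). -/
instance : TopologicalSpace (Space f F) :=
  TopologicalSpace.generateFrom {B | ∃ (U : Set X) (s : ∀ y, F.Stalk y), IsOpen U ∧
    ContinuousOn (fun y => (s y).1) (f ⁻¹' U) ∧ B = sec f s '' U}

theorem isOpen_sec {U : Set X} {s : ∀ y, F.Stalk y} (hU : IsOpen U)
    (hs : ContinuousOn (fun y => (s y).1) (f ⁻¹' U)) : IsOpen (sec f s '' U) :=
  TopologicalSpace.isOpen_generateFrom_of_mem ⟨U, s, hU, hs, rfl⟩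

theorem sec_eq_iff {s : ∀ y, F.Stalk y} {a : Space f F} {x : X} (h : x = a.pt) :
    sec f s x = a ↔ ∀ y (hy : f y = a.pt), s y = a.val y hy := by
  subst h
  constructor
  · intro h y hy
    obtain ⟨x, v⟩ := a
    injection h with h1 h2
    exact congrFun (congrFun h2 y) hy
  · intro h
    exact Space.ext_val rfl fun y _ hy => h y hy

theorem isOpen_agree (hf : IsClosedEmbedding f) {U : Set X} (hU : IsOpen U) {s t : ∀ y, F.Stalk y}
    (hs : ContinuousOn (fun y => (s y).1) (f ⁻¹' U))
    (ht : ContinuousOn (fun y => (t y).1) (f ⁻¹' U)) :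
    IsOpen {x | x ∈ U ∧ sec f s x = sec f t x} := by
  have h := isOpen_lift_eq F.isLocalHomeo (hU.preimage hf.continuous) hs ht
    (fun y _ => (s y).2.trans (t y).2.symm)
  obtain ⟨V, hV, hVe⟩ := hf.isInducing.isOpen_iff.1 h
  have : {x | x ∈ U ∧ sec f s x = sec f t x} = U ∩ (V ∪ (Set.range f)ᶜ) := by
    ext x
    refine and_congr_right fun hx => ?_
    rw [sec_eq_iff (a := sec f t x) (x := x) rfl]
    constructor
    · intro h1
      by_cases hr : x ∈ Set.range f
      · left
        obtain ⟨y, rfl⟩ := hr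
        change y ∈ f ⁻¹' V
        rw [hVe]
        exact ⟨hx, congrArg Subtype.val (h1 y rfl)⟩
      · exact Or.inr hr
    · rintro (h1 | h1) y hy
      · have hy' : y ∈ f ⁻¹' V := by
          change f y ∈ V
          rw [hy]
          exact h1
        rw [hVe] at hy'
        exact Subtype.ext hy'.2
      · exact (h1 ⟨y, hy⟩).elim
  rw [this]
  exact hU.inter (hV.union hf.isClosed_range.isOpen_compl)

theorem exists_sec (hf : IsClosedEmbedding f) (a : Space f F) : ∃ (U : Set X) (s : ∀ y, F.Stalk y), IsOpen U ∧ a.pt ∈ U ∧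
    ContinuousOn (fun y => (s y).1) (f ⁻¹' U) ∧ sec f s a.pt = a := by
  by_cases h : a.pt ∈ Set.range f
  · obtain ⟨y, hy⟩ := h
    obtain ⟨V, s, hV, hyV, hs, hse⟩ := F.exists_section (a.val y hy).1
    rw [(a.val y hy).2] at hyV hse
    obtain ⟨U, hU, rfl⟩ := hf.isInducing.isOpen_iff.1 hV
    refine ⟨U, s, hU, by rw [← hy]; exact hyV, hs, ?_⟩
    rw [sec_eq_iff rfl]
    intro y' hy'
    obtain rfl : y = y' := hf.injective (hy.trans hy'.symm)
    exact Subtype.ext hse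
  · refine ⟨(Set.range f)ᶜ, fun _ => 0, hf.isClosed_range.isOpen_compl, h, ?_, ?_⟩
    · exact F.continuous_zero.continuousOn
    · rw [sec_eq_iff rfl]
      intro y hy
      exact (h ⟨y, hy⟩).elim

theorem continuousOn_sec (hf : IsClosedEmbedding f) {U : Set X} (hU : IsOpen U) {s : ∀ y, F.Stalk y}
    (hs : ContinuousOn (fun y => (s y).1) (f ⁻¹' U)) : ContinuousOn (sec f s) U := by
  refine continuousOn_to_generateFrom_iff.2 ?_
  rintro x hx _ ⟨V, t, hV, ht, rfl⟩ ⟨x', hx', he⟩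
  obtain rfl : x' = x := congrArg Space.pt he
  have h := isOpen_agree hf (hU.inter hV) (hs.mono fun _ h => h.1) (ht.mono fun _ h => h.2)
  refine mem_nhdsWithin_of_mem_nhds ?_
  filter_upwards [h.mem_nhds ⟨⟨hx, hx'⟩, he.symm⟩] with z hz
  exact ⟨z, hz.1.2, hz.2.symm⟩

theorem continuous_pt (hf : IsClosedEmbedding f) : Continuous (Space.pt : Space f F → X) := by
  rw [continuous_iff_continuousAt]
  intro a V hV
  obtain ⟨W, hWV, hW, haW⟩ := mem_nhds_iff.1 hV
  obtain ⟨U, s, hU, hx, hs, hse⟩ := exists_sec hf a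
  refine Filter.mem_map.2 (Filter.mem_of_superset ((isOpen_sec (hU.inter hW)
    (hs.mono fun _ h => h.1)).mem_nhds ⟨a.pt, ⟨hx, haW⟩, hse⟩) ?_)
  rintro _ ⟨x, ⟨-, h2⟩, rfl⟩
  exact hWV h2

theorem isLocalHomeomorph_pt (hf : IsClosedEmbedding f) : IsLocalHomeomorph (Space.pt : Space f F → X) := by
  refine isLocalHomeomorph_of_sections (continuous_pt hf) fun a => ?_
  obtain ⟨U, s, hU, hx, hs, hse⟩ := exists_sec hf a
  exact ⟨U, sec f s, hU, hx, hse, continuousOn_sec hf hU hs, fun _ _ => rfl, isOpen_sec hU hs⟩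

/-- The fibre over `x` is the module of sections of `F` over `f ⁻¹ x`. -/
def fibEquiv (x : X) : Fib (Space.pt : Space f F → X) x ≃ ∀ y : {y : Y // f y = x}, F.Stalk y.1 where
  toFun a y := a.1.val y.1 (y.2.trans a.2.symm)
  invFun v := ⟨⟨x, fun y hy => v ⟨y, hy⟩⟩, rfl⟩
  left_inv a := Subtype.ext (Space.ext_val a.2.symm fun _ _ _ => rfl)
  right_inv _ := rfl

instance (x : X) : AddCommGroup (Fib (Space.pt : Space f F → X) x) := (fibEquiv x).addCommGroup

instance (x : X) : Module R (Fib (Space.pt : Space f F → X) x) := (fibEquiv x).module R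

/-- The action `(g t) (y) = g (t (g⁻¹ y))`. -/
instance : MulAction G (Space f F) where
  smul g a := ⟨g • a.pt, fun y hy => ⟨g • (a.val (g⁻¹ • y) (by
    rw [map_smul, hy, inv_smul_smul])).1, by rw [F.p_smul, (a.val (g⁻¹ • y) _).2, smul_inv_smul]⟩⟩
  one_smul a := Space.ext_val (one_smul G a.pt) fun y h1 h2 => Subtype.ext (by
    change (1 : G) • (a.val ((1 : G)⁻¹ • y) _).1 = _
    rw [one_smul]
    exact a.val_congr (by rw [inv_one, one_smul]) _ _)
  mul_smul g h a := Space.ext_val (mul_smul g h a.pt) fun y h1 h2 => Subtype.ext (by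
    change (g * h) • (a.val ((g * h)⁻¹ • y) _).1 = g • h • (a.val (h⁻¹ • g⁻¹ • y) _).1
    rw [mul_smul]
    exact congrArg (fun e => g • h • e) (a.val_congr (by rw [mul_inv_rev, mul_smul]) _ _))

theorem smul_pt (g : G) (a : Space f F) : (g • a).pt = g • a.pt := rfl

theorem smul_val (g : G) (a : Space f F) (y : Y) (hy : f y = a.pt) (hy' : f (g • y) = (g • a).pt) :
    ((g • a).val (g • y) hy').1 = g • (a.val y hy).1 := by
  change g • (a.val (g⁻¹ • g • y) _).1 = _
  exact congrArg (fun e => g • e) (a.val_congr (inv_smul_smul g y) _ _)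

end Ext

/-- The extension by zero `f_* F` of an equivariant sheaf along an equivariant closed embedding. -/
def extByZero {R G X Y : Type u} [Ring R] [Group G] [TopologicalSpace G]
    [TopologicalSpace X] [MulAction G X] [TopologicalSpace Y] [MulAction G Y]
    [ContinuousSMul G X] [ContinuousSMul G Y]
    (f : Y →[G] X) (hf : IsClosedEmbedding f) (F : EqSheaf R G Y) : EqSheaf R G X where
  E := Ext.Space f F
  p := Ext.Space.pt
  p_smul _ _ := rfl
  contAct := by
    refine ⟨continuous_generateFrom_iff.2 ?_⟩
    rintro _ ⟨U, s, hU, hs, rfl⟩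
    rw [isOpen_iff_mem_nhds]
    rintro ⟨g, a⟩ ⟨x, hx, he⟩
    obtain rfl : x = g • a.pt := congrArg Ext.Space.pt he
    obtain ⟨V, t, hV, haV, ht, hta⟩ := Ext.exists_sec hf a
    have hD : IsOpen {z : G × Y | f z.2 ∈ V ∧ f (z.1 • z.2) ∈ U} :=
      (hV.preimage (hf.continuous.comp continuous_snd)).inter
        (hU.preimage (hf.continuous.comp continuous_smul))
    have h1 : ContinuousOn (fun z : G × Y => z.1 • (t z.2).1)
        {z : G × Y | f z.2 ∈ V ∧ f (z.1 • z.2) ∈ U} :=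
      continuous_fst.continuousOn.smul (ht.comp continuous_snd.continuousOn fun z hz => hz.1)
    have h2 : ContinuousOn (fun z : G × Y => (s (z.1 • z.2)).1)
        {z : G × Y | f z.2 ∈ V ∧ f (z.1 • z.2) ∈ U} :=
      hs.comp continuous_smul.continuousOn fun z hz => hz.2
    have hC := isOpen_lift_eq F.isLocalHomeo hD h1 h2 (fun z _ => by
      rw [F.p_smul, (t z.2).2, (s (z.1 • z.2)).2])
    have hf' : IsClosedEmbedding (Prod.map (id : G → G) f) := IsClosedEmbedding.id.prodMap hf
    obtain ⟨W, hW, hWe⟩ := hf'.isInducing.isOpen_iff.1 hC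
    have hA : IsOpen {z : G × X | z.2 ∈ V ∧ z.1 • z.2 ∈ U ∧
        (z ∈ W ∨ z ∉ Set.range (Prod.map (id : G → G) f))} :=
      (hV.preimage continuous_snd).inter ((hU.preimage continuous_smul).inter
        (hW.union hf'.isClosed_range.isOpen_compl))
    have hN : IsOpen {z : G × Ext.Space f F | z.2 ∈ Ext.sec f t '' V ∧
        (z.1, z.2.pt) ∈ {z : G × X | z.2 ∈ V ∧ z.1 • z.2 ∈ U ∧
        (z ∈ W ∨ z ∉ Set.range (Prod.map (id : G → G) f))}} :=
      ((Ext.isOpen_sec hV ht).preimage continuous_snd).inter (hA.preimage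
        (continuous_fst.prodMk ((Ext.continuous_pt hf).comp continuous_snd)))
    refine Filter.mem_of_superset (hN.mem_nhds ⟨⟨a.pt, haV, hta⟩, haV, hx, ?_⟩) ?_
    · by_cases hr : (g, a.pt) ∈ Set.range (Prod.map (id : G → G) f)
      · left
        obtain ⟨⟨g', y⟩, hy⟩ := hr
        obtain ⟨rfl, hy2⟩ := Prod.mk.inj hy
        rw [← hy]
        change (g', y) ∈ Prod.map (id : G → G) f ⁻¹' W
        rw [hWe]
        have hy3 : f (g' • y) = g' • a.pt := by rw [map_smul, hy2]
        refine ⟨⟨by rw [hy2]; exact haV, by rw [hy3]; exact hx⟩, ?_⟩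
        have e1 := (Ext.sec_eq_iff rfl).1 hta y hy2
        have e2 := (Ext.sec_eq_iff (s := s) (a := g' • a) rfl).1 he (g' • y) hy3
        change g' • (t y).1 = (s (g' • y)).1
        rw [e2, e1]
        exact (Ext.smul_val g' a y hy2 _).symm
      · exact Or.inr hr
    · rintro ⟨g', b⟩ ⟨⟨x, hxV, rfl⟩, -, h4, h5⟩
      refine ⟨g' • x, h4, ?_⟩
      change Ext.sec f s (g' • x) = g' • Ext.sec f t x
      rw [Ext.sec_eq_iff (a := g' • Ext.sec f t x) (x := g' • x) rfl]
      intro y hy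
      obtain ⟨y, rfl⟩ : ∃ y', g' • y' = y := ⟨g'⁻¹ • y, smul_inv_smul g' y⟩
      have hyx : f y = x := by
        have h6 : f (g' • y) = g' • x := hy
        rw [map_smul] at h6
        exact smul_left_cancel g' h6
      apply Subtype.ext
      rw [Ext.smul_val g' (Ext.sec f t x) y hyx]
      rcases h5 with h5 | h5
      · have : (g', y) ∈ Prod.map (id : G → G) f ⁻¹' W := by
          change (g', f y) ∈ W
          rw [hyx]
          exact h5
        rw [hWe] at this
        exact this.2.symm
      · exact (h5 ⟨(g', y), Prod.ext rfl hyx⟩).elim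
  isLocalHomeo := Ext.isLocalHomeomorph_pt hf
  continuous_sub := by
    refine continuous_sub_of_sections (Ext.isLocalHomeomorph_pt hf) ?_
    rintro x ⟨a, rfl⟩ ⟨b, hb⟩
    obtain ⟨U, s, hU, haU, hs, hsa⟩ := Ext.exists_sec hf a
    obtain ⟨V, t, hV, hbV, ht, htb⟩ := Ext.exists_sec hf b
    rw [hb] at hbV htb
    have hs' := hs.mono (fun y (h : y ∈ f ⁻¹' (U ∩ V)) => h.1)
    have ht' := ht.mono (fun y (h : y ∈ f ⁻¹' (U ∩ V)) => h.2)
    exact ⟨U ∩ V, Ext.sec f s, Ext.sec f t, Ext.sec f fun y => s y - t y, hU.inter hV, ⟨haU, hbV⟩,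
      Ext.continuousOn_sec hf (hU.inter hV) hs', Ext.continuousOn_sec hf (hU.inter hV) ht',
      Ext.continuousOn_sec hf (hU.inter hV) (F.continuousOn_sub hs' ht'), hsa, htb,
      fun y _ => ⟨rfl, rfl, rfl⟩⟩
  continuous_scalar r := by
    refine continuous_scalar_of_sections (Ext.isLocalHomeomorph_pt hf) r ?_
    rintro x ⟨a, rfl⟩
    obtain ⟨U, s, hU, haU, hs, hsa⟩ := Ext.exists_sec hf a
    exact ⟨U, Ext.sec f s, Ext.sec f fun y => r • s y, hU, haU,
      Ext.continuousOn_sec hf hU hs, Ext.continuousOn_sec hf hU (F.continuousOn_scalar r hs), hsa,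
      fun y _ => ⟨rfl, rfl⟩⟩
  smul_add_fib g x a b := by
    refine Ext.Space.ext_val rfl fun y h1 h2 => Subtype.ext ?_
    have h3 := F.smul_add_fib g (g⁻¹ • y) (a.1.val (g⁻¹ • y) (by
      rw [map_smul, a.2]; exact inv_smul_eq_iff.2 h2)) (b.1.val (g⁻¹ • y) (by
      rw [map_smul, b.2]; exact inv_smul_eq_iff.2 h2))
    have key : ∀ (z : Y) (h : g • g⁻¹ • y = z) (c d : F.E) (hc : F.p c = g • g⁻¹ • y)
        (hd : F.p d = g • g⁻¹ • y), ((⟨c, hc⟩ : F.Stalk (g • g⁻¹ • y)) + ⟨d, hd⟩).1 =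
        ((⟨c, hc.trans h⟩ : F.Stalk z) + ⟨d, hd.trans h⟩).1 := by
      rintro _ rfl c d hc hd
      rfl
    exact h3.trans (key y (smul_inv_smul g y) _ _ _ _)
  smul_scalar_fib g x r a := by
    refine Ext.Space.ext_val rfl fun y h1 h2 => Subtype.ext ?_
    have h3 := F.smul_scalar_fib g (g⁻¹ • y) r (a.1.val (g⁻¹ • y) (by
      rw [map_smul, a.2]; exact inv_smul_eq_iff.2 h2))
    have key : ∀ (z : Y) (h : g • g⁻¹ • y = z) (c : F.E) (hc : F.p c = g • g⁻¹ • y),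
        (r • (⟨c, hc⟩ : F.Stalk (g • g⁻¹ • y))).1 = (r • (⟨c, hc.trans h⟩ : F.Stalk z)).1 := by
      rintro _ rfl c hc
      rfl
    exact h3.trans (key y (smul_inv_smul g y) _ _)

/-! ### Equivariant skyscraper sheaves -/

section Skyscraper

variable {R G X : Type u} [Ring R] [Group G] [TopologicalSpace G] [IsTopologicalGroup G]
  [CompactSpace G] [TopologicalSpace X] [T2Space X] [MulAction G X] [ContinuousSMul G X]

variable (G) in
/-- The inclusion of the orbit of `x`, as the map `G / stab x → X`, `g stab x ↦ g x`. -/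
def orbitMap (x : X) : (G ⧸ MulAction.stabilizer G x) →[G] X where
  toFun := MulAction.ofQuotientStabilizer G x
  map_smul' := MulAction.ofQuotientStabilizer_smul G x

theorem isClosedEmbedding_orbitMap (x : X) : IsClosedEmbedding (orbitMap G x) :=
  Continuous.isClosedEmbedding
    (continuous_quot_lift _ (continuous_id.smul continuous_const))
    (MulAction.injective_ofQuotientStabilizer G x)

/-- The equivariant skyscraper `i_* (G ×_(stab x) M)` of a discrete `R[stab x]`-module `M` over the
orbit of `x`. -/
noncomputable def skyscraper (x : X) (M : DiscMod R (MulAction.stabilizer G x)) : EqSheaf R G X :=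
  extByZero (orbitMap G x) (isClosedEmbedding_orbitMap x) (indSheaf M)

/-- The identification of `M` with the stalk at `x` of its skyscraper: `a` corresponds to the point
`[1, a]` over `x`. -/
noncomputable def skyscraperGerm (x : X) (M : DiscMod R (MulAction.stabilizer G x)) (a : M.M) :
    (skyscraper x M).Stalk x :=
  ⟨⟨x, fun _ hy => ⟨Ind.mk M 1 a, MulAction.injective_ofQuotientStabilizer G x
    ((one_smul G x).trans hy.symm)⟩⟩, rfl⟩

end Skyscraper

/-! ### The space of closed subgroups -/

section ClosedSubgroups

variable {G : Type u} [Group G] [TopologicalSpace G]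

/-- The map `p_N : K ↦ K N / N` on subgroups. -/
def subgroupImage (N : OpenNormalSubgroup G) (K : ClosedSubgroup G) :
    Subgroup (G ⧸ N.toSubgroup) :=
  K.toSubgroup.map (QuotientGroup.mk' N.toSubgroup)

/-- The topology on the set of closed subgroups of `G` with basis the sets
`{L | L N / N = K N / N}`, for `N` an open normal subgroup and `K` a closed subgroup. -/
instance : TopologicalSpace (ClosedSubgroup G) :=
  TopologicalSpace.generateFrom {B | ∃ (N : OpenNormalSubgroup G) (K : ClosedSubgroup G),
    B = {L | subgroupImage N L = subgroupImage N K}}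

variable [IsTopologicalGroup G]

/-- The conjugation action `g • K = g K g⁻¹` on closed subgroups. -/
instance : MulAction G (ClosedSubgroup G) where
  smul g K := ⟨K.toSubgroup.map (MulAut.conj g).toMonoidHom, by
    have : (K.toSubgroup.map (MulAut.conj g).toMonoidHom : Set G) =
        (fun x => g⁻¹ * x * g) ⁻¹' (K : Set G) := by
      ext x
      constructor
      · rintro ⟨k, hk, rfl⟩
        change g⁻¹ * (g * k * g⁻¹) * g ∈ K.toSubgroup
        have : g⁻¹ * (g * k * g⁻¹) * g = k := by group
        rwa [this]
      · intro hx
        exact ⟨g⁻¹ * x * g, hx, by simp [mul_assoc]⟩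
    change IsClosed (K.toSubgroup.map (MulAut.conj g).toMonoidHom : Set G)
    rw [this]
    exact K.isClosed'.preimage ((continuous_const.mul continuous_id).mul continuous_const)⟩
  one_smul K := ClosedSubgroup.toSubgroup_injective (by
    change K.toSubgroup.map (MulAut.conj (1 : G)).toMonoidHom = _
    ext
    simp)
  mul_smul g h K := ClosedSubgroup.toSubgroup_injective (by
    change K.toSubgroup.map (MulAut.conj (g * h)).toMonoidHom =
      (K.toSubgroup.map (MulAut.conj h).toMonoidHom).map (MulAut.conj g).toMonoidHom
    rw [Subgroup.map_map]
    congr 1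
    ext
    simp)

theorem smul_toSubgroup (g : G) (K : ClosedSubgroup G) :
    (g • K).toSubgroup = K.toSubgroup.map (MulAut.conj g).toMonoidHom := rfl

theorem subgroupImage_smul (N : OpenNormalSubgroup G) (g : G) (K : ClosedSubgroup G) :
    subgroupImage N (g • K) =
      (subgroupImage N K).map (MulAut.conj (g : G ⧸ N.toSubgroup)).toMonoidHom := by
  unfold subgroupImage
  rw [smul_toSubgroup, Subgroup.map_map, Subgroup.map_map]
  congr 1

instance : ContinuousSMul G (ClosedSubgroup G) where
  continuous_smul := by
    refine continuous_generateFrom_iff.2 ?_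
    rintro _ ⟨N, L, rfl⟩
    rw [isOpen_iff_mem_nhds]
    rintro ⟨g, K⟩ hgK
    have h1 : IsOpen {x : G | (x : G ⧸ N.toSubgroup) = g} := by
      have : {x : G | (x : G ⧸ N.toSubgroup) = g} = (fun x => x⁻¹ * g) ⁻¹' (N : Set G) := by
        ext x
        exact QuotientGroup.eq
      rw [this]
      exact N.isOpen'.preimage (continuous_inv.mul continuous_const)
    have h2 : IsOpen {K' : ClosedSubgroup G | subgroupImage N K' = subgroupImage N K} :=
      TopologicalSpace.isOpen_generateFrom_of_mem ⟨N, K, rfl⟩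
    refine Filter.mem_of_superset ((h1.prod h2).mem_nhds ⟨rfl, rfl⟩) ?_
    rintro ⟨x, K'⟩ ⟨hx, hK'⟩
    change subgroupImage N (x • K') = subgroupImage N L
    have e : subgroupImage N (g • K) = subgroupImage N L := hgK
    have hx' : (x : G ⧸ N.toSubgroup) = g := hx
    have hK'' : subgroupImage N K' = subgroupImage N K := hK'
    rw [← e, subgroupImage_smul, subgroupImage_smul, hx', hK'']

theorem exists_subgroupImage_ne [CompactSpace G] [TotallyDisconnectedSpace G]
    {K L : ClosedSubgroup G} {g : G} (hK : g ∈ K.toSubgroup) (hL : g ∉ L.toSubgroup) :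
    ∃ N : OpenNormalSubgroup G, subgroupImage N K ≠ subgroupImage N L := by
  have ho : IsOpen ((fun x => g * x) ⁻¹' (L : Set G)ᶜ) :=
    L.isClosed'.isOpen_compl.preimage (continuous_const.mul continuous_id)
  obtain ⟨N, hN⟩ := ProfiniteGrp.exist_openNormalSubgroup_sub_open_nhds_of_one ho (by
    change g * 1 ∉ L.toSubgroup
    rwa [mul_one])
  refine ⟨N, fun h => ?_⟩
  have h1 : (g : G ⧸ N.toSubgroup) ∈ subgroupImage N K := ⟨g, hK, rfl⟩
  rw [h] at h1
  obtain ⟨l, hl, hlg⟩ := h1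
  have h2 : g⁻¹ * l ∈ N.toSubgroup := QuotientGroup.eq.1 hlg.symm
  have h3 : g * (g⁻¹ * l) ∉ L.toSubgroup := hN h2
  rw [mul_inv_cancel_left] at h3
  exact h3 hl

instance [CompactSpace G] [TotallyDisconnectedSpace G] : T2Space (ClosedSubgroup G) where
  t2 K L hKL := by
    obtain ⟨N, hN⟩ : ∃ N : OpenNormalSubgroup G, subgroupImage N K ≠ subgroupImage N L := by
      by_contra! h
      refine hKL (ClosedSubgroup.toSubgroup_injective (le_antisymm ?_ ?_))
      · intro g hg
        by_contra hg'
        obtain ⟨N, hN⟩ := exists_subgroupImage_ne hg hg'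
        exact hN (h N)
      · intro g hg
        by_contra hg'
        obtain ⟨N, hN⟩ := exists_subgroupImage_ne hg hg'
        exact hN (h N).symm
    refine ⟨_, _, TopologicalSpace.isOpen_generateFrom_of_mem ⟨N, K, rfl⟩,
      TopologicalSpace.isOpen_generateFrom_of_mem ⟨N, L, rfl⟩, rfl, rfl, ?_⟩
    rw [Set.disjoint_left]
    intro J h1 h2
    exact hN (Eq.trans (Eq.symm h1) h2)

/-- The Weyl group `W_G K = N_G K / K`, with the quotient topology. -/
abbrev WeylGroup (K : ClosedSubgroup G) : Type u :=
  Subgroup.normalizer (K.toSubgroup : Set G) ⧸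
    K.toSubgroup.subgroupOf (Subgroup.normalizer (K.toSubgroup : Set G))

/-- The stabilizer of `K` for the conjugation action is the normalizer of `K`. -/
theorem stabilizer_eq_normalizer (K : ClosedSubgroup G) :
    MulAction.stabilizer G K = Subgroup.normalizer (K.toSubgroup : Set G) := by
  ext g
  rw [MulAction.mem_stabilizer_iff, Subgroup.mem_normalizer_iff_map_conj_eq,
    ← ClosedSubgroup.toSubgroup_injective.eq_iff]
  rfl

/-- The projection from the stabilizer `N_G K` of `K` to `W_G K`. -/
def toWeylGroup (K : ClosedSubgroup G) : MulAction.stabilizer G K →* WeylGroup K :=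
  (QuotientGroup.mk' _).comp (Subgroup.inclusion (stabilizer_eq_normalizer K).le)

theorem continuous_toWeylGroup (K : ClosedSubgroup G) : Continuous (toWeylGroup K) :=
  QuotientGroup.continuous_mk.comp (continuous_inclusion (stabilizer_eq_normalizer K).le)

end ClosedSubgroups

/-! ### Weyl sheaves -/

section Weyl

variable (R G : Type u) [Ring R] [Group G] [TopologicalSpace G] [IsTopologicalGroup G]

/-- A `G`-sheaf over the space of closed subgroups is Weyl if its stalk at `K` is `K`-fixed. -/
def isWeyl : ObjectProperty (EqSheaf R G (ClosedSubgroup G)) := fun F =>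
  ∀ (K : ClosedSubgroup G) (e : F.Stalk K), ∀ k ∈ K, k • e.1 = e.1

/-- The category of Weyl-`G`-sheaves of `R`-modules. -/
abbrev WeylSheaf : Type (u + 1) := (isWeyl R G).FullSubcategory

instance : HasZeroObject (WeylSheaf R G) where
  zero := by
    refine ⟨⟨EqSheaf.zero, fun K e k hk => ?_⟩, ?_⟩
    · have h : (isWeyl R G) EqSheaf.zero := by
        intro K e k hk
        obtain ⟨e, rfl⟩ := e
        change k • (e : ClosedSubgroup G) = e
        have hk' : k ∈ (e : ClosedSubgroup G).toSubgroup := hk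
        have h2 := Subgroup.le_normalizer hk'
        rw [← stabilizer_eq_normalizer (e : ClosedSubgroup G)] at h2
        exact h2
      exact h K e k hk
    · rw [IsZero.iff_id_eq_zero]
      apply ObjectProperty.hom_ext
      exact (IsZero.iff_id_eq_zero _).1 EqSheaf.isZero_zero

variable {R G}
variable [CompactSpace G] [TotallyDisconnectedSpace G]

theorem isWeyl_skyscraper (K : ClosedSubgroup G) (A : DiscMod R (WeylGroup K)) :
    isWeyl R G (skyscraper K (A.res (toWeylGroup K) (continuous_toWeylGroup K))) := by
  rintro L ⟨e, rfl⟩ l hl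
  have hl' : l ∈ Ext.Space.pt e := hl
  have hlL : l • Ext.Space.pt e = Ext.Space.pt e := by
    have h2 := Subgroup.le_normalizer hl'
    rw [← stabilizer_eq_normalizer] at h2
    exact h2
  refine Ext.Space.ext_val hlL fun y h1 h2 => Subtype.ext ?_
  obtain ⟨g, rfl⟩ := QuotientGroup.mk_surjective y
  have hg : g • K = Ext.Space.pt e := h2
  have hk : g⁻¹ * l * g ∈ K.toSubgroup := by
    rw [← hg] at hl'
    obtain ⟨k, hk, hkl⟩ := hl'
    rw [← hkl]
    simpa [mul_assoc] using hk
  have hst : g⁻¹ * l * g ∈ MulAction.stabilizer G K := by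
    rw [stabilizer_eq_normalizer]
    exact Subgroup.le_normalizer hk
  have hy : l • (g : G ⧸ MulAction.stabilizer G K) = g := by
    change ((l * g : G) : G ⧸ MulAction.stabilizer G K) = g
    rw [QuotientGroup.eq]
    have := inv_mem hst
    simpa [mul_assoc] using this
  have h3 : orbitMap G K (l • (g : G ⧸ MulAction.stabilizer G K)) = Ext.Space.pt (l • e) := by
    rw [hy]
    exact h1
  have h4 := Ext.smul_val (f := orbitMap G K) l e (g : G ⧸ MulAction.stabilizer G K) h2 h3
  rw [← Ext.Space.val_congr (l • e) hy h3 h1]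
  refine h4.trans ?_
  obtain ⟨m, hm⟩ := Ind.exists_mk_of_proj
    (M := A.res (toWeylGroup K) (continuous_toWeylGroup K)) (e.val _ h2).2
  rw [← hm]
  change Ind.mk _ (l * g) m = Ind.mk _ g m
  have h5 : l * g = g * ((⟨g⁻¹ * l * g, hst⟩ : MulAction.stabilizer G K) : G) := by
    simp [mul_assoc]
  rw [h5, Ind.mk_mul]
  congr 1
  have h6 : toWeylGroup K ⟨g⁻¹ * l * g, hst⟩ = 1 := by
    refine (QuotientGroup.eq_one_iff _).2 ?_
    exact hk
  change toWeylGroup K ⟨g⁻¹ * l * g, hst⟩ • (show A.M from m) = m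
  rw [h6]
  exact one_smul _ (show A.M from m)

/-- The Weyl skyscraper sheaf `i_* (G ×_(N_G K) A)` of a discrete `R[W_G K]`-module `A`. -/
noncomputable def weylSkyscraper (K : ClosedSubgroup G) (A : DiscMod R (WeylGroup K)) :
    WeylSheaf R G :=
  ⟨skyscraper K (A.res (toWeylGroup K) (continuous_toWeylGroup K)), isWeyl_skyscraper K A⟩

/-! ### Godement resolutions -/

/-- An embedding `j` of discrete `R[W_G K]`-modules from the stalk `E_K` of a Weyl sheaf to `A`: an
injective `R`-linear map that is equivariant for the action of `W_G K = N_G K / K`. -/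
structure StalkEmbedding (E : WeylSheaf R G) (K : ClosedSubgroup G)
    (A : DiscMod R (WeylGroup K)) where
  j : E.obj.Stalk K →ₗ[R] A.M
  injective : Function.Injective j
  map_smul : ∀ (n : MulAction.stabilizer G K) (e : E.obj.Stalk K),
    j ⟨(n : G) • e.1, by rw [E.obj.p_smul, e.2]; exact n.2⟩ = toWeylGroup K n • j e

/-- A morphism `δ : E ⟶ I` of Weyl sheaves is a Godement embedding if, for a choice of a
representative `K` in each conjugacy class of closed subgroups and of an embedding `j_K` of the
stalk `E_K` into an injective discrete `R[W_G K]`-module `A_K`, the sheaf `I` is the product over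
all classes of the Weyl skyscrapers of the `A_K`, and the component of `δ` at `K` induces `j_K` on
the stalks at `K`. -/
def IsGodementEmbedding {E I : WeylSheaf R G} (δ : E ⟶ I) : Prop :=
  ∃ (K : MulAction.orbitRel.Quotient G (ClosedSubgroup G) → ClosedSubgroup G)
    (_ : ∀ O, (Quotient.mk _ (K O) : MulAction.orbitRel.Quotient G (ClosedSubgroup G)) = O)
    (A : ∀ O, DiscMod R (WeylGroup (K O)))
    (_ : ∀ O, Injective (A O))
    (j : ∀ O, StalkEmbedding E (K O) (A O))
    (π : ∀ O, I ⟶ weylSkyscraper (K O) (A O)),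
    Nonempty (IsLimit (Fan.mk I π)) ∧
    ∀ O (e : E.obj.Stalk (K O)), EqSheaf.Hom.stalk (δ ≫ π O).hom (K O) e =
      skyscraperGerm (K O) _ ((j O).j e)

/-- The step `B ⟶ C` after `f : A ⟶ B` in a Godement resolution: the composite of the cokernel
`B ⟶ coker f` and a Godement embedding `coker f ⟶ C`. -/
def IsGodementStep {A B C : WeylSheaf R G} (f : A ⟶ B) (g : B ⟶ C) : Prop :=
  ∃ (Q : WeylSheaf R G) (q : B ⟶ Q) (w : f ≫ q = 0) (δ : Q ⟶ C),
    Nonempty (IsColimit (CokernelCofork.ofπ q w)) ∧ IsGodementEmbedding δ ∧ q ≫ δ = g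

/-- An injective resolution is a Godement resolution if its augmentation `E ⟶ I⁰` is a Godement
embedding and each differential is a Godement step after the preceding map. -/
def IsGodementResolution {E : WeylSheaf R G} (P : InjectiveResolution E) : Prop :=
  let ι : E ⟶ P.cocomplex.X 0 := (HomologicalComplex.singleObjXSelf (ComplexShape.up ℕ) 0 E).inv ≫ P.ι.f 0
  IsGodementEmbedding ι ∧ IsGodementStep ι (P.cocomplex.d 0 1) ∧
    ∀ n, IsGodementStep (P.cocomplex.d n (n + 1)) (P.cocomplex.d (n + 1) (n + 2))

end Weyl

end WeylSheaves

namespace WeylSheaves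

/-! ### Sheaves of germs of equivariant sections -/

/-! Injectivity of skyscrapers is an adjunction argument. A morphism from a Weyl sheaf `E` to the
skyscraper of `A` at `K` is the same as a `W_G K`-equivariant map `E_K → A` (`skyscraperHom`,
`skyscraperStalk`, `skyscraper_hom_ext`), and the stalk functor preserves monomorphisms
(`stalkMap_injective_of_mono`), so its right adjoint preserves injective objects
(`injective_weylSkyscraper`).

Discrete `R[Γ]`-modules embed in injective ones: embed the module in an injective module over the
group ring and keep the elements with open stabilizer (`DiscMod.exists_injective`). Doing this for
the stalk at one `K` in each conjugacy class and taking the product of the skyscrapers gives a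
Godement embedding. The product is injective, and the map is injective on every stalk because `G`
moves each stalk to a chosen one. Iterating on cokernels gives the resolution, whose exactness is
read off on stalks.

No abelian structure on Weyl sheaves is used: kernels, cokernels and products are all built by one
device, the sheaf of germs of a `GermData`. A germ at `x` is a family of continuous sections near
`x` with values in `num`, modulo families with values in `den` near `x`. All members of a family
must be defined on one neighbourhood `U` and be equivariant under one open subgroup `J` containing
every subgroup in `U`. This uniformity makes the action of `G` on germs continuous and makes the
sheaf Weyl, even for infinite families.

The device is rich enough because of `exists_equivariantOn`: every point of a Weyl sheaf lies on
such an equivariant section. This is where compactness of `K`, the Weyl condition and the topology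
on closed subgroups meet. It yields the universal properties (`GermData.lift`, `GermData.desc`,
`GermData.hom_ext_proj`) and the computation of stalks of kernels and cokernels. -/

theorem EqSheaf.continuousOn_add {R G X : Type u} [Ring R] [Group G] [TopologicalSpace G]
    [TopologicalSpace X] [MulAction G X] (F : EqSheaf R G X) {U : Set X} {s t : ∀ x, F.Stalk x}
    (hs : ContinuousOn (fun x => (s x).1) U) (ht : ContinuousOn (fun x => (t x).1) U) :
    ContinuousOn (fun x => (s x + t x).1) U := by
  have := F.continuousOn_sub hs (F.continuousOn_sub (s := fun _ => 0) F.continuous_zero.continuousOn ht)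
  simpa using this

section Germs

variable {R G : Type u} [Ring R] [Group G] [TopologicalSpace G] [IsTopologicalGroup G]

/-- Translation by `g` of families of germs. -/
def translateFamily {ι : Type u} (F : ι → EqSheaf R G (ClosedSubgroup G)) (g : G)
    (x : ClosedSubgroup G) : (∀ i, (F i).Stalk x) →ₗ[R] ∀ i, (F i).Stalk (g • x) :=
  LinearMap.pi fun i => ((F i).translate g x).comp (LinearMap.proj i)

variable (R G) in
/-- A subquotient `num / den` of the stalkwise product of a family of equivariant sheaves. -/
structure GermData where
  ι : Type u
  F : ι → EqSheaf R G (ClosedSubgroup G)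
  num : ∀ x, Submodule R (∀ i, (F i).Stalk x)
  den : ∀ x, Submodule R (∀ i, (F i).Stalk x)
  num_smul : ∀ g x a, a ∈ num x → translateFamily F g x a ∈ num (g • x)
  den_smul : ∀ g x a, a ∈ den x → translateFamily F g x a ∈ den (g • x)

namespace GermData

variable (D : GermData R G)

/-- Families of (arbitrary) sections. -/
abbrev Family : Type u := ∀ x, ∀ i, (D.F i).Stalk x

variable {D}

theorem family_congr (s : D.Family) {x y : ClosedSubgroup G} (h : x = y) (i : D.ι) :
    (s x i).1 = (s y i).1 := by
  subst h
  rfl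

/-- The translate `y ↦ g (s (g⁻¹ y))` of a family of sections. -/
def translate (g : G) (s : D.Family) : D.Family := fun y i =>
  ⟨g • (s (g⁻¹ • y) i).1, by rw [(D.F i).p_smul, (s _ i).2, smul_inv_smul]⟩

/-- Every point has the form `g • y`, so translates are always evaluated in this form, which avoids
transport along `g • g⁻¹ • y = y`. -/
theorem translate_apply (g : G) (s : D.Family) (y : ClosedSubgroup G) :
    translate g s (g • y) = translateFamily D.F g y (s y) := by
  funext i
  apply Subtype.ext
  change g • (s (g⁻¹ • g • y) i).1 = g • (s y i).1
  rw [family_congr s (inv_smul_smul g y)]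

theorem translate_add (g : G) (s t : D.Family) :
    translate g (s + t) = translate g s + translate g t := by
  funext y
  obtain ⟨y, rfl⟩ : ∃ z, g • z = y := ⟨g⁻¹ • y, smul_inv_smul g y⟩
  simp only [Pi.add_apply (f := translate g s), translate_apply]
  exact _root_.map_add _ _ _

theorem translate_scalar (g : G) (r : R) (s : D.Family) :
    translate g (r • s) = r • translate g s := by
  funext y
  obtain ⟨y, rfl⟩ : ∃ z, g • z = y := ⟨g⁻¹ • y, smul_inv_smul g y⟩
  simp only [Pi.smul_apply (f := translate g s), translate_apply]
  exact (translateFamily D.F g y).map_smul r (s y)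

theorem translate_one (s : D.Family) : translate (1 : G) s = s := by
  funext y i
  apply Subtype.ext
  change (1 : G) • (s ((1 : G)⁻¹ • y) i).1 = _
  rw [one_smul, family_congr s (show (1 : G)⁻¹ • y = y by simp)]

theorem translate_mul (g h : G) (s : D.Family) :
    translate (g * h) s = translate g (translate h s) := by
  funext y i
  apply Subtype.ext
  change (g * h) • (s ((g * h)⁻¹ • y) i).1 = g • h • (s (h⁻¹ • g⁻¹ • y) i).1
  rw [mul_smul, family_congr s (show (g * h)⁻¹ • y = h⁻¹ • g⁻¹ • y by rw [mul_inv_rev, mul_smul])]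

/-- A family of continuous sections on a set `U` of subgroups of `J`, equivariant under `J`. -/
structure GoodOn (U : Set (ClosedSubgroup G)) (J : Subgroup G) (s : D.Family) : Prop where
  isOpen : IsOpen U
  isOpen_subgroup : IsOpen (J : Set G)
  stable : ∀ j ∈ J, ∀ y ∈ U, j • y ∈ U
  -- The source of the Weyl condition: elements of `y` lie in `J`, and `s` is equivariant under `J`.
  le : ∀ y ∈ U, y.toSubgroup ≤ J
  mem : ∀ y ∈ U, s y ∈ D.num y
  cont : ∀ i, ContinuousOn (fun y => (s y i).1) U
  map_smul : ∀ j ∈ J, ∀ y ∈ U, ∀ i, (s (j • y) i).1 = j • (s y i).1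

theorem GoodOn.map_smul' {U : Set (ClosedSubgroup G)} {J : Subgroup G} {s : D.Family}
    (h : GoodOn U J s) {j : G} (hj : j ∈ J) {y : ClosedSubgroup G} (hy : y ∈ U) :
    s (j • y) = translateFamily D.F j y (s y) :=
  funext fun i => Subtype.ext (h.map_smul j hj y hy i)

/-- The openness and stability conditions pass to intersections; for a family `w` made from `s` and
`t`, only its values, continuity and equivariance remain to be checked. -/
theorem GoodOn.inter {U U' : Set (ClosedSubgroup G)} {J J' : Subgroup G} {s t w : D.Family}
    (h : GoodOn U J s) (h' : GoodOn U' J' t) (hm : ∀ y ∈ U ∩ U', w y ∈ D.num y)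
    (hc : ∀ i, ContinuousOn (fun y => (w y i).1) (U ∩ U'))
    (he : ∀ j ∈ J ⊓ J', ∀ y ∈ U ∩ U', w (j • y) = translateFamily D.F j y (w y)) :
    GoodOn (U ∩ U') (J ⊓ J') w where
  isOpen := h.isOpen.inter h'.isOpen
  isOpen_subgroup := h.isOpen_subgroup.inter h'.isOpen_subgroup
  stable j hj y hy := ⟨h.stable j hj.1 y hy.1, h'.stable j hj.2 y hy.2⟩
  le y hy := le_inf (h.le y hy.1) (h'.le y hy.2)
  mem := hm
  cont := hc
  map_smul j hj y hy i := by
    rw [he j hj y hy]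
    rfl

variable (D) in
/-- The families of sections that are equivariant near `x`. -/
def good (x : ClosedSubgroup G) : Submodule R D.Family where
  carrier := {s | ∃ U J, x ∈ U ∧ GoodOn U J s}
  zero_mem' := ⟨Set.univ, ⊤, trivial,
    { isOpen := isOpen_univ
      isOpen_subgroup := isOpen_univ
      stable := fun _ _ _ _ => trivial
      le := fun _ _ => le_top
      mem := fun y _ => (D.num y).zero_mem
      cont := fun i => (D.F i).continuous_zero.continuousOn
      map_smul := fun j _ y _ i => ((D.F i).smul_zero_stalk j y).symm }⟩
  add_mem' := by
    rintro s t ⟨U, J, hx, h⟩ ⟨U', J', hx', h'⟩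
    refine ⟨U ∩ U', J ⊓ J', ⟨hx, hx'⟩, h.inter h' ?_ ?_ ?_⟩
    · exact fun y hy => (D.num y).add_mem (h.mem y hy.1) (h'.mem y hy.2)
    · exact fun i => (D.F i).continuousOn_add ((h.cont i).mono fun _ hy => hy.1)
        ((h'.cont i).mono fun _ hy => hy.2)
    · intro j hj y hy
      rw [Pi.add_apply, Pi.add_apply, h.map_smul' hj.1 hy.1, h'.map_smul' hj.2 hy.2,
        _root_.map_add]
  smul_mem' := by
    rintro r s ⟨U, J, hx, h⟩
    refine ⟨U ∩ U, J ⊓ J, ⟨hx, hx⟩, h.inter h ?_ ?_ ?_⟩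
    · exact fun y hy => (D.num y).smul_mem r (h.mem y hy.1)
    · exact fun i => (D.F i).continuousOn_scalar r ((h.cont i).mono fun _ hy => hy.1)
    · intro j hj y hy
      rw [Pi.smul_apply, Pi.smul_apply, h.map_smul' hj.1 hy.1, _root_.map_smul]

variable (D) in
/-- The families of sections that lie in `den` near `x`. -/
def null (x : ClosedSubgroup G) : Submodule R D.Family where
  carrier := {s | ∀ᶠ y in 𝓝 x, s y ∈ D.den y}
  zero_mem' := Filter.Eventually.of_forall fun y => (D.den y).zero_mem
  add_mem' hs ht := by
    filter_upwards [hs, ht] with y h h'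
    exact (D.den y).add_mem h h'
  smul_mem' r s hs := by
    filter_upwards [hs] with y h
    exact (D.den y).smul_mem r h

/-- Since goodness is an open condition, a germ at `x` has a representative that defines germs at
all nearby points; these germs form the local sections of the sheaf space. -/
theorem isOpen_good (s : D.Family) : IsOpen {x | s ∈ D.good x} := by
  rw [isOpen_iff_mem_nhds]
  rintro x ⟨U, J, hx, h⟩
  exact Filter.mem_of_superset (h.isOpen.mem_nhds hx) fun y hy => ⟨U, J, hy, h⟩

theorem isOpen_null (s : D.Family) : IsOpen {x | s ∈ D.null x} := by
  rw [isOpen_iff_mem_nhds]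
  intro x hx
  exact eventually_eventually_nhds.2 hx

theorem eventually_translate {p : ClosedSubgroup G → Prop} {g : G} {x : ClosedSubgroup G}
    (h : ∀ᶠ y in 𝓝 x, p (g • y)) : ∀ᶠ z in 𝓝 (g • x), p z := by
  have hc : ContinuousAt (fun z : ClosedSubgroup G => g⁻¹ • z) (g • x) :=
    (continuous_const_smul g⁻¹).continuousAt
  have h' : ∀ᶠ y in 𝓝 (g⁻¹ • g • x), p (g • y) := by rwa [inv_smul_smul]
  filter_upwards [hc.eventually h'] with z hz
  rwa [smul_inv_smul] at hz

theorem translate_mem_null {s : D.Family} {x : ClosedSubgroup G} (hs : s ∈ D.null x) (g : G) :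
    translate g s ∈ D.null (g • x) := by
  refine eventually_translate (p := fun z => translate g s z ∈ D.den z) ?_
  have hs' : ∀ᶠ y in 𝓝 x, s y ∈ D.den y := hs
  filter_upwards [hs'] with y hy
  rw [translate_apply]
  exact D.den_smul g y _ hy

/-- If `s` is equivariant under `J` on `U`, its translate by `g` is equivariant under `g J g⁻¹` on
`g U`; both are written as preimages under the inverse. -/
theorem translate_mem_good {s : D.Family} {x : ClosedSubgroup G} (hs : s ∈ D.good x) (g : G) :
    translate g s ∈ D.good (g • x) := by
  obtain ⟨U, J, hx, h⟩ := hs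
  have hc : Continuous fun z : ClosedSubgroup G => g⁻¹ • z := continuous_const_smul g⁻¹
  have hcomm : ∀ j, ∀ y : ClosedSubgroup G, (g⁻¹ * j * g) • g⁻¹ • y = g⁻¹ • j • y := by
    intro j y
    simp only [← mul_smul]
    congr 1
    group
  refine ⟨(fun z => g⁻¹ • z) ⁻¹' U, J.comap (MulAut.conj g⁻¹).toMonoidHom, by simpa using hx, ?_⟩
  have hJ : ∀ j, j ∈ J.comap (MulAut.conj g⁻¹).toMonoidHom → g⁻¹ * j * g ∈ J := by
    intro j hj
    have : g⁻¹ * j * g⁻¹⁻¹ ∈ J := hj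
    rwa [inv_inv] at this
  refine ⟨h.isOpen.preimage hc, ?_, ?_, ?_, ?_, ?_, ?_⟩
  · exact h.isOpen_subgroup.preimage
      ((continuous_const.mul continuous_id).mul continuous_const : Continuous fun j => g⁻¹ * j * g⁻¹⁻¹)
  · intro j hj y hy
    have := h.stable _ (hJ j hj) _ hy
    rwa [hcomm] at this
  · intro y hy k hk
    have h1 := h.le _ hy
    rw [smul_toSubgroup] at h1
    exact h1 ⟨k, hk, rfl⟩
  · intro y hy
    obtain ⟨y, rfl⟩ : ∃ z, g • z = y := ⟨g⁻¹ • y, smul_inv_smul g y⟩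
    rw [translate_apply]
    refine D.num_smul g y _ (h.mem _ ?_)
    simpa using hy
  · intro i
    exact ((h.cont i).comp hc.continuousOn fun _ hz => hz).const_smul g
  · intro j hj y hy i
    change g • (s (g⁻¹ • j • y) i).1 = j • g • (s (g⁻¹ • y) i).1
    rw [family_congr s (hcomm j y).symm, h.map_smul _ (hJ j hj) _ hy]
    simp only [← mul_smul]
    congr 1
    group

/-! ### The space of germs, its fibres and its `G`-action -/

variable (D) in
/-- The stalk of the sheaf of germs. -/
abbrev GermModule (x : ClosedSubgroup G) : Type u :=
  D.good x ⧸ (D.null x).submoduleOf (D.good x)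

variable (D) in
/-- The sheaf space of germs. -/
structure Space : Type u where
  pt : ClosedSubgroup G
  germ : D.GermModule pt

open Classical in
/-- The germ of `s` at `x`. -/
noncomputable def sec (s : D.Family) (x : ClosedSubgroup G) : D.Space :=
  ⟨x, if h : s ∈ D.good x then Submodule.Quotient.mk ⟨s, h⟩ else 0⟩

theorem sec_of_mem {s : D.Family} {x : ClosedSubgroup G} (h : s ∈ D.good x) :
    sec s x = ⟨x, Submodule.Quotient.mk ⟨s, h⟩⟩ := by
  simp [sec, h]

theorem exists_sec (a : D.Space) : ∃ s ∈ D.good a.pt, sec s a.pt = a := by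
  obtain ⟨x, q⟩ := a
  obtain ⟨⟨s, hs⟩, rfl⟩ := Submodule.Quotient.mk_surjective _ q
  exact ⟨s, hs, sec_of_mem hs⟩

/-- Equality of germs is a condition on a neighbourhood and not only at `x`: for infinite families,
agreement of all components at `x` gives no common neighbourhood of agreement. -/
theorem sec_eq_sec {s t : D.Family} {x : ClosedSubgroup G} (hs : s ∈ D.good x)
    (ht : t ∈ D.good x) : sec s x = sec t x ↔ s - t ∈ D.null x := by
  rw [sec_of_mem hs, sec_of_mem ht, Space.mk.injEq, heq_eq_eq, and_iff_right rfl,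
    Submodule.Quotient.eq]
  rfl

theorem sec_congr {s t : D.Family} {x : ClosedSubgroup G} (hs : s ∈ D.good x)
    (ht : t ∈ D.good x) (h : ∀ᶠ y in 𝓝 x, s y = t y) : sec s x = sec t x := by
  rw [sec_eq_sec hs ht]
  change ∀ᶠ y in 𝓝 x, _
  filter_upwards [h] with y hy
  rw [Pi.sub_apply, hy, sub_self]
  exact (D.den y).zero_mem

instance : TopologicalSpace D.Space :=
  TopologicalSpace.generateFrom {B | ∃ (U : Set (ClosedSubgroup G)) (s : D.Family), IsOpen U ∧
    (∀ x ∈ U, s ∈ D.good x) ∧ B = sec s '' U}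

theorem isOpen_sec {U : Set (ClosedSubgroup G)} {s : D.Family} (hU : IsOpen U)
    (hs : ∀ x ∈ U, s ∈ D.good x) : IsOpen (sec s '' U) :=
  TopologicalSpace.isOpen_generateFrom_of_mem ⟨U, s, hU, hs, rfl⟩

theorem continuousAt_sec {s : D.Family} {x : ClosedSubgroup G} (hs : s ∈ D.good x) :
    ContinuousAt (sec s) x := by
  rw [ContinuousAt, TopologicalSpace.tendsto_nhds_generateFrom_iff]
  rintro _ ⟨V, t, hV, ht, rfl⟩ ⟨x', hx', he⟩
  obtain rfl : x' = x := congrArg Space.pt he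
  have h := (sec_eq_sec (ht x' hx') hs).1 he
  filter_upwards [hV.mem_nhds hx', (isOpen_good s).mem_nhds hs, (isOpen_null (t - s)).mem_nhds h]
    with z h1 h2 h3
  exact ⟨z, h1, (sec_eq_sec (ht z h1) h2).2 h3⟩

theorem continuous_pt : Continuous (Space.pt : D.Space → ClosedSubgroup G) := by
  rw [continuous_iff_continuousAt]
  intro a V hV
  obtain ⟨W, hWV, hW, haW⟩ := mem_nhds_iff.1 hV
  obtain ⟨s, hs, hsa⟩ := exists_sec a
  refine Filter.mem_map.2 (Filter.mem_of_superset ((isOpen_sec (hW.inter (isOpen_good s))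
    (fun _ h => h.2)).mem_nhds ⟨a.pt, ⟨haW, hs⟩, hsa⟩) ?_)
  rintro _ ⟨x, ⟨h1, -⟩, rfl⟩
  exact hWV h1

theorem isLocalHomeomorph_pt : IsLocalHomeomorph (Space.pt : D.Space → ClosedSubgroup G) := by
  refine isLocalHomeomorph_of_sections continuous_pt fun a => ?_
  obtain ⟨s, hs, hsa⟩ := exists_sec a
  exact ⟨{x | s ∈ D.good x}, sec s, isOpen_good s, hs, hsa,
    fun x hx => (continuousAt_sec hx).continuousWithinAt, fun _ _ => rfl,
    isOpen_sec (isOpen_good s) fun _ h => h⟩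

/-- The fibre over `x` is the module of germs at `x`. -/
def fibEquiv (x : ClosedSubgroup G) : Fib (Space.pt : D.Space → ClosedSubgroup G) x ≃
    D.GermModule x where
  toFun a := match a with
    | ⟨⟨_, q⟩, rfl⟩ => q
  invFun q := ⟨⟨x, q⟩, rfl⟩
  left_inv := by
    rintro ⟨⟨_, q⟩, rfl⟩
    rfl
  right_inv _ := rfl

instance (x : ClosedSubgroup G) : AddCommGroup (Fib (Space.pt : D.Space → ClosedSubgroup G) x) :=
  (fibEquiv x).addCommGroup

instance (x : ClosedSubgroup G) : Module R (Fib (Space.pt : D.Space → ClosedSubgroup G) x) :=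
  (fibEquiv x).module R

/-- The germ of `s` at `x` as a point of the fibre. -/
noncomputable def fibSec (s : D.Family) (x : ClosedSubgroup G) :
    Fib (Space.pt : D.Space → ClosedSubgroup G) x := ⟨sec s x, rfl⟩

theorem fibSec_of_mem {s : D.Family} {x : ClosedSubgroup G} (h : s ∈ D.good x) :
    fibSec s x = (fibEquiv x).symm (Submodule.Quotient.mk ⟨s, h⟩) :=
  Subtype.ext (sec_of_mem h)

theorem fibSec_add {s t : D.Family} {x : ClosedSubgroup G} (hs : s ∈ D.good x)
    (ht : t ∈ D.good x) : fibSec s x + fibSec t x = fibSec (s + t) x := by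
  rw [fibSec_of_mem hs, fibSec_of_mem ht, fibSec_of_mem ((D.good x).add_mem hs ht),
    Equiv.add_def, Equiv.apply_symm_apply, Equiv.apply_symm_apply]
  rfl

theorem fibSec_scalar {s : D.Family} {x : ClosedSubgroup G} (hs : s ∈ D.good x) (r : R) :
    r • fibSec s x = fibSec (r • s) x := by
  rw [fibSec_of_mem hs, fibSec_of_mem ((D.good x).smul_mem r hs),
    Equiv.smul_def, Equiv.apply_symm_apply]
  rfl

theorem fibSec_sub {s t : D.Family} {x : ClosedSubgroup G} (hs : s ∈ D.good x)
    (ht : t ∈ D.good x) : fibSec s x - fibSec t x = fibSec (s - t) x := by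
  rw [sub_eq_iff_eq_add, fibSec_add ((D.good x).sub_mem hs ht) ht, sub_add_cancel]

theorem exists_fibSec {x : ClosedSubgroup G} (a : Fib (Space.pt : D.Space → ClosedSubgroup G) x) :
    ∃ s ∈ D.good x, fibSec s x = a := by
  obtain ⟨a, rfl⟩ := a
  obtain ⟨s, hs, hsa⟩ := exists_sec a
  exact ⟨s, hs, Subtype.ext hsa⟩

noncomputable instance : SMul G D.Space :=
  ⟨fun g a => sec (translate g (exists_sec a).choose) (g • a.pt)⟩

/-- The action is defined through a chosen representative of the germ. The choice is immaterial
because translation carries null families to null families. -/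
theorem smul_sec (g : G) {s : D.Family} {x : ClosedSubgroup G} (hs : s ∈ D.good x) :
    g • sec s x = sec (translate g s) (g • x) := by
  have h := (exists_sec (sec s x)).choose_spec
  have h1 : (exists_sec (sec s x)).choose ∈ D.good x := h.1
  refine (sec_eq_sec (translate_mem_good h1 g) (translate_mem_good hs g)).2 ?_
  have h2 := translate_mem_null ((sec_eq_sec h1 hs).1 h.2) g
  have h3 : ∀ t : D.Family, translate g (t - s) = translate g t - translate g s := by
    intro t
    rw [eq_sub_iff_add_eq, ← translate_add, sub_add_cancel]
  rwa [h3] at h2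

noncomputable instance : MulAction G D.Space where
  one_smul a := by
    obtain ⟨s, hs, hsa⟩ := exists_sec a
    rw [← hsa, smul_sec _ hs, translate_one, one_smul]
  mul_smul g h a := by
    obtain ⟨s, hs, hsa⟩ := exists_sec a
    rw [← hsa, smul_sec _ hs, smul_sec _ hs, smul_sec _ (translate_mem_good hs h), translate_mul,
      mul_smul]

/-- For a family equivariant under `J`, translation by `g * j` and by `g` give the same family near
`(g * j) • y`. Hence the whole coset `g J` acts through a single translate, which yields the
continuity of the action and, for `g = 1`, the Weyl condition. -/
theorem smul_sec_of_goodOn {U : Set (ClosedSubgroup G)} {J : Subgroup G} {s : D.Family}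
    (h : GoodOn U J s) (g : G) {j : G} (hj : j ∈ J) {y : ClosedSubgroup G} (hy : y ∈ U) :
    (g * j) • sec s y = sec (translate g s) ((g * j) • y) := by
  have hg : ∀ z ∈ U, s ∈ D.good z := fun z hz => ⟨U, J, hz, h⟩
  rw [smul_sec _ (hg y hy)]
  refine sec_congr (translate_mem_good (hg y hy) _) ?_ ?_
  · rw [mul_smul]
    exact translate_mem_good (hg _ (h.stable j hj y hy)) g
  · refine eventually_translate (p := fun z => translate (g * j) s z = translate g s z) ?_
    filter_upwards [h.isOpen.mem_nhds hy] with z hz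
    rw [translate_apply]
    funext i
    apply Subtype.ext
    change (g * j) • (s z i).1 = g • (s (g⁻¹ • (g * j) • z) i).1
    rw [family_congr s (show g⁻¹ • (g * j) • z = j • z by rw [mul_smul, inv_smul_smul]),
      h.map_smul j hj z hz, mul_smul]

instance : ContinuousSMul G D.Space where
  continuous_smul := by
    rw [continuous_iff_continuousAt]
    rintro ⟨g, a⟩
    obtain ⟨s, ⟨U, J, hx, h⟩, hsa⟩ := exists_sec a
    have hg : ∀ z ∈ U, s ∈ D.good z := fun z hz => ⟨U, J, hz, h⟩
    -- On the neighbourhood `g J × sec s '' U` the action coincides with this function, in which the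
    -- translate no longer varies with the group element.
    have h1 : ContinuousAt (fun z : G × D.Space => sec (translate g s) (z.1 • z.2.pt)) (g, a) :=
      ContinuousAt.comp (f := fun z : G × D.Space => z.1 • z.2.pt) (g := sec (translate g s))
        (continuousAt_sec (translate_mem_good (hg _ hx) g))
        (continuous_fst.smul (continuous_pt.comp continuous_snd)).continuousAt
    refine h1.congr ?_
    have h2 : IsOpen {k : G | g⁻¹ * k ∈ J} :=
      h.isOpen_subgroup.preimage (continuous_const.mul continuous_id)
    have h3 : g⁻¹ * g ∈ J := by
      rw [inv_mul_cancel]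
      exact J.one_mem
    filter_upwards [(h2.prod (isOpen_sec h.isOpen hg)).mem_nhds ⟨h3, a.pt, hx, hsa⟩]
    rintro ⟨k, _⟩ ⟨hk, y, hy, rfl⟩
    have := smul_sec_of_goodOn h g hk hy
    rw [mul_inv_cancel_left] at this
    exact this.symm

theorem fib_smul (g : G) {s : D.Family} {x : ClosedSubgroup G} (hs : s ∈ D.good x) :
    g • (fibSec s x).1 = (fibSec (translate g s) (g • x)).1 := smul_sec g hs

variable (D) in
/-- The equivariant sheaf of germs. -/
noncomputable def sheaf : EqSheaf R G (ClosedSubgroup G) where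
  E := D.Space
  p := Space.pt
  p_smul _ _ := rfl
  isLocalHomeo := isLocalHomeomorph_pt
  continuous_sub := by
    refine continuous_sub_of_sections isLocalHomeomorph_pt fun x a b => ?_
    obtain ⟨s, hs, rfl⟩ := exists_fibSec a
    obtain ⟨t, ht, rfl⟩ := exists_fibSec b
    refine ⟨{x | s ∈ D.good x} ∩ {x | t ∈ D.good x}, sec s, sec t, sec (s - t),
      (isOpen_good s).inter (isOpen_good t), ⟨hs, ht⟩, ?_, ?_, ?_, rfl, rfl, ?_⟩
    · exact fun x hx => (continuousAt_sec hx.1).continuousWithinAt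
    · exact fun x hx => (continuousAt_sec hx.2).continuousWithinAt
    · exact fun x hx =>
        (continuousAt_sec ((D.good x).sub_mem hx.1 hx.2)).continuousWithinAt
    · exact fun y hy => ⟨rfl, rfl, congrArg Subtype.val (fibSec_sub hy.1 hy.2).symm⟩
  continuous_scalar r := by
    refine continuous_scalar_of_sections isLocalHomeomorph_pt r fun x a => ?_
    obtain ⟨s, hs, rfl⟩ := exists_fibSec a
    refine ⟨{x | s ∈ D.good x}, sec s, sec (r • s), isOpen_good s, hs, ?_, ?_, rfl, ?_⟩
    · exact fun x hx => (continuousAt_sec hx).continuousWithinAt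
    · exact fun x hx => (continuousAt_sec ((D.good x).smul_mem r hx)).continuousWithinAt
    · exact fun y hy => ⟨rfl, congrArg Subtype.val (fibSec_scalar hy r).symm⟩
  smul_add_fib g x a b := by
    obtain ⟨s, hs, rfl⟩ := exists_fibSec a
    obtain ⟨t, ht, rfl⟩ := exists_fibSec b
    rw [fibSec_add hs ht]
    simp only [fib_smul g hs, fib_smul g ht, fib_smul g ((D.good x).add_mem hs ht), translate_add]
    exact congrArg Subtype.val
      (fibSec_add (translate_mem_good hs g) (translate_mem_good ht g)).symm
  smul_scalar_fib g x r a := by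
    obtain ⟨s, hs, rfl⟩ := exists_fibSec a
    rw [fibSec_scalar hs]
    simp only [fib_smul g hs, fib_smul g ((D.good x).smul_mem r hs), translate_scalar]
    exact congrArg Subtype.val (fibSec_scalar (translate_mem_good hs g) r).symm

theorem smul_eq_self {x : ClosedSubgroup G} {k : G} (hk : k ∈ x) : k • x = x := by
  have h : k ∈ Subgroup.normalizer (x.toSubgroup : Set G) :=
    Subgroup.le_normalizer (show k ∈ x.toSubgroup from hk)
  rwa [← stabilizer_eq_normalizer] at h

-- An element `k` of `x` lies in `J` and fixes `x`, so it acts on the germ of `s` as translation by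
-- `1` does.
variable (D) in
theorem isWeyl_sheaf : isWeyl R G D.sheaf := by
  intro x a k hk
  obtain ⟨s, ⟨U, J, hx, h⟩, rfl⟩ := exists_fibSec a
  have h1 := smul_sec_of_goodOn h 1 (h.le x hx hk) hx
  rw [one_mul, smul_eq_self hk, translate_one] at h1
  exact h1

variable (D) in
/-- The Weyl sheaf of germs. -/
noncomputable def weylSheaf : WeylSheaf R G := ⟨D.sheaf, D.isWeyl_sheaf⟩

end GermData

end Germs

/-! ### Equivariant sections of Weyl sheaves -/

theorem EqSheaf.section_congr {R G X : Type u} [Ring R] [Group G] [TopologicalSpace G]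
    [TopologicalSpace X] [MulAction G X] (F : EqSheaf R G X) (s : ∀ x, F.Stalk x) {x y : X}
    (h : x = y) : (s x).1 = (s y).1 := by
  subst h
  rfl

section Sections

variable {R G : Type u} [Ring R] [Group G] [TopologicalSpace G] [IsTopologicalGroup G]

/-- A continuous section on a set `U` of subgroups of `J`, equivariant under `J`. -/
structure EquivariantOn (F : EqSheaf R G (ClosedSubgroup G)) (U : Set (ClosedSubgroup G))
    (J : Subgroup G) (s : ∀ x, F.Stalk x) : Prop where
  isOpen : IsOpen U
  isOpen_subgroup : IsOpen (J : Set G)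
  stable : ∀ j ∈ J, ∀ y ∈ U, j • y ∈ U
  le : ∀ y ∈ U, y.toSubgroup ≤ J
  cont : ContinuousOn (fun y => (s y).1) U
  map_smul : ∀ j ∈ J, ∀ y ∈ U, (s (j • y)).1 = j • (s y).1

theorem subgroupImage_eq_iff {N : OpenNormalSubgroup G} {K L : ClosedSubgroup G} :
    subgroupImage N L = subgroupImage N K ↔
      L.toSubgroup ⊔ N.toSubgroup = K.toSubgroup ⊔ N.toSubgroup := by
  unfold subgroupImage
  rw [Subgroup.map_eq_map_iff, QuotientGroup.ker_mk']

theorem subgroupImage_eq_of_le {N N' : OpenNormalSubgroup G} (h : N.toSubgroup ≤ N'.toSubgroup)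
    {K L : ClosedSubgroup G} (hKL : subgroupImage N L = subgroupImage N K) :
    subgroupImage N' L = subgroupImage N' K := by
  rw [subgroupImage_eq_iff] at hKL ⊢
  rw [← sup_eq_right.2 h, ← sup_assoc, hKL, sup_assoc]

/-- A basic open set may be recentred at any of its members, and shrinking `N` shrinks the set; so
at each `K` the basic sets centred at `K` itself form a neighbourhood base. -/
theorem exists_subgroupImage_subset {V : Set (ClosedSubgroup G)} (hV : IsOpen V)
    {K : ClosedSubgroup G} (hK : K ∈ V) :
    ∃ N : OpenNormalSubgroup G, {L | subgroupImage N L = subgroupImage N K} ⊆ V := by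
  induction hV with
  | basic B hB =>
    obtain ⟨N, K', rfl⟩ := hB
    exact ⟨N, fun L hL => Eq.trans hL hK⟩
  | univ => exact ⟨⟨⟨⊤, isOpen_univ⟩, inferInstanceAs (⊤ : Subgroup G).Normal⟩, fun _ _ => trivial⟩
  | inter A B _ _ hA hB =>
    obtain ⟨N, hN⟩ := hA hK.1
    obtain ⟨N', hN'⟩ := hB hK.2
    exact ⟨N ⊓ N', fun L hL => ⟨
      hN (subgroupImage_eq_of_le (fun _ h => (inf_le_left : N ⊓ N' ≤ N) h) hL),
      hN' (subgroupImage_eq_of_le (fun _ h => (inf_le_right : N ⊓ N' ≤ N') h) hL)⟩⟩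
  | sUnion S _ hS =>
    obtain ⟨A, hA, hKA⟩ := hK
    obtain ⟨N, hN⟩ := hS A hA hKA
    exact ⟨N, fun L hL => ⟨A, hA, hN hL⟩⟩

/-- Take any local section `s` through `e`. The pairs `(g, y)` with `g s(y) = s(g y)` form an open
set, which contains `x × {x}` by the Weyl condition. As `x` is compact, it contains a box `A × V`.
For a small open normal `N`, the open subgroup `J = x N` lies in `A` and `U = {L | L N = x N}` lies
in `V`; moreover `U` is stable under `J` and its members are contained in `J`. -/
theorem exists_equivariantOn [CompactSpace G] [TotallyDisconnectedSpace G]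
    {F : EqSheaf R G (ClosedSubgroup G)} (hF : isWeyl R G F) {x : ClosedSubgroup G}
    (e : F.Stalk x) : ∃ U J s, x ∈ U ∧ EquivariantOn F U J s ∧ s x = e := by
  obtain ⟨U, s, hU, hx, hs, hse⟩ := F.exists_section e.1
  rw [e.2] at hx hse
  have hD : IsOpen {z : G × ClosedSubgroup G | z.2 ∈ U ∧ z.1 • z.2 ∈ U} :=
    (hU.preimage continuous_snd).inter (hU.preimage continuous_smul)
  have h1 : ContinuousOn (fun z : G × ClosedSubgroup G => z.1 • (s z.2).1)
      {z : G × ClosedSubgroup G | z.2 ∈ U ∧ z.1 • z.2 ∈ U} :=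
    continuous_fst.continuousOn.smul (hs.comp continuous_snd.continuousOn fun z hz => hz.1)
  have h2 : ContinuousOn (fun z : G × ClosedSubgroup G => (s (z.1 • z.2)).1)
      {z : G × ClosedSubgroup G | z.2 ∈ U ∧ z.1 • z.2 ∈ U} :=
    hs.comp continuous_smul.continuousOn fun z hz => hz.2
  have hC := isOpen_lift_eq F.isLocalHomeo hD h1 h2 (fun z _ => by
    rw [F.p_smul, (s z.2).2, (s (z.1 • z.2)).2])
  obtain ⟨A, V, hA, hV, hxA, hxV, hAV⟩ := generalized_tube_lemma (s := (x : Set G))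
    (t := {x}) x.isClosed'.isCompact isCompact_singleton hC (by
      rintro ⟨k, y⟩ ⟨hk, hy⟩
      obtain rfl : y = x := hy
      have hky : k • y = y := GermData.smul_eq_self hk
      refine ⟨⟨hx, by simpa only [hky] using hx⟩, ?_⟩
      change k • (s y).1 = (s (k • y)).1
      rw [hse, hF y e k hk, ← hse]
      exact F.section_congr s hky.symm)
  -- Compactness again: `x W ⊆ A` for some neighbourhood `W` of `1`. Then `N₁ ⊆ W` controls the
  -- group variable and `N₂` controls the base point.
  obtain ⟨W, hW, hxW⟩ := compact_open_separated_mul_right x.isClosed'.isCompact hA hxA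
  obtain ⟨N₁, hN₁⟩ := ProfiniteGrp.exist_openNormalSubgroup_sub_open_nhds_of_one
    isOpen_interior (mem_interior_iff_mem_nhds.2 hW)
  obtain ⟨N₂, hN₂⟩ := exists_subgroupImage_subset hV (hxV rfl)
  let N := N₁ ⊓ N₂
  have hsub : {L | subgroupImage N L = subgroupImage N x} ⊆ V :=
    fun L hL => hN₂ (subgroupImage_eq_of_le (fun _ h => (inf_le_right : N₁ ⊓ N₂ ≤ N₂) h) hL)
  have hJ : ∀ j ∈ x.toSubgroup ⊔ N.toSubgroup, j ∈ A := by
    intro j hj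
    obtain ⟨k, hk, n, hn, rfl⟩ := Subgroup.mem_sup_of_normal_right.1 hj
    exact hxW ⟨k, hk, n, interior_subset (hN₁ ((inf_le_left : N₁ ⊓ N₂ ≤ N₁) hn)), rfl⟩
  refine ⟨{L | subgroupImage N L = subgroupImage N x}, x.toSubgroup ⊔ N.toSubgroup, s, rfl,
    ⟨?_, ?_, ?_, ?_, ?_, ?_⟩, Subtype.ext hse⟩
  · exact TopologicalSpace.isOpen_generateFrom_of_mem ⟨N, x, rfl⟩
  · exact Subgroup.isOpen_mono le_sup_right N.isOpen'
  · intro j hj y hy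
    have hy' : subgroupImage N y = subgroupImage N x := hy
    change subgroupImage N (j • y) = subgroupImage N x
    rw [subgroupImage_smul, hy']
    -- The class of `j` modulo `N` belongs to the image of `x`, and a subgroup is normalised by its
    -- own elements.
    refine Subgroup.mem_normalizer_iff_map_conj_eq.1 (Subgroup.le_normalizer ?_)
    obtain ⟨k, hk, n, hn, rfl⟩ := Subgroup.mem_sup_of_normal_right.1 hj
    exact ⟨k, hk, QuotientGroup.eq.2 (by simpa using hn)⟩
  · intro y hy
    rw [← subgroupImage_eq_iff.1 hy]
    exact le_sup_left
  · refine hs.mono fun y hy => ?_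
    -- Taking `1 ∈ J` as the group element, membership in the box includes membership of `y` in the
    -- domain of `s`.
    exact (hAV (Set.mk_mem_prod (hJ 1 (one_mem _)) (hsub hy))).1.1
  · intro j hj y hy
    exact (hAV (Set.mk_mem_prod (hJ j hj) (hsub hy))).2.symm

end Sections

/-! ### Linear maps on stalks -/

namespace EqSheaf

variable {R G X : Type u} [Ring R] [Group G] [TopologicalSpace G] [TopologicalSpace X]
  [MulAction G X]

/-- The map on stalks induced by a morphism, as a linear map. -/
def stalkMap {F F' : EqSheaf R G X} (f : F ⟶ F') (x : X) : F.Stalk x →ₗ[R] F'.Stalk x where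
  toFun := Hom.stalk f x
  map_add' a b := Subtype.ext (Hom.map_add_fib f x a b)
  map_smul' r a := Subtype.ext (Hom.map_scalar_fib f x r a)

theorem stalkMap_comp {F F' F'' : EqSheaf R G X} (f : F ⟶ F') (g : F' ⟶ F'') (x : X)
    (a : F.Stalk x) : stalkMap (f ≫ g) x a = stalkMap g x (stalkMap f x a) := rfl

theorem stalkMap_translate {F F' : EqSheaf R G X} (f : F ⟶ F') (g : G) (x : X) (a : F.Stalk x) :
    stalkMap f (g • x) (F.translate g x a) = F'.translate g x (stalkMap f x a) :=
  Subtype.ext (Hom.map_smul f g a.1)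

theorem stalkMap_zero {F F' : EqSheaf R G X} (x : X) (a : F.Stalk x) :
    stalkMap (0 : F ⟶ F') x a = 0 := by
  obtain ⟨a, rfl⟩ := a
  rfl

theorem hom_ext_stalkMap {F F' : EqSheaf R G X} {f g : F ⟶ F'}
    (h : ∀ x a, stalkMap f x a = stalkMap g x a) : f = g :=
  Hom.ext (funext fun e => congrArg Subtype.val (h (F.p e) ⟨e, rfl⟩))

theorem continuousOn_stalkMap {F F' : EqSheaf R G X} (f : F ⟶ F') {U : Set X}
    {s : ∀ x, F.Stalk x} (hs : ContinuousOn (fun x => (s x).1) U) :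
    ContinuousOn (fun x => (stalkMap f x (s x)).1) U :=
  (Hom.continuous_toFun f).comp_continuousOn hs

/-- Sections of a local homeomorphism that meet at a point coincide near it. This is how identities
in one stalk become identities of germs. -/
theorem eventually_eq_of_eq {F : EqSheaf R G X} {U : Set X} (hU : IsOpen U) {s t : ∀ x, F.Stalk x}
    (hs : ContinuousOn (fun x => (s x).1) U) (ht : ContinuousOn (fun x => (t x).1) U) {x : X}
    (hx : x ∈ U) (h : s x = t x) : ∀ᶠ y in 𝓝 x, s y = t y := by
  have ho := isOpen_lift_eq F.isLocalHomeo hU hs ht fun y _ => (s y).2.trans (t y).2.symm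
  filter_upwards [ho.mem_nhds ⟨hx, congrArg Subtype.val h⟩] with y hy
  exact Subtype.ext hy.2

end EqSheaf

namespace GermData

open EqSheaf

section Hom

variable {R G : Type u} [Ring R] [Group G] [TopologicalSpace G] [IsTopologicalGroup G]
  (D : GermData R G)

/-! ### Morphisms out of and into sheaves of germs -/

section Desc

variable {F' : EqSheaf R G (ClosedSubgroup G)} (i : D.ι) (k : D.F i ⟶ F')

/-- The function on germs induced by a morphism out of a member of the family. -/
noncomputable def descFun (a : D.Space) : F'.E :=
  (stalkMap k a.pt ((exists_sec a).choose a.pt i)).1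

variable {D i k}

/-- The chosen representative and `s` differ near `x`, hence at `x`, by an element of `den`, which
`k` kills. So the value does not depend on the choice. -/
theorem descFun_sec (hk : ∀ x, ∀ a ∈ D.den x, stalkMap k x (a i) = 0) {s : D.Family}
    {x : ClosedSubgroup G} (hs : s ∈ D.good x) :
    D.descFun i k (sec s x) = (stalkMap k x (s x i)).1 := by
  have h := (exists_sec (sec s x)).choose_spec
  have h1 := (sec_eq_sec h.1 hs).1 h.2
  have h1' : ∀ᶠ y in 𝓝 x, ((exists_sec (sec s x)).choose - s) y ∈ D.den y := h1
  have h2 := hk x _ h1'.self_of_nhds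
  rw [Pi.sub_apply, Pi.sub_apply, map_sub, sub_eq_zero] at h2
  exact congrArg Subtype.val h2

variable (D i k)

theorem continuous_descFun (hk : ∀ x, ∀ a ∈ D.den x, stalkMap k x (a i) = 0) :
    Continuous (D.descFun i k) := by
  rw [continuous_iff_continuousAt]
  intro a
  obtain ⟨s, ⟨U, J, hx, h⟩, hsa⟩ := exists_sec (D := D) a
  have hg : ∀ z ∈ U, s ∈ D.good z := fun z hz => ⟨U, J, hz, h⟩
  have h1 : ContinuousAt (fun a : D.Space => (stalkMap k a.pt (s a.pt i)).1) a :=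
    ContinuousAt.comp (f := Space.pt) (g := fun y => (stalkMap k y (s y i)).1)
      ((continuousOn_stalkMap k (h.cont i)).continuousAt (h.isOpen.mem_nhds hx))
      continuous_pt.continuousAt
  refine h1.congr ?_
  filter_upwards [(isOpen_sec h.isOpen hg).mem_nhds ⟨_, hx, hsa⟩]
  rintro _ ⟨y, hy, rfl⟩
  exact (descFun_sec hk (hg y hy)).symm

/-- The morphism out of the sheaf of germs induced by a morphism out of a member of the family. -/
noncomputable def desc (hk : ∀ x, ∀ a ∈ D.den x, stalkMap k x (a i) = 0) : D.sheaf ⟶ F' :=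
  show EqSheaf.Hom D.sheaf F' from
  { toFun := D.descFun i k
    continuous_toFun := continuous_descFun D i k hk
    map_smul := by
      intro g a
      obtain ⟨s, hs, hsa⟩ := exists_sec (D := D) a
      rw [← hsa]
      change D.descFun i k (g • sec s _) = _
      rw [smul_sec g hs, descFun_sec hk (translate_mem_good hs g), descFun_sec hk hs,
        translate_apply]
      exact congrArg Subtype.val (stalkMap_translate k g _ _)
    map_p := fun a => (stalkMap k a.pt ((exists_sec (D := D) a).choose a.pt i)).2
    map_add_fib := by
      intro x a b
      obtain ⟨s, hs, rfl⟩ := exists_fibSec a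
      obtain ⟨t, ht, rfl⟩ := exists_fibSec b
      have e1 := descFun_sec hk hs
      have e2 := descFun_sec hk ht
      have e3 := descFun_sec hk ((D.good x).add_mem hs ht)
      rw [Pi.add_apply, Pi.add_apply, map_add] at e3
      refine (congrArg (D.descFun i k) (congrArg Subtype.val (fibSec_add hs ht))).trans
        (e3.trans ?_)
      congr 2
      · exact Subtype.ext e1.symm
      · exact Subtype.ext e2.symm
    map_scalar_fib := by
      intro x r a
      obtain ⟨s, hs, rfl⟩ := exists_fibSec a
      have e1 := descFun_sec hk hs
      have e3 := descFun_sec hk ((D.good x).smul_mem r hs)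
      rw [Pi.smul_apply, Pi.smul_apply, LinearMap.map_smul] at e3
      refine (congrArg (D.descFun i k) (congrArg Subtype.val (fibSec_scalar hs r))).trans
        (e3.trans ?_)
      congr 2
      exact Subtype.ext e1.symm }

theorem stalkMap_desc (hk : ∀ x, ∀ a ∈ D.den x, stalkMap k x (a i) = 0) {s : D.Family}
    {x : ClosedSubgroup G} (hs : s ∈ D.good x) :
    stalkMap (D.desc i k hk) x (fibSec s x) = stalkMap k x (s x i) :=
  Subtype.ext (descFun_sec hk hs)

end Desc

section Lift

variable [CompactSpace G] [TotallyDisconnectedSpace G]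
  {F : EqSheaf R G (ClosedSubgroup G)} (hF : isWeyl R G F) (h : ∀ i, F ⟶ D.F i)

/-- The family of sections obtained from a section. -/
def mapSection (s : ∀ x, F.Stalk x) : D.Family := fun x i => stalkMap (h i) x (s x)

variable {D h}

theorem mapSection_mem_good (hm : ∀ x a, (fun i => stalkMap (h i) x a) ∈ D.num x)
    {U : Set (ClosedSubgroup G)} {J : Subgroup G} {s : ∀ x, F.Stalk x} (hs : EquivariantOn F U J s)
    {x : ClosedSubgroup G} (hx : x ∈ U) : D.mapSection h s ∈ D.good x :=
  ⟨U, J, hx,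
    { isOpen := hs.isOpen
      isOpen_subgroup := hs.isOpen_subgroup
      stable := hs.stable
      le := hs.le
      mem := fun y _ => hm y (s y)
      cont := fun i => continuousOn_stalkMap (h i) hs.cont
      map_smul := fun j hj y hy i => by
        change Hom.toFun (h i) (s (j • y)).1 = _
        rw [hs.map_smul j hj y hy]
        exact Hom.map_smul (h i) j _ }⟩

variable (D h) in
/-- The function on sheaf spaces induced by a family of morphisms. -/
noncomputable def liftFun (e : F.E) : D.Space :=
  sec (D.mapSection h (exists_equivariantOn hF (⟨e, rfl⟩ : F.Stalk (F.p e))).choose_spec.choose_spec.choose)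
    (F.p e)

/-- `liftFun` uses a chosen equivariant section through `e`. Any other continuous section through
`e` agrees with it near `x`, so it may be used instead as soon as its image family is good.
Equivariance of `s` is not asked for, since translates, sums and multiples get the goodness of their
image family from `translate_mem_good` and the submodule `good`. -/
theorem liftFun_eq (hm : ∀ x a, (fun i => stalkMap (h i) x a) ∈ D.num x) {x : ClosedSubgroup G}
    {s : ∀ x, F.Stalk x} {U : Set (ClosedSubgroup G)} (hU : IsOpen U) (hx : x ∈ U)
    (hs : ContinuousOn (fun x => (s x).1) U) (hg : D.mapSection h s ∈ D.good x)
    {e : F.E} (he : (s x).1 = e) : D.liftFun hF h e = sec (D.mapSection h s) x := by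
  subst he
  -- The chosen section is based at `F.p (s x).1`, equal to `x` only propositionally; generalising
  -- to `y` with `y = x` lets this equality be substituted.
  have hp : ∀ (y : ClosedSubgroup G) (_ : y = x) (t : ∀ x, F.Stalk x),
      t y = ⟨(s y).1, (s y).2⟩ → (∃ V J, y ∈ V ∧ EquivariantOn F V J t) →
      sec (D.mapSection h t) y = sec (D.mapSection h s) x := by
    rintro y rfl t hty ⟨V, J, hy, hV⟩
    refine sec_congr (mapSection_mem_good hm hV hy) hg ?_
    filter_upwards [eventually_eq_of_eq (hV.isOpen.inter hU) (hV.cont.mono fun _ h => h.1)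
      (hs.mono fun _ h => h.2) ⟨hy, hx⟩ hty] with z hz
    funext i
    exact congrArg (stalkMap (h i) z) hz
  have hc := (exists_equivariantOn hF
    (⟨(s x).1, rfl⟩ : F.Stalk (F.p (s x).1))).choose_spec.choose_spec.choose_spec
  refine hp _ (s x).2 _ ?_ ⟨_, _, hc.1, hc.2.1⟩
  rw [hc.2.2]
  apply Subtype.ext
  change (s x).1 = (s (F.p (s x).1)).1
  exact F.section_congr s (s x).2.symm

theorem liftFun_of_equivariantOn (hm : ∀ x a, (fun i => stalkMap (h i) x a) ∈ D.num x)
    {x : ClosedSubgroup G}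
    {s : ∀ x, F.Stalk x} {U : Set (ClosedSubgroup G)} {J : Subgroup G} (hs : EquivariantOn F U J s)
    (hx : x ∈ U) : D.liftFun hF h (s x).1 = sec (D.mapSection h s) x :=
  liftFun_eq hF hm hs.isOpen hx hs.cont (mapSection_mem_good hm hs hx) rfl

theorem continuous_liftFun (hm : ∀ x a, (fun i => stalkMap (h i) x a) ∈ D.num x) :
    Continuous (D.liftFun hF h) := by
  rw [continuous_iff_continuousAt]
  intro e
  obtain ⟨U, J, s, hx, hs, hse⟩ := exists_equivariantOn hF (⟨e, rfl⟩ : F.Stalk (F.p e))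
  have h1 : ContinuousAt (fun e => sec (D.mapSection h s) (F.p e)) e :=
    ContinuousAt.comp (f := F.p) (continuousAt_sec (mapSection_mem_good hm hs hx))
      F.continuous_p.continuousAt
  refine h1.congr ?_
  filter_upwards [eventually_section_eq F.isLocalHomeo hs.isOpen hs.cont
    (fun y _ => (s y).2) hx (congrArg Subtype.val hse)] with e' he'
  have := liftFun_of_equivariantOn hF hm hs he'.1
  rw [he'.2] at this
  exact this.symm

variable (D h) in
/-- The morphism into the sheaf of germs induced by a family of morphisms. -/
noncomputable def lift (hm : ∀ x a, (fun i => stalkMap (h i) x a) ∈ D.num x) : F ⟶ D.sheaf :=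
  show EqSheaf.Hom F D.sheaf from
  { toFun := D.liftFun hF h
    continuous_toFun := continuous_liftFun hF hm
    map_smul := by
      intro g e
      obtain ⟨U, J, s, hx, hs, hse⟩ := exists_equivariantOn hF (⟨e, rfl⟩ : F.Stalk (F.p e))
      have h1 := liftFun_of_equivariantOn hF hm hs hx
      rw [hse] at h1
      have hg := mapSection_mem_good hm hs hx
      change D.liftFun hF h (g • e) = g • D.liftFun hF h e
      rw [h1, smul_sec g hg]
      have h2 : ∀ y, F.p (g • (s (g⁻¹ • y)).1) = y := fun y => by
        rw [F.p_smul, (s (g⁻¹ • y)).2, smul_inv_smul]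
      have h3 : D.mapSection h (fun y => ⟨g • (s (g⁻¹ • y)).1, h2 y⟩) =
          translate g (D.mapSection h s) := by
        funext y i
        exact Subtype.ext (Hom.map_smul (h i) g _)
      rw [← h3]
      have hc : Continuous fun z : ClosedSubgroup G => g⁻¹ • z := continuous_const_smul g⁻¹
      refine liftFun_eq hF hm (hs.isOpen.preimage hc)
        (by simpa using hx) ((hs.cont.comp hc.continuousOn fun _ hz => hz).const_smul g) ?_ ?_
      · rw [h3]
        exact translate_mem_good hg g
      · change g • (s (g⁻¹ • g • F.p e)).1 = _
        congr 1
        trans (s (F.p e)).1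
        · exact F.section_congr s (inv_smul_smul _ _)
        · rw [hse]
    map_p := fun _ => rfl
    map_add_fib := by
      intro x a b
      obtain ⟨U, J, s, hx, hs, rfl⟩ := exists_equivariantOn hF a
      obtain ⟨V, J', t, hx', ht, rfl⟩ := exists_equivariantOn hF b
      have hgs := mapSection_mem_good hm hs hx
      have hgt := mapSection_mem_good hm ht hx'
      have h3 : D.mapSection h (fun y => s y + t y) = D.mapSection h s + D.mapSection h t := by
        funext y i
        exact map_add (stalkMap (h i) y) _ _
      have e3 : D.liftFun hF h (s x + t x).1 = _ :=
        liftFun_eq hF hm (s := fun y => s y + t y) (hs.isOpen.inter ht.isOpen) ⟨hx, hx'⟩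
          (F.continuousOn_add (hs.cont.mono fun _ h => h.1) (ht.cont.mono fun _ h => h.2))
          (by rw [h3]; exact (D.good x).add_mem hgs hgt) rfl
      refine e3.trans ?_
      rw [h3]
      refine (congrArg Subtype.val (fibSec_add hgs hgt)).symm.trans ?_
      congr 2
      · exact Subtype.ext (liftFun_of_equivariantOn hF hm hs hx).symm
      · exact Subtype.ext (liftFun_of_equivariantOn hF hm ht hx').symm
    map_scalar_fib := by
      intro x r a
      obtain ⟨U, J, s, hx, hs, rfl⟩ := exists_equivariantOn hF a
      have hgs := mapSection_mem_good hm hs hx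
      have h3 : D.mapSection h (fun y => r • s y) = r • D.mapSection h s := by
        funext y i
        exact (stalkMap (h i) y).map_smul r _
      have e3 : D.liftFun hF h (r • s x).1 = _ :=
        liftFun_eq hF hm (s := fun y => r • s y) hs.isOpen hx
          (F.continuousOn_scalar r hs.cont)
          (by rw [h3]; exact (D.good x).smul_mem r hgs) rfl
      refine e3.trans ?_
      rw [h3]
      refine (congrArg Subtype.val (fibSec_scalar hgs r)).symm.trans ?_
      congr 2
      exact Subtype.ext (liftFun_of_equivariantOn hF hm hs hx).symm }

theorem stalkMap_lift (hm : ∀ x a, (fun i => stalkMap (h i) x a) ∈ D.num x) {x : ClosedSubgroup G}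
    {s : ∀ x, F.Stalk x} {U : Set (ClosedSubgroup G)} {J : Subgroup G} (hs : EquivariantOn F U J s)
    (hx : x ∈ U) :
    stalkMap (D.lift hF h hm) x (s x) = fibSec (D.mapSection h s) x :=
  Subtype.ext (liftFun_of_equivariantOn hF hm hs hx)

end Lift

end Hom

end GermData

/-! ### Zero germs and projections from a sheaf of germs -/

open EqSheaf

namespace GermData

variable {R G : Type u} [Ring R] [Group G] [TopologicalSpace G] [IsTopologicalGroup G]
  {D : GermData R G}

theorem apply_mem_num {s : D.Family} {x : ClosedSubgroup G} (hs : s ∈ D.good x) :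
    s x ∈ D.num x := by
  obtain ⟨U, J, hx, h⟩ := hs
  exact h.mem x hx

theorem fibSec_zero (x : ClosedSubgroup G) : fibSec (0 : D.Family) x = 0 := by
  have := fibSec_sub (D.good x).zero_mem (D.good x).zero_mem
  rwa [sub_self, sub_self, eq_comm] at this

theorem fibSec_eq_fibSec {s t : D.Family} {x : ClosedSubgroup G} (hs : s ∈ D.good x)
    (ht : t ∈ D.good x) : fibSec s x = fibSec t x ↔ s - t ∈ D.null x :=
  Subtype.ext_iff.trans (sec_eq_sec hs ht)

theorem fibSec_eq_zero_iff {s : D.Family} {x : ClosedSubgroup G} (hs : s ∈ D.good x) :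
    fibSec s x = 0 ↔ s ∈ D.null x := by
  rw [← fibSec_zero, fibSec_eq_fibSec hs (D.good x).zero_mem, sub_zero]

variable [CompactSpace G] [TotallyDisconnectedSpace G]

variable (D) in
/-- The projection of a sheaf of germs with `den = 0` onto a member of the family. -/
noncomputable abbrev proj (hD : ∀ x, D.den x = ⊥) (i : D.ι) : D.sheaf ⟶ D.F i :=
  D.desc i (𝟙 _) fun x a ha => by
    rw [hD, Submodule.mem_bot] at ha
    rw [ha, Pi.zero_apply, map_zero]

theorem stalkMap_proj (hD : ∀ x, D.den x = ⊥) (i : D.ι) {s : D.Family}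
    {x : ClosedSubgroup G} (hs : s ∈ D.good x) :
    stalkMap (D.proj hD i) x (fibSec s x) = s x i :=
  stalkMap_desc D i (𝟙 _) _ hs

/-- Represent `m (s x)` by a family `t`. Then `m ∘ s` and the germs of `t` are continuous sections
that agree at `x`, hence on a neighbourhood, and there every component of `t` is read off from the
projections, on one neighbourhood for all `i`. With `den = 0` these values near `x` determine the
germ. -/
theorem hom_ext_proj (hD : ∀ x, D.den x = ⊥) {T : EqSheaf R G (ClosedSubgroup G)}
    (hT : isWeyl R G T) {m m' : T ⟶ D.sheaf}
    (h : ∀ i, m ≫ D.proj hD i = m' ≫ D.proj hD i) : m = m' := by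
  refine hom_ext_stalkMap fun x a => ?_
  obtain ⟨U, J, s, hx, hs, rfl⟩ := exists_equivariantOn hT a
  have key : ∀ m : T ⟶ D.sheaf, ∃ t ∈ D.good x, stalkMap m x (s x) = fibSec t x ∧
      ∀ᶠ y in 𝓝 x, ∀ i, stalkMap (m ≫ D.proj hD i) y (s y) = t y i := by
    intro m
    obtain ⟨t, ht, hm⟩ := exists_fibSec (stalkMap m x (s x))
    refine ⟨t, ht, hm.symm, ?_⟩
    have hc : ContinuousOn (fun y => (fibSec t y).1) {y | t ∈ D.good y} :=
      fun y hy => (continuousAt_sec hy).continuousWithinAt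
    have ho := hs.isOpen.inter (isOpen_good t)
    filter_upwards [eventually_eq_of_eq (F := D.sheaf) ho
      ((continuousOn_stalkMap m hs.cont).mono fun _ h => h.1) (hc.mono fun _ h => h.2) ⟨hx, ht⟩
      hm.symm, (isOpen_good t).mem_nhds ht] with y h1 h2 i
    rw [stalkMap_comp, h1]
    exact stalkMap_proj hD i h2
  obtain ⟨t, ht, hm, h1⟩ := key m
  obtain ⟨t', ht', hm', h2⟩ := key m'
  rw [hm, hm']
  refine Subtype.ext (sec_congr ht ht' ?_)
  filter_upwards [h1, h2] with y h1 h2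
  funext i
  rw [← h1 i, ← h2 i, h i]

end GermData

/-! ### Monomorphisms and epimorphisms of Weyl sheaves through stalks -/

section Limits

variable {R G : Type u} [Ring R] [Group G] [TopologicalSpace G] [IsTopologicalGroup G]
  {F F' : WeylSheaf R G} (f : F ⟶ F')

theorem weyl_hom_ext {f g : F ⟶ F'} (h : ∀ x a, stalkMap f.hom x a = stalkMap g.hom x a) : f = g :=
  ObjectProperty.hom_ext _ (hom_ext_stalkMap h)

variable {f} in
theorem mono_of_stalkMap_injective (h : ∀ x, Function.Injective (stalkMap f.hom x)) : Mono f where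
  right_cancellation g g' w := weyl_hom_ext fun x a => h x (by
    rw [← stalkMap_comp, ← stalkMap_comp, ← ObjectProperty.FullSubcategory.comp_hom, w]
    rfl)

variable {f} in
theorem epi_of_stalkMap_surjective (h : ∀ x, Function.Surjective (stalkMap f.hom x)) : Epi f where
  left_cancellation g g' w := weyl_hom_ext fun x a => by
    obtain ⟨a, rfl⟩ := h x a
    rw [← stalkMap_comp, ← stalkMap_comp, ← ObjectProperty.FullSubcategory.comp_hom, w]
    rfl

/-! ### Kernels -/

/-- The data defining the kernel of a morphism. -/
def kerData : GermData R G where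
  ι := PUnit
  F _ := F.obj
  num x := (LinearMap.ker (stalkMap f.hom x)).comap (LinearMap.proj PUnit.unit)
  den _ := ⊥
  num_smul g x a ha := by
    change stalkMap f.hom (g • x) (F.obj.translate g x (a PUnit.unit)) = 0
    rw [stalkMap_translate, show stalkMap f.hom x (a PUnit.unit) = 0 from ha, map_zero]
  den_smul g x a ha := by
    rw [Submodule.mem_bot] at ha ⊢
    rw [ha, map_zero]

/-- The data defining the cokernel of a morphism. -/
def cokerData : GermData R G where
  ι := PUnit
  F _ := F'.obj
  num _ := ⊤
  den x := (LinearMap.range (stalkMap f.hom x)).comap (LinearMap.proj PUnit.unit)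
  num_smul _ _ _ _ := trivial
  den_smul g x a ha := by
    obtain ⟨b, hb⟩ := ha
    exact ⟨F.obj.translate g x b, by rw [stalkMap_translate, hb]; rfl⟩

variable [CompactSpace G] [TotallyDisconnectedSpace G]

/-- The inclusion of the kernel. -/
noncomputable def kerι : (kerData f).weylSheaf ⟶ F :=
  ObjectProperty.homMk ((kerData f).proj (fun _ => rfl) PUnit.unit)

theorem kerι_comp : kerι f ≫ f = 0 := by
  refine weyl_hom_ext fun x a => ?_
  obtain ⟨s, hs, rfl⟩ := GermData.exists_fibSec a
  refine Eq.trans ?_ (stalkMap_zero x _).symm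
  exact (congrArg (stalkMap f.hom x) (GermData.stalkMap_proj (D := kerData f) (fun _ => rfl)
    PUnit.unit hs)).trans (GermData.apply_mem_num hs)

/-- Extend `a` to an equivariant section `s`. Its image under `f` vanishes at `x`, hence on an open
set, and this set is stable under `J` because `f` is equivariant. So `s` defines a germ of the
kernel. -/
theorem exists_kerι {x : ClosedSubgroup G} {a : F.obj.Stalk x} (ha : stalkMap f.hom x a = 0) :
    ∃ b, stalkMap (kerι f).hom x b = a := by
  obtain ⟨U, J, s, hx, hs, rfl⟩ := exists_equivariantOn F.property a
  have h0 : IsOpen {y | y ∈ U ∧ stalkMap f.hom y (s y) = 0} := by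
    have := isOpen_lift_eq F'.obj.isLocalHomeo hs.isOpen (continuousOn_stalkMap f.hom hs.cont)
      F'.obj.continuous_zero.continuousOn
      fun y _ => (stalkMap f.hom y (s y)).2.trans (0 : F'.obj.Stalk y).2.symm
    simpa only [Subtype.ext_iff] using this
  have hg : (fun y _ => s y : (kerData f).Family) ∈ (kerData f).good x := by
    refine ⟨{y | y ∈ U ∧ stalkMap f.hom y (s y) = 0}, J, ⟨hx, ha⟩, h0, hs.isOpen_subgroup, ?_, fun y hy => hs.le y hy.1, fun y hy => hy.2,
      fun _ => hs.cont.mono fun y hy => hy.1, fun j hj y hy _ => hs.map_smul j hj y hy.1⟩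
    intro j hj y hy
    refine ⟨hs.stable j hj y hy.1, ?_⟩
    rw [show s (j • y) = F.obj.translate j y (s y) from Subtype.ext (hs.map_smul j hj y hy.1),
      stalkMap_translate, hy.2, map_zero]
  exact ⟨GermData.fibSec (D := kerData f) (fun y _ => s y) x, GermData.stalkMap_proj (D := kerData f) (fun _ => rfl) PUnit.unit hg⟩

/-- A monomorphism cancels the inclusion of its kernel against zero, while this inclusion reaches
every element of a stalk that `f` kills. -/
theorem stalkMap_injective_of_mono [Mono f] (x : ClosedSubgroup G) :
    Function.Injective (stalkMap f.hom x) := by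
  rw [injective_iff_map_eq_zero]
  intro a ha
  obtain ⟨b, rfl⟩ := exists_kerι f ha
  have h : kerι f = 0 := by
    rw [← cancel_mono f, kerι_comp, zero_comp]
  rw [h]
  exact stalkMap_zero x b

/-- The factorization of a morphism through the kernel. -/
noncomputable def kerLift {T : WeylSheaf R G} (h : T ⟶ F) (w : h ≫ f = 0) :
    T ⟶ (kerData f).weylSheaf :=
  ObjectProperty.homMk ((kerData f).lift T.property (fun _ => h.hom) fun x a => by
    change stalkMap (h ≫ f).hom x a = 0
    rw [w]
    exact stalkMap_zero x a)

theorem kerLift_kerι {T : WeylSheaf R G} (h : T ⟶ F) (w : h ≫ f = 0) :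
    kerLift f h w ≫ kerι f = h := by
  refine weyl_hom_ext fun x a => ?_
  obtain ⟨U, J, s, hx, hs, rfl⟩ := exists_equivariantOn T.property a
  have hm : ∀ x a, (fun _ => stalkMap h.hom x a : ∀ _ : (kerData f).ι, _) ∈ (kerData f).num x := by
    intro x a
    change stalkMap (h ≫ f).hom x a = 0
    rw [w]
    exact stalkMap_zero x a
  refine (congrArg (stalkMap (kerι f).hom x) (GermData.stalkMap_lift T.property hm hs hx)).trans ?_
  exact GermData.stalkMap_proj (D := kerData f) (fun _ => rfl) PUnit.unit
    (GermData.mapSection_mem_good hm hs hx)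

instance mono_kerι : Mono (kerι f) where
  right_cancellation {T} _ _ w := ObjectProperty.hom_ext _
    (GermData.hom_ext_proj (D := kerData f) (fun _ => rfl) T.property fun _ =>
      congrArg InducedCategory.Hom.hom w)

/-- The sheaf of germs of sections of the kernel is a kernel. -/
noncomputable def kerIsLimit : IsLimit (KernelFork.ofι (kerι f) (kerι_comp f)) :=
  KernelFork.IsLimit.ofι _ _ (fun h w => kerLift f h w) (fun h w => kerLift_kerι f h w)
    fun h w m hm => by rw [← cancel_mono (kerι f), hm, kerLift_kerι]

/-! ### Cokernels -/

/-- The projection onto the cokernel. -/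
noncomputable def cokerπ : F' ⟶ (cokerData f).weylSheaf :=
  ObjectProperty.homMk ((cokerData f).lift F'.property (fun _ => 𝟙 _) fun _ _ => trivial)

theorem stalkMap_cokerπ {x : ClosedSubgroup G} {s : ∀ x, F'.obj.Stalk x}
    {U : Set (ClosedSubgroup G)} {J : Subgroup G} (hs : EquivariantOn F'.obj U J s) (hx : x ∈ U) :
    (fun y _ => s y : (cokerData f).Family) ∈ (cokerData f).good x ∧
    stalkMap (cokerπ f).hom x (s x) =
      GermData.fibSec (fun y _ => s y : (cokerData f).Family) x :=
  ⟨GermData.mapSection_mem_good (D := cokerData f) (h := fun _ => 𝟙 F'.obj) (fun _ _ => trivial)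
      hs hx,
    GermData.stalkMap_lift (D := cokerData f) F'.property (fun _ _ => trivial) hs hx⟩

/-- A zero germ is in the image of `f` near `x`, in particular at `x`. Conversely a preimage at `x`
extends to a section, whose image agrees with `s` near `x`. -/
theorem stalkMap_cokerπ_eq_zero_iff {x : ClosedSubgroup G} (a : F'.obj.Stalk x) :
    stalkMap (cokerπ f).hom x a = 0 ↔ ∃ b, stalkMap f.hom x b = a := by
  obtain ⟨U, J, s, hx, hs, rfl⟩ := exists_equivariantOn F'.property a
  obtain ⟨h1, h2⟩ := stalkMap_cokerπ f hs hx
  rw [h2]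
  refine (GermData.fibSec_eq_zero_iff h1).trans ⟨fun h => ?_, ?_⟩
  · have h' : ∀ᶠ y in 𝓝 x, ∃ b, stalkMap f.hom y b = s y := h
    exact h'.self_of_nhds
  · rintro ⟨b, hb⟩
    obtain ⟨V, J', t, hx', ht, rfl⟩ := exists_equivariantOn F.property b
    change ∀ᶠ y in 𝓝 x, ∃ b, stalkMap f.hom y b = s y
    filter_upwards [eventually_eq_of_eq (ht.isOpen.inter hs.isOpen)
      ((continuousOn_stalkMap f.hom ht.cont).mono fun _ h => h.1) (hs.cont.mono fun _ h => h.2)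
      ⟨hx', hx⟩ hb] with y hy
    exact ⟨t y, hy⟩

/-- A good family over the one-point index set is an equivariant section of the target, so every
germ already comes from a point. -/
theorem stalkMap_cokerπ_surjective (x : ClosedSubgroup G) :
    Function.Surjective (stalkMap (cokerπ f).hom x) := by
  intro b
  obtain ⟨s, ⟨U, J, hx, hs⟩, rfl⟩ := GermData.exists_fibSec b
  exact ⟨s x PUnit.unit, (stalkMap_cokerπ f (s := fun y => s y PUnit.unit)
    ⟨hs.isOpen, hs.isOpen_subgroup, hs.stable, hs.le, hs.cont PUnit.unit,
      fun j hj y hy => hs.map_smul j hj y hy _⟩ hx).2⟩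

instance : Epi (cokerπ f) := epi_of_stalkMap_surjective (stalkMap_cokerπ_surjective f)

theorem comp_cokerπ : f ≫ cokerπ f = 0 := by
  refine weyl_hom_ext fun x a => ?_
  refine Eq.trans ?_ (stalkMap_zero x _).symm
  exact (stalkMap_cokerπ_eq_zero_iff f _).2 ⟨a, rfl⟩

theorem stalkMap_eq_zero_of_mem_den {T : WeylSheaf R G} {h : F' ⟶ T} (w : f ≫ h = 0) :
    ∀ x, ∀ a ∈ (cokerData f).den x, stalkMap h.hom x (a PUnit.unit) = 0 := by
  rintro x a ⟨b, hb⟩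
  rw [show a PUnit.unit = stalkMap f.hom x b from hb.symm, ← stalkMap_comp,
    ← ObjectProperty.FullSubcategory.comp_hom, w]
  exact stalkMap_zero x b

/-- The factorization of a morphism through the cokernel. -/
noncomputable def cokerDesc {T : WeylSheaf R G} (h : F' ⟶ T) (w : f ≫ h = 0) :
    (cokerData f).weylSheaf ⟶ T :=
  ObjectProperty.homMk ((cokerData f).desc PUnit.unit h.hom (stalkMap_eq_zero_of_mem_den f w))

theorem cokerπ_cokerDesc {T : WeylSheaf R G} (h : F' ⟶ T) (w : f ≫ h = 0) :
    cokerπ f ≫ cokerDesc f h w = h := by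
  refine weyl_hom_ext fun x a => ?_
  obtain ⟨U, J, s, hx, hs, rfl⟩ := exists_equivariantOn F'.property a
  obtain ⟨h1, h2⟩ := stalkMap_cokerπ f hs hx
  exact (congrArg (stalkMap (cokerDesc f h w).hom x) h2).trans
    (GermData.stalkMap_desc (cokerData f) PUnit.unit h.hom (stalkMap_eq_zero_of_mem_den f w) h1)

/-- The sheaf of germs of sections modulo the image is a cokernel. -/
noncomputable def cokerIsColimit : IsColimit (CokernelCofork.ofπ (cokerπ f) (comp_cokerπ f)) :=
  CokernelCofork.IsColimit.ofπ _ _ (fun h w => cokerDesc f h w)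
    (fun h w => cokerπ_cokerDesc f h w)
    fun h w m hm => by rw [← cancel_epi (cokerπ f), hm, cokerπ_cokerDesc]

end Limits

/-! ### Products -/

section Products

variable {R G : Type u} [Ring R] [Group G] [TopologicalSpace G] [IsTopologicalGroup G]
  {ι : Type u} (F : ι → WeylSheaf R G)

/-- The data defining the product of a family of Weyl sheaves. -/
def prodData : GermData R G where
  ι := ι
  F i := (F i).obj
  num _ := ⊤
  den _ := ⊥
  num_smul _ _ _ _ := trivial
  den_smul g x a ha := by
    rw [Submodule.mem_bot] at ha ⊢
    rw [ha, map_zero]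

variable [CompactSpace G] [TotallyDisconnectedSpace G]

/-- The projections of the product. -/
noncomputable def prodπ (i : ι) : (prodData F).weylSheaf ⟶ F i :=
  ObjectProperty.homMk ((prodData F).proj (fun _ => rfl) i)

/-- The morphism into the product with given components. -/
noncomputable def prodLift {T : WeylSheaf R G} (h : ∀ i, T ⟶ F i) : T ⟶ (prodData F).weylSheaf :=
  ObjectProperty.homMk ((prodData F).lift T.property (fun i => (h i).hom) fun _ _ => trivial)

theorem prodLift_prodπ {T : WeylSheaf R G} (h : ∀ i, T ⟶ F i) (i : ι) :
    prodLift F h ≫ prodπ F i = h i := by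
  refine weyl_hom_ext fun x a => ?_
  obtain ⟨U, J, s, hx, hs, rfl⟩ := exists_equivariantOn T.property a
  refine (congrArg (stalkMap (prodπ F i).hom x) (GermData.stalkMap_lift (D := prodData F) T.property
    (h := fun i => (h i).hom) (fun _ _ => trivial) hs hx)).trans ?_
  exact GermData.stalkMap_proj (D := prodData F) (fun _ => rfl) i
    (GermData.mapSection_mem_good (D := prodData F) (h := fun i => (h i).hom) (fun _ _ => trivial)
      hs hx)

/-- The sheaf of germs of families of sections is a product. -/
noncomputable def prodIsLimit : IsLimit (Fan.mk (prodData F).weylSheaf (prodπ F)) :=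
  Fan.IsLimit.mk _ (fun s => prodLift F s.proj) (fun s i => prodLift_prodπ F s.proj i)
    fun s _ hm => ObjectProperty.hom_ext _
      (GermData.hom_ext_proj (D := prodData F) (fun _ => rfl) s.pt.property fun i =>
        congrArg InducedCategory.Hom.hom ((hm i).trans (prodLift_prodπ F s.proj i).symm))

end Products

/-! ### Morphisms into equivariant skyscrapers -/

namespace Ind

variable {R G : Type u} [Ring R] [Group G] [TopologicalSpace G] {H : Subgroup G} {M : DiscMod R H}

theorem val_add {g : G} {a b : M.M} {v w : Fib (proj M) (g : G ⧸ H)} (hv : v.1 = mk M g a)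
    (hw : w.1 = mk M g b) : (v + w).1 = mk M g (a + b) := by
  obtain ⟨v, hv'⟩ := v
  obtain ⟨w, hw'⟩ := w
  obtain rfl : v = _ := hv
  obtain rfl : w = _ := hw
  exact congrArg Subtype.val (mk_add_mk _ g rfl a b)

theorem val_scalar {g : G} (r : R) {a : M.M} {v : Fib (proj M) (g : G ⧸ H)}
    (hv : v.1 = mk M g a) : (r • v).1 = mk M g (r • a) := by
  obtain ⟨v, hv'⟩ := v
  obtain rfl : v = _ := hv
  exact congrArg Subtype.val (scalar_mk _ g rfl r a)

end Ind

section SkyscraperHom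

variable {R G X : Type u} [Ring R] [Group G] [TopologicalSpace G] [IsTopologicalGroup G]
  [TopologicalSpace X] [MulAction G X]

/-- The action of the stabilizer of `x` on the stalk at `x`. -/
def stabSmul (F : EqSheaf R G X) (x : X) (n : MulAction.stabilizer G x) (e : F.Stalk x) :
    F.Stalk x := ⟨(n : G) • e.1, by rw [F.p_smul, e.2]; exact n.2⟩

/-- The projection is injective near each point, so a small open set meets the fibre only there.
Hence every map out of a stalk is continuous. -/
instance discreteTopology_stalk (F : EqSheaf R G X) (x : X) : DiscreteTopology (F.Stalk x) := by
  rw [discreteTopology_iff_isOpen_singleton]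
  intro e
  obtain ⟨V, hV, heV, hinj⟩ := F.isLocalHomeo.isLocallyInjective e.1
  convert hV.preimage (continuous_subtype_val : Continuous (Subtype.val : F.Stalk x → F.E))
  ext e'
  refine ⟨?_, fun h => Subtype.ext (hinj h heV (e'.2.trans e.2.symm))⟩
  rintro rfl
  exact heV

variable [CompactSpace G] [T2Space X] [ContinuousSMul G X] {F : EqSheaf R G X} {x : X}
  {M : DiscMod R (MulAction.stabilizer G x)} (φ : F.Stalk x →ₗ[R] M.M)

theorem p_inv_smul {e : F.E} {g : G} (h : g • x = F.p e) : F.p (g⁻¹ • e) = x := by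
  rw [F.p_smul, ← h, inv_smul_smul]

/-- The map of sheaf spaces `e ↦ (g stab x ↦ [g, φ (g⁻¹ e)])`. -/
noncomputable def skyscraperFun (e : F.E) : Ext.Space (orbitMap G x) (indSheaf M) :=
  ⟨F.p e, fun y hy => ⟨Ind.mk M y.out (φ ⟨y.out⁻¹ • e, p_inv_smul (by
    rw [← hy]
    nth_rewrite 2 [← QuotientGroup.out_eq' y]
    rfl)⟩), QuotientGroup.out_eq' y⟩⟩

variable {φ} (hφ : ∀ n e, φ (stabSmul F x n e) = n • φ e)

include hφ

/-- The definition uses the representative `y.out`. Any other `g` serves as well, since equivariance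
of `φ` gives `[g n, φ ((g n)⁻¹ e)] = [g, n φ (n⁻¹ g⁻¹ e)] = [g, φ (g⁻¹ e)]` for `n` in the
stabilizer. -/
theorem skyscraperFun_val {e : F.E} {g : G} (h : g • x = F.p e)
    (hy : orbitMap G x (g : G ⧸ MulAction.stabilizer G x) = F.p e) :
    ((skyscraperFun φ e).val (g : G ⧸ MulAction.stabilizer G x) hy).1 =
      Ind.mk M g (φ ⟨g⁻¹ • e, p_inv_smul h⟩) := by
  obtain ⟨n, hn⟩ : ∃ n : MulAction.stabilizer G x,
      (g : G ⧸ MulAction.stabilizer G x).out = g * n := by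
    refine ⟨⟨g⁻¹ * (g : G ⧸ MulAction.stabilizer G x).out, ?_⟩, by simp⟩
    rw [← QuotientGroup.eq]
    exact (QuotientGroup.out_eq' _).symm
  change Ind.mk M (g : G ⧸ MulAction.stabilizer G x).out
    (φ ⟨(g : G ⧸ MulAction.stabilizer G x).out⁻¹ • e, _⟩) = _
  have key : ∀ (k : G) (hk : k = g * n) (hk' : F.p (k⁻¹ • e) = x),
      Ind.mk M k (φ ⟨k⁻¹ • e, hk'⟩) = Ind.mk M g (φ ⟨g⁻¹ • e, p_inv_smul h⟩) := by
    rintro _ rfl hk'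
    rw [Ind.mk_mul, ← hφ]
    congr 2
    apply Subtype.ext
    change (n : G) • (g * n)⁻¹ • e = g⁻¹ • e
    rw [mul_inv_rev, mul_smul, smul_inv_smul]
  exact key _ hn _

/-- Along a local section `s` of `F` the map is the germ of one section `t` of `G ×_H M`, where `H =
stab x`, so it suffices that `t` is continuous. -/
theorem continuous_skyscraperFun : Continuous (skyscraperFun φ) := by
  rw [continuous_iff_continuousAt]
  intro e
  obtain ⟨U, s, hU, hx, hs, hse⟩ := F.exists_section e
  have horb : ∀ y, orbitMap G x y = F.p (s (orbitMap G x y)).1 := fun y => (s _).2.symm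
  let t : ∀ y, (indSheaf M).Stalk y := fun y =>
    (skyscraperFun φ (s (orbitMap G x y)).1).val y (horb y)
  have ht : ∀ z, Ext.sec (orbitMap G x) t z = skyscraperFun φ (s z).1 := by
    intro z
    refine (Ext.sec_eq_iff (a := skyscraperFun φ (s z).1) (s := t) (s z).2.symm).2 ?_
    intro y hy
    have : z = orbitMap G x y := ((s z).2.symm.trans hy.symm)
    subst this
    rfl
  have htc : ContinuousOn (fun y => (t y).1) (orbitMap G x ⁻¹' U) := by
    have hUo : IsOpen (orbitMap G x ⁻¹' U) :=
      hU.preimage (isClosedEmbedding_orbitMap x).continuous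
    intro y hy
    obtain ⟨g, rfl⟩ := QuotientGroup.mk_surjective y
    refine ContinuousAt.continuousWithinAt ?_
    -- After pulling back along the open quotient map from `G`, the section is `k ↦ [k, φ (k⁻¹ s(k
    -- x))]`, with no choice of representatives; `φ` is continuous because the stalk is discrete.
    rw [← (QuotientGroup.isOpenQuotientMap_mk (N := MulAction.stabilizer G x)).continuousAt_comp_iff]
    have hc : Continuous fun k : G => k • x := continuous_id.smul continuous_const
    have h1 : ContinuousOn (fun k : G => k⁻¹ • (s (k • x)).1) {k : G | k • x ∈ U} :=
      continuous_inv.continuousOn.smul (hs.comp hc.continuousOn fun _ hk => hk)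
    have h2 : ContinuousAt (fun k : G => k⁻¹ • (s (k • x)).1) g :=
      h1.continuousAt ((hU.preimage hc).mem_nhds hy)
    have hm : ∀ k : G, F.p (k⁻¹ • (s (k • x)).1) = x := fun k => p_inv_smul (s (k • x)).2.symm
    have h3 : ContinuousAt (fun k : G => (⟨k⁻¹ • (s (k • x)).1, hm k⟩ : F.Stalk x)) g :=
      IsInducing.subtypeVal.continuousAt_iff.2 h2
    have h4 : ContinuousAt (fun k : G =>
        Ind.mk M k (φ ⟨k⁻¹ • (s (k • x)).1, hm k⟩)) g :=
      ContinuousAt.comp (g := fun z : G × M.M => Ind.mk M z.1 z.2)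
        (f := fun k : G => (k, φ ⟨k⁻¹ • (s (k • x)).1, hm k⟩)) Ind.continuous_mk.continuousAt
        (continuousAt_id.prodMk (ContinuousAt.comp (g := φ)
          (continuous_of_discreteTopology.continuousAt) h3))
    refine h4.congr (Filter.Eventually.of_forall fun k => ?_)
    exact (skyscraperFun_val hφ (horb (k : G ⧸ MulAction.stabilizer G x)) (horb _)).symm
  have h1 : ContinuousAt (fun e => Ext.sec (orbitMap G x) t (F.p e)) e :=
    ContinuousAt.comp (f := F.p) (g := Ext.sec (orbitMap G x) t)
      ((Ext.continuousOn_sec (isClosedEmbedding_orbitMap x) hU htc).continuousAt (hU.mem_nhds hx))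
      F.continuous_p.continuousAt
  refine h1.congr ?_
  filter_upwards [eventually_section_eq F.isLocalHomeo hU hs (fun y _ => (s y).2) hx hse]
    with e' he'
  rw [ht, he'.2]

/-- The morphism to the skyscraper of `M` at `x` given by an equivariant map from the stalk at `x`
to `M`. -/
noncomputable def skyscraperHom : F ⟶ skyscraper x M :=
  show EqSheaf.Hom F (skyscraper x M) from
  { toFun := skyscraperFun φ
    continuous_toFun := continuous_skyscraperFun hφ
    map_smul := by
      intro g e
      refine Ext.Space.ext_val (F.p_smul g e) fun y h1 h2 => Subtype.ext ?_
      obtain ⟨k, rfl⟩ := QuotientGroup.mk_surjective y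
      obtain ⟨k, rfl⟩ : ∃ k', g * k' = k := ⟨g⁻¹ * k, mul_inv_cancel_left g k⟩
      have h3 : (g * k) • x = F.p (g • e) := h1
      have h4 : k • x = F.p e := by
        rw [F.p_smul, mul_smul] at h3
        exact smul_left_cancel g h3
      refine (skyscraperFun_val hφ h3 h1).trans ?_
      refine Eq.trans ?_ (Ext.smul_val (f := orbitMap G x) g (skyscraperFun φ e)
        (k : G ⧸ MulAction.stabilizer G x) h4 h2).symm
      refine Eq.trans ?_ (congrArg (g • ·) (skyscraperFun_val hφ h4 h4)).symm
      change _ = Ind.mk M (g * k) _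
      congr 3
      rw [mul_inv_rev, mul_smul, inv_smul_smul]
    map_p := fun _ => rfl
    map_add_fib := by
      intro y a b
      refine Ext.Space.ext_val (a + b).2 fun z h1 h2 => Subtype.ext ?_
      obtain ⟨g, rfl⟩ := QuotientGroup.mk_surjective z
      have hg : g • x = y := h2
      have ha : g • x = F.p a.1 := hg.trans a.2.symm
      have hb : g • x = F.p b.1 := hg.trans b.2.symm
      refine (skyscraperFun_val hφ h1 h1).trans ?_
      have e1 := skyscraperFun_val hφ ha ha
      have e2 := skyscraperFun_val hφ hb hb
      refine Eq.trans ?_ (Ind.val_add e1 e2).symm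
      rw [← map_add]
      congr 2
      apply Subtype.ext
      have := F.smul_add_fib g⁻¹ y a b
      refine this.trans ?_
      have hy : g⁻¹ • y = x := by rw [← hg, inv_smul_smul]
      subst hy
      rfl
    map_scalar_fib := by
      intro y r a
      refine Ext.Space.ext_val (r • a).2 fun z h1 h2 => Subtype.ext ?_
      obtain ⟨g, rfl⟩ := QuotientGroup.mk_surjective z
      have hg : g • x = y := h2
      have ha : g • x = F.p a.1 := hg.trans a.2.symm
      refine (skyscraperFun_val hφ h1 h1).trans ?_
      have e1 := skyscraperFun_val hφ ha ha
      refine Eq.trans ?_ (Ind.val_scalar r e1).symm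
      rw [← LinearMap.map_smul]
      congr 2
      apply Subtype.ext
      have := F.smul_scalar_fib g⁻¹ y r a
      refine this.trans ?_
      have hy : g⁻¹ • y = x := by rw [← hg, inv_smul_smul]
      subst hy
      rfl }

theorem stalkMap_skyscraperHom (e : F.Stalk x) :
    stalkMap (skyscraperHom hφ) x e = skyscraperGerm x M (φ e) := by
  refine Subtype.ext (Ext.Space.ext_val e.2 fun y h1 h2 => Subtype.ext ?_)
  have hx : (1 : G) • x = F.p e.1 := (one_smul G x).trans e.2.symm
  obtain rfl : ((1 : G) : G ⧸ MulAction.stabilizer G x) = y :=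
    MulAction.injective_ofQuotientStabilizer G x (hx.trans h1.symm)
  refine (skyscraperFun_val hφ hx hx).trans ?_
  change Ind.mk M 1 _ = Ind.mk M 1 _
  congr 2
  apply Subtype.ext
  change (1 : G)⁻¹ • e.1 = e.1
  rw [inv_one, one_smul]

omit hφ in
-- Over the orbit of `x`, points are moved into the stalk at `x` by the group; elsewhere the stalks
-- of the skyscraper are zero.
theorem skyscraper_hom_ext {m m' : F ⟶ skyscraper x M}
    (h : ∀ e, stalkMap m x e = stalkMap m' x e) : m = m' := by
  refine Hom.ext (funext fun e => ?_)
  by_cases hx : ∃ g : G, g • x = F.p e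
  · obtain ⟨g, hg⟩ := hx
    have h1 := congrArg Subtype.val (h ⟨g⁻¹ • e, p_inv_smul hg⟩)
    rw [← smul_inv_smul g e, Hom.map_smul m, Hom.map_smul m']
    exact congrArg (g • ·) h1
  · refine Ext.Space.ext_val ((Hom.map_p m e).trans (Hom.map_p m' e).symm) fun y h1 h2 => ?_
    obtain ⟨g, rfl⟩ := QuotientGroup.mk_surjective y
    have h3 : g • x = F.p e := (Eq.trans h1 (Hom.map_p m e) : _)
    exact (hx ⟨g, h3⟩).elim

omit hφ

variable (x M) in
theorem skyscraperGerm_bijective : Function.Bijective (skyscraperGerm x M) := by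
  have h1 : orbitMap G x ((1 : G) : G ⧸ MulAction.stabilizer G x) = x := one_smul G x
  constructor
  · intro a b hab
    have h2 : (skyscraperGerm x M a).1 = (skyscraperGerm x M b).1 := congrArg Subtype.val hab
    have h3 : ∀ (c d : Ext.Space (orbitMap G x) (indSheaf M)) (_ : c = d)
        (hc : orbitMap G x ((1 : G) : G ⧸ MulAction.stabilizer G x) = c.pt)
        (hd : orbitMap G x ((1 : G) : G ⧸ MulAction.stabilizer G x) = d.pt),
        (c.val _ hc).1 = (d.val _ hd).1 := by
      rintro c _ rfl _ _
      rfl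
    exact Ind.mk_inj.1 (h3 _ _ h2 h1 h1)
  · rintro ⟨c, hc⟩
    have h2 : orbitMap G x ((1 : G) : G ⧸ MulAction.stabilizer G x) = Ext.Space.pt c :=
      h1.trans hc.symm
    obtain ⟨m, hm⟩ := Ind.exists_mk_of_proj (M := M) (g := 1) (Ext.Space.val c _ h2).2
    refine ⟨m, Subtype.ext (Ext.Space.ext_val hc.symm fun y h3 h4 => Subtype.ext ?_)⟩
    obtain rfl : ((1 : G) : G ⧸ MulAction.stabilizer G x) = y :=
      MulAction.injective_ofQuotientStabilizer G x (h2.trans h4.symm)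
    exact hm

theorem skyscraperGerm_add (a b : M.M) :
    skyscraperGerm x M (a + b) = skyscraperGerm x M a + skyscraperGerm x M b := by
  refine Subtype.ext (Ext.Space.ext_val rfl fun y h1 h2 => ?_)
  exact (Ind.mk_add_mk y 1 _ a b).symm

theorem skyscraperGerm_scalar (r : R) (a : M.M) :
    skyscraperGerm x M (r • a) = r • skyscraperGerm x M a := by
  refine Subtype.ext (Ext.Space.ext_val rfl fun y h1 h2 => ?_)
  exact (Ind.scalar_mk y 1 _ r a).symm

theorem skyscraperGerm_smul (n : MulAction.stabilizer G x) (a : M.M) :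
    skyscraperGerm x M (n • a) = stabSmul (skyscraper x M) x n (skyscraperGerm x M a) := by
  have hn : (n : G) • x = x := n.2
  refine Subtype.ext (Ext.Space.ext_val hn.symm fun y h1 h2 => Subtype.ext ?_)
  have h0 : orbitMap G x ((1 : G) : G ⧸ MulAction.stabilizer G x) = x := one_smul G x
  obtain rfl : (n : G) • ((1 : G) : G ⧸ MulAction.stabilizer G x) = y :=
    MulAction.injective_ofQuotientStabilizer G x (by
      refine Eq.trans ?_ h2.symm
      change ((n : G) * 1) • x = (n : G) • x
      rw [mul_one])
  refine Eq.trans ?_ (Ext.smul_val (f := orbitMap G x) (n : G) (skyscraperGerm x M a).1 _ h0 h2).symm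
  change Ind.mk M 1 (n • a) = (n : G) • Ind.mk M 1 a
  rw [← Ind.mk_mul, Ind.smul_mk, mul_one, one_mul]

variable (x M) in
/-- The stalk at `x` of the skyscraper of `M` is `M`. -/
noncomputable def skyscraperGermEquiv : M.M ≃ₗ[R] (skyscraper x M).Stalk x :=
  LinearEquiv.ofBijective
    { toFun := skyscraperGerm x M
      map_add' := skyscraperGerm_add
      map_smul' := skyscraperGerm_scalar } (skyscraperGerm_bijective x M)

/-- The map from the stalk at `x` to `M` given by a morphism to the skyscraper of `M`. -/
noncomputable def skyscraperStalk (m : F ⟶ skyscraper x M) : F.Stalk x →ₗ[R] M.M :=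
  (skyscraperGermEquiv x M).symm.toLinearMap.comp (stalkMap m x)

theorem skyscraperGerm_skyscraperStalk (m : F ⟶ skyscraper x M) (e : F.Stalk x) :
    skyscraperGerm x M (skyscraperStalk m e) = stalkMap m x e :=
  (skyscraperGermEquiv x M).apply_symm_apply _

/-- Equivariance is tested after the injective map `skyscraperGerm`. It makes the induced stalk map
a morphism of discrete modules, as the adjunction requires. -/
theorem skyscraperStalk_smul (m : F ⟶ skyscraper x M) (n : MulAction.stabilizer G x)
    (e : F.Stalk x) : skyscraperStalk m (stabSmul F x n e) = n • skyscraperStalk m e := by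
  apply (skyscraperGerm_bijective x M).1
  rw [skyscraperGerm_smul, skyscraperGerm_skyscraperStalk, skyscraperGerm_skyscraperStalk]
  exact Subtype.ext (Hom.map_smul m (n : G) e.1)

end SkyscraperHom

/-! ### Injective discrete modules -/

section Abstract

variable (R Γ : Type u) [Ring R] [Group Γ]

/-- The module over the group ring given by commuting actions of the ring and of the group. -/
noncomputable abbrev groupRingModule (M : Type u) [AddCommGroup M] [Module R M]
    [DistribMulAction Γ M] [SMulCommClass Γ R M] : Module (MonoidAlgebra R Γ) M :=
  Module.compHom M (MonoidAlgebra.liftNCRingHom (Module.toAddMonoidEnd R M)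
    (DistribMulAction.toAddMonoidEnd Γ M) fun r γ => by
      ext m
      exact (smul_comm γ r m).symm)

theorem single_smul_eq (M : Type u) [AddCommGroup M] [Module R M]
    [DistribMulAction Γ M] [SMulCommClass Γ R M] (γ : Γ) (r : R) (m : M) :
    letI := groupRingModule R Γ M
    (MonoidAlgebra.single γ r : MonoidAlgebra R Γ) • m = r • γ • m := by
  exact DFunLike.congr_fun (MonoidAlgebra.liftNC_single
    ((Module.toAddMonoidEnd R M : R →+* AddMonoid.End M) : R →+ AddMonoid.End M)
    (DistribMulAction.toAddMonoidEnd Γ M) γ r) m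

theorem exists_injective_module (S M : Type u) [Ring S] [AddCommGroup M] [Module S M] :
    ∃ (J : Type u) (_ : AddCommGroup J) (_ : Module S J) (i : M →ₗ[S] J),
      Module.Injective S J ∧ Function.Injective i := by
  let I : ModuleCat.{u} S := Injective.under (ModuleCat.of S M)
  have hI : Injective (ModuleCat.of S I) :=
    inferInstanceAs (Injective (Injective.under (ModuleCat.of S M)))
  refine ⟨I, inferInstance, inferInstance,
    (Injective.ι (ModuleCat.of S M)).hom, ?_, ?_⟩
  · exact Module.injective_module_of_injective_object S I
  · exact (ModuleCat.mono_iff_injective _).1 inferInstance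

end Abstract

namespace DiscMod

variable {R Γ : Type u} [Ring R] [Group Γ] [TopologicalSpace Γ]

/-- The kernel of a morphism of discrete modules. -/
def ker {A B : DiscMod R Γ} (f : Hom A B) : DiscMod R Γ :=
  letI _act : DistribMulAction Γ (LinearMap.ker f.toLin) :=
    { smul := fun γ a => ⟨γ • a.1, by
        rw [LinearMap.mem_ker, f.map_smul, LinearMap.mem_ker.1 a.2, smul_zero]⟩
      one_smul := fun a => Subtype.ext (one_smul Γ a.1)
      mul_smul := fun γ δ a => Subtype.ext (mul_smul γ δ a.1)
      smul_zero := fun γ => Subtype.ext (smul_zero γ)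
      smul_add := fun γ a b => Subtype.ext (smul_add γ a.1 b.1) }
  { M := LinearMap.ker f.toLin
    comm := ⟨fun γ r a => Subtype.ext (smul_comm γ r a.1)⟩
    contAct := ⟨Continuous.subtype_mk
      (continuous_fst.smul (continuous_subtype_val.comp continuous_snd)) _⟩ }

/-- The kernel is itself a discrete module, so a monomorphism cancels its inclusion against the zero
map. -/
theorem injective_of_mono {A B : DiscMod R Γ} (f : A ⟶ B) [Mono f] :
    Function.Injective (Hom.toLin f) := by
  rw [← LinearMap.ker_eq_bot, Submodule.eq_bot_iff]
  intro a ha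
  let i : ker f ⟶ A := show Hom (ker f) A from ⟨(LinearMap.ker (Hom.toLin f)).subtype, fun _ _ => rfl⟩
  let z : ker f ⟶ A := show Hom (ker f) A from ⟨0, fun γ _ => (smul_zero γ).symm⟩
  have h : i = z := by
    rw [← cancel_mono f]
    refine Hom.ext (LinearMap.ext fun b => ?_)
    exact (LinearMap.mem_ker.1 b.2).trans (LinearMap.map_zero _).symm
  have h1 : Hom.toLin i ⟨a, ha⟩ = Hom.toLin z ⟨a, ha⟩ := by rw [h]
  exact h1

theorem mono_of_injective {A B : DiscMod R Γ} (f : A ⟶ B)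
    (hf : Function.Injective (Hom.toLin f)) : Mono f where
  right_cancellation _ _ w := Hom.ext (LinearMap.ext fun a => hf
    (LinearMap.congr_fun (congrArg Hom.toLin w) a))

section Smooth

variable [IsTopologicalGroup Γ] (J : Type u) [AddCommGroup J] [Module (MonoidAlgebra R Γ) J]

theorem of_smul_of_smul (γ δ : Γ) (a : J) :
    MonoidAlgebra.of R Γ γ • MonoidAlgebra.of R Γ δ • a = MonoidAlgebra.of R Γ (γ * δ) • a := by
  rw [← mul_smul, map_mul]

variable (R Γ) in
/-- The elements of a module over the group ring that are fixed by a neighbourhood of `1`. -/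
def smooth : Submodule (MonoidAlgebra R Γ) J where
  carrier := {a | ∀ᶠ γ in 𝓝 (1 : Γ), MonoidAlgebra.of R Γ γ • a = a}
  zero_mem' := Filter.Eventually.of_forall fun γ => smul_zero _
  add_mem' ha hb := by
    filter_upwards [ha, hb] with γ h h'
    rw [smul_add, h, h']
  smul_mem' s a ha := by
    induction s using MonoidAlgebra.induction_linear with
    | zero =>
      rw [zero_smul]
      exact Filter.Eventually.of_forall fun γ => smul_zero _
    | add s t hs ht =>
      filter_upwards [hs, ht] with γ h h'
      rw [add_smul, smul_add, h, h']
    | single δ r =>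
      -- Moving `γ` past `δ` replaces it by `δ⁻¹ γ δ`, which is still close to `1`; this is why the
      -- smooth elements form a submodule over the group ring.
      have hc : Filter.Tendsto (fun γ : Γ => δ⁻¹ * γ * δ) (𝓝 1) (𝓝 1) := by
        have : Continuous fun γ : Γ => δ⁻¹ * γ * δ := by fun_prop
        simpa using this.tendsto 1
      filter_upwards [hc.eventually ha] with γ h
      have h1 : MonoidAlgebra.of R Γ γ * MonoidAlgebra.single δ r =
          MonoidAlgebra.single δ r * MonoidAlgebra.of R Γ (δ⁻¹ * γ * δ) := by
        rw [MonoidAlgebra.of_apply, MonoidAlgebra.of_apply, MonoidAlgebra.single_mul_single,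
          MonoidAlgebra.single_mul_single, one_mul, mul_one]
        congr 1
        group
      rw [← mul_smul, h1, mul_smul, h]

variable (R Γ) in
/-- The discrete module of smooth elements. -/
noncomputable def ofSmooth : DiscMod R Γ :=
  letI _mod : Module R (smooth R Γ J) :=
    Module.compHom _ (MonoidAlgebra.singleOneRingHom : R →+* MonoidAlgebra R Γ)
  letI _act : DistribMulAction Γ (smooth R Γ J) :=
    DistribMulAction.compHom _ (MonoidAlgebra.of R Γ)
  letI _top : TopologicalSpace (smooth R Γ J) := ⊥
  haveI _disc : DiscreteTopology (smooth R Γ J) := ⟨rfl⟩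
  { M := smooth R Γ J
    comm := ⟨fun γ r a => by
      change MonoidAlgebra.of R Γ γ • MonoidAlgebra.single (1 : Γ) r • a =
        MonoidAlgebra.single (1 : Γ) r • MonoidAlgebra.of R Γ γ • a
      rw [← mul_smul, ← mul_smul, MonoidAlgebra.of_apply, MonoidAlgebra.single_mul_single,
        MonoidAlgebra.single_mul_single, one_mul, mul_one, one_mul, mul_one]⟩
    contAct := by
      refine ⟨continuous_iff_continuousAt.2 ?_⟩
      rintro ⟨γ, a⟩
      have ha : ∀ᶠ δ in 𝓝 (1 : Γ), MonoidAlgebra.of R Γ δ • a.1 = a.1 := a.2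
      -- For `z.1` near `γ` the quotient `γ⁻¹ * z.1` is near `1` and fixes `a`, so `z.1` and `γ` act
      -- on `a` in the same way.
      have hc : Filter.Tendsto (fun z : Γ × smooth R Γ J => γ⁻¹ * z.1) (𝓝 (γ, a)) (𝓝 1) := by
        have : Continuous fun z : Γ × smooth R Γ J => γ⁻¹ * z.1 := by fun_prop
        simpa using this.tendsto (γ, a)
      have hd : ∀ᶠ z : Γ × smooth R Γ J in 𝓝 (γ, a), z.2 = a :=
        continuous_snd.continuousAt.eventually ((isOpen_discrete {a}).mem_nhds (Set.mem_singleton a))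
      refine (continuousAt_const (y := γ • a)).congr ?_
      filter_upwards [hc.eventually ha, hd] with z h h'
      rw [h']
      apply Subtype.ext
      change MonoidAlgebra.of R Γ γ • a.1 = MonoidAlgebra.of R Γ z.1 • a.1
      rw [← h, of_smul_of_smul, mul_inv_cancel_left, h] }

/-- An equivariant linear map is linear over the group ring. -/
noncomputable def Hom.toGroupRing {A B : DiscMod R Γ} (f : Hom A B) :
    letI := groupRingModule R Γ A.M
    letI := groupRingModule R Γ B.M
    A.M →ₗ[MonoidAlgebra R Γ] B.M :=
  letI := groupRingModule R Γ A.M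
  letI := groupRingModule R Γ B.M
  { f.toLin.toAddMonoidHom with
    map_smul' := fun s a => by
      change f.toLin (s • a) = s • f.toLin a
      induction s using MonoidAlgebra.induction_linear with
      | zero => simp
      | add s t hs ht => rw [add_smul, add_smul, map_add, hs, ht]
      | single γ r =>
        rw [single_smul_eq, single_smul_eq, LinearMap.map_smul, f.map_smul] }

/-- An equivariant linear map to the smooth elements is linear over the group ring. -/
noncomputable def homOfSmooth {A : DiscMod R Γ} (f : Hom A (ofSmooth R Γ J)) :
    letI := groupRingModule R Γ A.M
    A.M →ₗ[MonoidAlgebra R Γ] J :=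
  letI := groupRingModule R Γ A.M
  { toFun := fun a => (show smooth R Γ J from f.toLin a).1
    map_add' := fun a b => congrArg Subtype.val (f.toLin.map_add a b)
    map_smul' := fun s a => by
      change (show smooth R Γ J from f.toLin (s • a)).1 = s • (show smooth R Γ J from f.toLin a).1
      induction s using MonoidAlgebra.induction_linear with
      | zero =>
        rw [zero_smul, zero_smul, f.toLin.map_zero]
        rfl
      | add s t hs ht =>
        rw [add_smul, add_smul, f.toLin.map_add, ← hs, ← ht]
        rfl
      | single γ r =>
        rw [single_smul_eq, f.toLin.map_smul, f.map_smul]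
        change MonoidAlgebra.single (1 : Γ) r • MonoidAlgebra.of R Γ γ •
          (show smooth R Γ J from f.toLin a).1 = _
        rw [← mul_smul, MonoidAlgebra.of_apply, MonoidAlgebra.single_mul_single, one_mul, mul_one] }

/-- A map that is linear over the group ring takes values in the smooth elements. -/
noncomputable def toSmooth {A : DiscMod R Γ}
    (f : letI := groupRingModule R Γ A.M; A.M →ₗ[MonoidAlgebra R Γ] J) :
    Hom A (ofSmooth R Γ J) :=
  letI := groupRingModule R Γ A.M
  have hm : ∀ a, f a ∈ smooth R Γ J := fun a => by
    have h : ∀ᶠ γ in 𝓝 (1 : Γ), γ • a = a :=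
      (A.isOpen_stabilizer a).mem_nhds (one_smul Γ a)
    change ∀ᶠ γ in 𝓝 (1 : Γ), MonoidAlgebra.of R Γ γ • f a = f a
    filter_upwards [h] with γ hγ
    rw [← map_smul, MonoidAlgebra.of_apply, single_smul_eq, one_smul, hγ]
  { toLin :=
      { toFun := fun a => (⟨f a, hm a⟩ : smooth R Γ J)
        map_add' := fun a b => Subtype.ext (map_add f a b)
        map_smul' := fun r a => Subtype.ext (by
          change f (r • a) = MonoidAlgebra.single (1 : Γ) r • f a
          rw [← map_smul, single_smul_eq, one_smul]) }
    map_smul := fun γ a => Subtype.ext (by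
      change f (γ • a) = MonoidAlgebra.of R Γ γ • f a
      rw [← map_smul, MonoidAlgebra.of_apply, single_smul_eq, one_smul]) }

/-- Taking smooth elements is right adjoint to regarding a discrete module as a module over the
group ring, which preserves injections. Concretely, an extension with values in `J` exists, and it
lands in the smooth elements because every element of a discrete module has open stabilizer. -/
theorem injective_ofSmooth (hJ : Module.Injective (MonoidAlgebra R Γ) J) :
    Injective (ofSmooth R Γ J) where
  factors {X Y} g f _ := by
    let _ := groupRingModule R Γ X.M
    let _ := groupRingModule R Γ Y.M
    obtain ⟨h, hh⟩ := hJ.out (Hom.toGroupRing f) (injective_of_mono f) (homOfSmooth J g)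
    exact ⟨toSmooth J h, Hom.ext (LinearMap.ext fun a => Subtype.ext (hh a))⟩

theorem exists_injective (A : DiscMod R Γ) : ∃ (B : DiscMod R Γ) (f : Hom A B),
    Injective B ∧ Function.Injective f.toLin := by
  let _ := groupRingModule R Γ A.M
  obtain ⟨J, _, _, i, hJ, hi⟩ := exists_injective_module (MonoidAlgebra R Γ) A.M
  exact ⟨ofSmooth R Γ J, toSmooth J i, injective_ofSmooth J hJ,
    fun a b hab => hi (congrArg Subtype.val hab)⟩

end Smooth

end DiscMod

/-! ### Stalks of Weyl sheaves as discrete modules -/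

/-- The action of `g`, as a map from the stalk at `x` to the stalk at `y = g x`. -/
def EqSheaf.translateTo {R G X : Type u} [Ring R] [Group G] [TopologicalSpace G]
    [TopologicalSpace X] [MulAction G X] (F : EqSheaf R G X) (g : G) {x y : X} (h : g • x = y) :
    F.Stalk x →ₗ[R] F.Stalk y where
  toFun a := ⟨g • a.1, by rw [F.p_smul, a.2, h]⟩
  map_add' := by
    subst h
    exact (F.translate g x).map_add
  map_smul' := by
    subst h
    exact (F.translate g x).map_smul

section Stalks

variable {R G : Type u} [Ring R] [Group G] [TopologicalSpace G] [IsTopologicalGroup G]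

/-- The action of the stabilizer on the stalk. -/
def stabRep (F : EqSheaf R G (ClosedSubgroup G)) (K : ClosedSubgroup G) :
    MulAction.stabilizer G K →* Module.End R (F.Stalk K) where
  toFun n := F.translateTo (n : G) n.2
  map_one' := LinearMap.ext fun e => Subtype.ext (one_smul G e.1)
  map_mul' m n := LinearMap.ext fun e => Subtype.ext (mul_smul (m : G) (n : G) e.1)

/-- The action of the Weyl group on the stalk of a Weyl sheaf. -/
def weylRep (E : WeylSheaf R G) (K : ClosedSubgroup G) :
    WeylGroup K →* Module.End R (E.obj.Stalk K) :=
  QuotientGroup.lift _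
    ((stabRep E.obj K).comp (Subgroup.inclusion (stabilizer_eq_normalizer K).ge))
    fun n hn => LinearMap.ext fun e => Subtype.ext (E.property K e n.1 hn)

theorem toWeylGroup_surjective (K : ClosedSubgroup G) : Function.Surjective (toWeylGroup K) := by
  intro γ
  obtain ⟨n, rfl⟩ := QuotientGroup.mk_surjective γ
  exact ⟨⟨n.1, (stabilizer_eq_normalizer K).ge n.2⟩, rfl⟩

/-- The stalk of a Weyl sheaf at `K` as a discrete module over `W_G K`. -/
def stalkModule (E : WeylSheaf R G) (K : ClosedSubgroup G) : DiscMod R (WeylGroup K) :=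
  letI _act : DistribMulAction (WeylGroup K) (E.obj.Stalk K) :=
    DistribMulAction.compHom _ (weylRep E K)
  { M := E.obj.Stalk K
    comm := ⟨fun γ r a => (weylRep E K γ).map_smul r a⟩
    contAct := by
      -- An open quotient map stays one after taking the product with the stalk, so continuity is
      -- checked for the normalizer, where the action is restricted from that of `G` on the sheaf
      -- space.
      have h : IsOpenQuotientMap (Prod.map (QuotientGroup.mk : _ → WeylGroup K)
          (id : E.obj.Stalk K → E.obj.Stalk K)) :=
        QuotientGroup.isOpenQuotientMap_mk.prodMap IsOpenQuotientMap.id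
      refine ⟨h.isQuotientMap.continuous_iff.2 ?_⟩
      exact Continuous.subtype_mk ((continuous_subtype_val.comp continuous_fst).smul
        (continuous_subtype_val.comp continuous_snd)) _ }

/-- The map of discrete modules induced by a morphism of Weyl sheaves. -/
def stalkModuleMap {E E' : WeylSheaf R G} (f : E ⟶ E') (K : ClosedSubgroup G) :
    stalkModule E K ⟶ stalkModule E' K :=
  show DiscMod.Hom _ _ from
  { toLin := stalkMap f.hom K
    map_smul := fun γ a => by
      obtain ⟨n, rfl⟩ := toWeylGroup_surjective K γ
      exact Subtype.ext (Hom.map_smul f.hom (n : G) a.1) }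

variable [CompactSpace G] [TotallyDisconnectedSpace G]

/-- The morphism to the Weyl skyscraper of `A` given by a morphism from the stalk to `A`. -/
noncomputable def weylSkyscraperHom {E : WeylSheaf R G} {K : ClosedSubgroup G}
    {A : DiscMod R (WeylGroup K)} (φ : DiscMod.Hom (stalkModule E K) A) :
    E ⟶ weylSkyscraper K A :=
  ObjectProperty.homMk (skyscraperHom (F := E.obj)
    (M := A.res (toWeylGroup K) (continuous_toWeylGroup K)) (φ := φ.toLin)
    fun n e => φ.map_smul (toWeylGroup K n) e)

theorem stalkMap_weylSkyscraperHom {E : WeylSheaf R G} {K : ClosedSubgroup G}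
    {A : DiscMod R (WeylGroup K)} (φ : DiscMod.Hom (stalkModule E K) A) (e : E.obj.Stalk K) :
    stalkMap (weylSkyscraperHom φ).hom K e =
      skyscraperGerm K (A.res (toWeylGroup K) (continuous_toWeylGroup K)) (φ.toLin e) :=
  stalkMap_skyscraperHom (F := E.obj)
    (M := A.res (toWeylGroup K) (continuous_toWeylGroup K)) (φ := φ.toLin)
    (fun n e => φ.map_smul (toWeylGroup K n) e) e

/-- The morphism from the stalk to `A` given by a morphism to the Weyl skyscraper of `A`. -/
noncomputable def weylSkyscraperStalk {E : WeylSheaf R G} {K : ClosedSubgroup G}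
    {A : DiscMod R (WeylGroup K)} (m : E ⟶ weylSkyscraper K A) :
    DiscMod.Hom (stalkModule E K) A where
  toLin := skyscraperStalk (M := A.res (toWeylGroup K) (continuous_toWeylGroup K)) m.hom
  map_smul γ a := by
    obtain ⟨n, rfl⟩ := toWeylGroup_surjective K γ
    exact skyscraperStalk_smul (M := A.res (toWeylGroup K) (continuous_toWeylGroup K)) m.hom n a

/-- Pass to stalks at `K`, where the monomorphism stays injective, extend there by injectivity of
`A`, and pass back. Morphisms to the skyscraper are compared at `K` alone. -/
theorem injective_weylSkyscraper (K : ClosedSubgroup G) (A : DiscMod R (WeylGroup K))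
    [Injective A] : Injective (weylSkyscraper K A) where
  factors {E E'} g f _ := by
    have hf : Mono (stalkModuleMap f K) :=
      DiscMod.mono_of_injective _ (stalkMap_injective_of_mono f K)
    let g' : stalkModule E K ⟶ A := weylSkyscraperStalk g
    let h : stalkModule E' K ⟶ A := Injective.factorThru g' (stalkModuleMap f K)
    have hh : stalkModuleMap f K ≫ h = g' := Injective.comp_factorThru _ _
    refine ⟨weylSkyscraperHom h, ObjectProperty.hom_ext _ (skyscraper_hom_ext fun e => ?_)⟩
    refine (stalkMap_weylSkyscraperHom h (stalkMap f.hom K e)).trans ?_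
    have h1 : DiscMod.Hom.toLin h (stalkMap f.hom K e) = DiscMod.Hom.toLin g' e := by
      rw [← hh]
      rfl
    rw [h1]
    exact skyscraperGerm_skyscraperStalk
      (M := A.res (toWeylGroup K) (continuous_toWeylGroup K)) g.hom e

/-! ### Godement embeddings -/

theorem exists_isGodementEmbedding (E : WeylSheaf R G) :
    ∃ (I : WeylSheaf R G) (δ : E ⟶ I), IsGodementEmbedding δ := by
  let K : MulAction.orbitRel.Quotient G (ClosedSubgroup G) → ClosedSubgroup G := Quotient.out
  choose A f hA hf using fun O => DiscMod.exists_injective (stalkModule E (K O))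
  let S : MulAction.orbitRel.Quotient G (ClosedSubgroup G) → WeylSheaf R G :=
    fun O => weylSkyscraper (K O) (A O)
  refine ⟨(prodData S).weylSheaf, prodLift S fun O => weylSkyscraperHom (f O), K,
    fun O => Quotient.out_eq O, A, hA,
    fun O => ⟨(f O).toLin, hf O, fun n e => (f O).map_smul (toWeylGroup (K O) n) e⟩, prodπ S,
    ⟨prodIsLimit S⟩, fun O e => ?_⟩
  rw [prodLift_prodπ]
  exact stalkMap_weylSkyscraperHom (f O) e

variable {E I : WeylSheaf R G} {δ : E ⟶ I}

/-- A product of injective objects is injective: extend each component separately. -/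
theorem IsGodementEmbedding.injective (h : IsGodementEmbedding δ) : Injective I := by
  obtain ⟨K, hK, A, hA, j, π, ⟨hl⟩, h⟩ := h
  have hS : ∀ O, Injective (weylSkyscraper (K O) (A O)) := fun O =>
    have := hA O
    injective_weylSkyscraper (K O) (A O)
  refine ⟨fun {X Y} g f _ => ⟨Fan.IsLimit.lift hl fun O => Injective.factorThru (g ≫ π O) f, ?_⟩⟩
  refine Fan.IsLimit.hom_ext hl _ _ fun O => ?_
  rw [Category.assoc, Fan.IsLimit.fac]
  exact Injective.comp_factorThru _ _

/-- Translate the stalk at `L` to the one at the chosen representative `K O` of its class; there the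
component at `O` of `δ` is `j O`, which is injective. -/
theorem IsGodementEmbedding.stalkMap_injective (h : IsGodementEmbedding δ)
    (L : ClosedSubgroup G) : Function.Injective (stalkMap δ.hom L) := by
  obtain ⟨K, hK, A, hA, j, π, -, h⟩ := h
  rw [injective_iff_map_eq_zero]
  intro a ha
  let O : MulAction.orbitRel.Quotient G (ClosedSubgroup G) := Quotient.mk _ L
  obtain ⟨g, hg⟩ : ∃ g : G, g • L = K O := Quotient.exact (hK O)
  have h1 : stalkMap δ.hom (K O) (E.obj.translateTo g hg a) = 0 := by
    have h2 : stalkMap δ.hom (K O) (E.obj.translateTo g hg a) =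
        I.obj.translateTo g hg (stalkMap δ.hom L a) := Subtype.ext (Hom.map_smul δ.hom g a.1)
    rw [h2, ha, map_zero]
  have h2 := h O (E.obj.translateTo g hg a)
  have h3 : Hom.stalk (δ ≫ π O).hom (K O) (E.obj.translateTo g hg a) = 0 := by
    change stalkMap (π O).hom (K O) (stalkMap δ.hom (K O) (E.obj.translateTo g hg a)) = 0
    rw [h1, map_zero]
  rw [h3] at h2
  have h4 := (skyscraperGermEquiv (K O)
    ((A O).res (toWeylGroup (K O)) (continuous_toWeylGroup (K O)))).map_eq_zero_iff.1 h2.symm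
  have h5 : E.obj.translateTo g hg a = 0 := (j O).injective (h4.trans (map_zero _).symm)
  have h6 : g • a.1 = (0 : E.obj.Stalk (K O)).1 := congrArg Subtype.val h5
  have h7 : g • (0 : E.obj.Stalk L).1 = (0 : E.obj.Stalk (K O)).1 :=
    congrArg Subtype.val (E.obj.translateTo g hg).map_zero
  exact Subtype.ext (smul_left_cancel g (h6.trans h7.symm))

theorem IsGodementEmbedding.mono (h : IsGodementEmbedding δ) : Mono δ :=
  mono_of_stalkMap_injective h.stalkMap_injective

theorem enoughInjectives : EnoughInjectives (WeylSheaf R G) where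
  presentation E := by
    obtain ⟨I, δ, h⟩ := exists_isGodementEmbedding E
    exact ⟨⟨I, h.injective, δ, h.mono⟩⟩

end Stalks

section Exactness

variable {R G : Type u} [Ring R] [Group G] [TopologicalSpace G] [IsTopologicalGroup G]
  [CompactSpace G] [TotallyDisconnectedSpace G]

/-! ### Exactness and isomorphisms on stalks -/

/-- A continuous map over the base between local homeomorphisms is a local homeomorphism, so a
bijective one is a homeomorphism; its inverse inherits equivariance and linearity. -/
theorem isIso_of_stalkMap_bijective {F F' : WeylSheaf R G} (f : F ⟶ F')
    (h : ∀ x, Function.Bijective (stalkMap f.hom x)) : IsIso f := by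
  let φ : F.obj.E → F'.obj.E := Hom.toFun f.hom
  have hφ : Function.Bijective φ := by
    constructor
    · intro a b hab
      have hp : F.obj.p a = F.obj.p b := by
        rw [← Hom.map_p f.hom a, ← Hom.map_p f.hom b]
        exact congrArg F'.obj.p hab
      exact congrArg Subtype.val ((h (F.obj.p b)).1
        (a₁ := ⟨a, hp⟩) (a₂ := ⟨b, rfl⟩) (Subtype.ext hab))
    · intro b
      obtain ⟨a, ha⟩ := (h (F'.obj.p b)).2 ⟨b, rfl⟩
      exact ⟨a.1, congrArg Subtype.val ha⟩
  have hlocal : IsLocalHomeomorph φ := by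
    refine IsLocalHomeomorph.of_comp (g := F'.obj.p) ?_ F'.obj.isLocalHomeo
      (Hom.continuous_toFun f.hom)
    rw [show F'.obj.p ∘ φ = F.obj.p from funext (Hom.map_p f.hom)]
    exact F.obj.isLocalHomeo
  let e := Equiv.ofBijective φ hφ
  have he : ∀ b, φ (e.symm b) = b := e.apply_symm_apply
  have hp : ∀ b, F.obj.p (e.symm b) = F'.obj.p b := fun b => by
    rw [← Hom.map_p f.hom (e.symm b)]
    exact congrArg F'.obj.p (he b)
  let g : F'.obj ⟶ F.obj := show EqSheaf.Hom F'.obj F.obj from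
    { toFun := e.symm
      continuous_toFun := (e.toHomeomorphOfContinuousOpen (Hom.continuous_toFun f.hom)
        hlocal.isOpenMap).symm.continuous
      map_smul := fun g b => hφ.1 (by
        rw [he]
        refine Eq.trans ?_ (Hom.map_smul f.hom g _).symm
        exact congrArg (g • ·) (he b).symm)
      map_p := hp
      map_add_fib := fun x a b => hφ.1 (by
        rw [he]
        refine Eq.trans ?_ (Hom.map_add_fib f.hom x ⟨e.symm a.1, (hp a.1).trans a.2⟩
          ⟨e.symm b.1, (hp b.1).trans b.2⟩).symm
        congr 2
        · exact Subtype.ext (he a.1).symm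
        · exact Subtype.ext (he b.1).symm)
      map_scalar_fib := fun x r a => hφ.1 (by
        rw [he]
        refine Eq.trans ?_ (Hom.map_scalar_fib f.hom x r ⟨e.symm a.1, (hp a.1).trans a.2⟩).symm
        congr 2
        exact Subtype.ext (he a.1).symm) }
  refine ⟨ObjectProperty.homMk g, ?_, ?_⟩
  · exact ObjectProperty.hom_ext _ (Hom.ext (funext fun a => e.symm_apply_apply a))
  · exact ObjectProperty.hom_ext _ (Hom.ext (funext fun b => he b))

/-- Exactness is shown by exhibiting homology data with zero homology. Stalkwise exactness makes the
map from the first object to the kernel of `g` an epimorphism, so the left homology vanishes, and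
the map from the cokernel of `f` to the last object a monomorphism, so the right homology vanishes.
-/
theorem exact_of_stalkMap {S : ShortComplex (WeylSheaf R G)}
    (h : ∀ x a, stalkMap S.g.hom x a = 0 → ∃ b, stalkMap S.f.hom x b = a) : S.Exact := by
  have hepi : Epi (kerLift S.g S.f S.zero) := by
    refine epi_of_stalkMap_surjective fun x a => ?_
    have h1 : stalkMap S.g.hom x (stalkMap (kerι S.g).hom x a) = 0 := by
      change stalkMap (kerι S.g ≫ S.g).hom x a = 0
      rw [kerι_comp]
      exact stalkMap_zero x a
    obtain ⟨b, hb⟩ := h x _ h1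
    refine ⟨b, stalkMap_injective_of_mono (kerι S.g) x ?_⟩
    rw [← hb]
    change stalkMap (kerLift S.g S.f S.zero ≫ kerι S.g).hom x b = _
    rw [kerLift_kerι]
  have hmono : Mono (cokerDesc S.f S.g S.zero) := by
    refine mono_of_stalkMap_injective fun x => ?_
    rw [injective_iff_map_eq_zero]
    intro a ha
    obtain ⟨a, rfl⟩ := stalkMap_cokerπ_surjective S.f x a
    have h1 : stalkMap (cokerπ S.f ≫ cokerDesc S.f S.g S.zero).hom x a = 0 := ha
    rw [cokerπ_cokerDesc] at h1
    exact (stalkMap_cokerπ_eq_zero_iff S.f a).2 (h x a h1)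
  obtain ⟨Z, hz⟩ := HasZeroObject.zero (C := WeylSheaf R G)
  refine ⟨{
    left :=
      { K := _
        H := Z
        i := kerι S.g
        π := 0
        wi := kerι_comp S.g
        hi := kerIsLimit S.g
        wπ := comp_zero
        hπ := CokernelCofork.IsColimit.ofπ _ _ (fun _ _ => 0)
          (fun k hk => by
            have hk' : kerLift S.g S.f S.zero ≫ k = 0 := hk
            rw [zero_comp, ← cancel_epi (kerLift S.g S.f S.zero), hk', comp_zero])
          fun _ _ _ _ => hz.eq_of_src _ _ }
    right :=
      { Q := _
        H := Z
        p := cokerπ S.f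
        ι := 0
        wp := comp_cokerπ S.f
        hp := cokerIsColimit S.f
        wι := zero_comp
        hι := KernelFork.IsLimit.ofι _ _ (fun _ _ => 0)
          (fun k hk => by
            have hk' : k ≫ cokerDesc S.f S.g S.zero = 0 := hk
            rw [comp_zero, ← cancel_mono (cokerDesc S.f S.g S.zero), hk', zero_comp])
          fun _ _ _ _ => hz.eq_of_tgt _ _ }
    iso := Iso.refl _
    comm := ?_ }, hz⟩
  change 0 ≫ _ = kerι S.g ≫ cokerπ S.f
  rw [zero_comp, ← cancel_epi (kerLift S.g S.f S.zero), comp_zero, ← Category.assoc, kerLift_kerι,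
    comp_cokerπ]

/-! ### Godement resolutions -/

theorem exists_isGodementStep {A B : WeylSheaf R G} (f : A ⟶ B) :
    ∃ (C : WeylSheaf R G) (g : B ⟶ C), IsGodementStep f g := by
  obtain ⟨C, δ, h⟩ := exists_isGodementEmbedding (cokerData f).weylSheaf
  exact ⟨C, cokerπ f ≫ δ, _, cokerπ f, comp_cokerπ f, δ, ⟨cokerIsColimit f⟩, h, rfl⟩

theorem IsGodementStep.comp_eq_zero {A B C : WeylSheaf R G} {f : A ⟶ B} {g : B ⟶ C}
    (h : IsGodementStep f g) : f ≫ g = 0 := by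
  obtain ⟨Q, q, w, δ, -, -, rfl⟩ := h
  rw [← Category.assoc, w, zero_comp]

theorem IsGodementStep.injective {A B C : WeylSheaf R G} {f : A ⟶ B} {g : B ⟶ C}
    (h : IsGodementStep f g) : Injective C := by
  obtain ⟨Q, q, w, δ, -, h, -⟩ := h
  exact h.injective

/-- The embedding `δ` is injective on stalks, so `q` kills `b`. Since `q` is a cokernel, `cokerπ f`
factors through it and kills `b` too; its kernel on stalks is the image of `f`. -/
theorem IsGodementStep.exists_of_eq_zero {A B C : WeylSheaf R G} {f : A ⟶ B} {g : B ⟶ C}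
    (h : IsGodementStep f g) {x : ClosedSubgroup G} {b : B.obj.Stalk x}
    (hb : stalkMap g.hom x b = 0) : ∃ a, stalkMap f.hom x a = b := by
  obtain ⟨Q, q, w, δ, ⟨hq⟩, h, rfl⟩ := h
  have h1 : stalkMap q.hom x b = 0 :=
    h.stalkMap_injective x (Eq.trans hb (map_zero (stalkMap δ.hom x)).symm)
  rw [← stalkMap_cokerπ_eq_zero_iff]
  obtain ⟨l, hl⟩ := CokernelCofork.IsColimit.desc' hq (cokerπ f) (comp_cokerπ f)
  have hl' : q ≫ l = cokerπ f := hl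
  rw [← hl']
  change stalkMap l.hom x (stalkMap q.hom x b) = 0
  rw [h1, map_zero]

variable (E : WeylSheaf R G)

/-- The successive maps of a Godement resolution. -/
noncomputable def godementMap : ℕ → Arrow (WeylSheaf R G)
  | 0 => Arrow.mk (exists_isGodementEmbedding E).choose_spec.choose
  | n + 1 => Arrow.mk (exists_isGodementStep (godementMap n).hom).choose_spec.choose

/-- The augmentation of a Godement resolution. -/
noncomputable def godementι : E ⟶ (godementMap E 0).right := (godementMap E 0).hom

/-- The differentials of a Godement resolution. -/
noncomputable def godementD (n : ℕ) : (godementMap E n).right ⟶ (godementMap E (n + 1)).right :=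
  -- Arrow `0` is the augmentation, so the differential out of degree `n` is arrow `n + 1`; its
  -- source is by definition the target of arrow `n`.
  (godementMap E (n + 1)).hom

theorem isGodementEmbedding_godementι : IsGodementEmbedding (godementι E) :=
  (exists_isGodementEmbedding E).choose_spec.choose_spec

theorem isGodementStep_godementι : IsGodementStep (godementι E) (godementD E 0) :=
  (exists_isGodementStep (godementMap E 0).hom).choose_spec.choose_spec

theorem isGodementStep_godementD (n : ℕ) : IsGodementStep (godementD E n) (godementD E (n + 1)) :=
  (exists_isGodementStep (godementMap E (n + 1)).hom).choose_spec.choose_spec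

/-- The complex of a Godement resolution. -/
noncomputable def godementComplex : CochainComplex (WeylSheaf R G) ℕ :=
  CochainComplex.of (fun n => (godementMap E n).right) (godementD E)
    fun n => (isGodementStep_godementD E n).comp_eq_zero

theorem godementComplex_d (n : ℕ) : (godementComplex E).d n (n + 1) = godementD E n :=
  CochainComplex.of_d (fun n => (godementMap E n).right) (godementD E) n

theorem exactAt_godementComplex (n : ℕ) : (godementComplex E).ExactAt (n + 1) := by
  rw [(godementComplex E).exactAt_iff' n (n + 1) (n + 2) (by simp) (by simp)]
  refine exact_of_stalkMap fun x a ha => ?_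
  change stalkMap ((godementComplex E).d (n + 1) (n + 1 + 1)).hom x a = 0 at ha
  change ∃ b, stalkMap ((godementComplex E).d n (n + 1)).hom x b = a
  rw [godementComplex_d] at ha ⊢
  exact (isGodementStep_godementD E n).exists_of_eq_zero ha

/-- Degree `0` is its own predecessor in the complex shape, so the incoming map of the short complex
there is `d 0 0`. It vanishes, and the homology is the kernel of the outgoing differential. -/
theorem godementComplex_d_zero : (godementComplex E).d 0 0 = 0 :=
  (godementComplex E).shape 0 0 (by simp)

instance hasHomology_sc' : ((godementComplex E).sc' 0 0 1).HasHomology :=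
  .mk' (ShortComplex.HomologyData.ofIsLimitKernelFork _ (godementComplex_d_zero E) _ (kerIsLimit _))

instance hasHomology_godementComplex (n : ℕ) : (godementComplex E).HasHomology n := by
  cases n with
  | zero =>
    exact ShortComplex.hasHomology_of_iso
      ((godementComplex E).isoSc' 0 0 1 (by simp) (by simp)).symm
  | succ n => exact ShortComplex.Exact.hasHomology (exactAt_godementComplex E n)

/-- The augmentation of a Godement resolution, as a map of complexes. -/
noncomputable def godementAug : (CochainComplex.single₀ (WeylSheaf R G)).obj E ⟶ godementComplex E :=
  HomologicalComplex.mkHomFromSingle (j := 0) (godementι E) fun k hk => by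
    obtain rfl : 0 + 1 = k := hk
    rw [godementComplex_d]
    exact (isGodementStep_godementι E).comp_eq_zero

theorem godementAug_f : (godementAug E).f 0 =
    (HomologicalComplex.singleObjXSelf (ComplexShape.up ℕ) 0 E).hom ≫ godementι E :=
  HomologicalComplex.mkHomFromSingle_f _ _

/-- In degree `0` the homologies are `E` and the kernel of the first differential, and the induced
map is the factorization of the augmentation through this kernel. It is bijective on stalks:
injective since the augmentation is mono, surjective by exactness of the first Godement step. -/
instance quasiIsoAt_godementAug_zero : QuasiIsoAt (godementAug E) 0 := by
  let K := (CochainComplex.single₀ (WeylSheaf R G)).obj E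
  have : (K.sc' 0 0 1).HasHomology := ShortComplex.hasHomology_of_iso
    (K.isoSc' 0 0 1 (by simp) (by simp))
  rw [CochainComplex.quasiIsoAt₀_iff]
  let φ := (HomologicalComplex.shortComplexFunctor' (WeylSheaf R G) (ComplexShape.up ℕ) 0 0 1).map
    (godementAug E)
  have hg : (K.sc' 0 0 1).g = 0 := HomologicalComplex.single_obj_d (ComplexShape.up ℕ) 0 E _ _
  have hf : (K.sc' 0 0 1).f = 0 := HomologicalComplex.single_obj_d (ComplexShape.up ℕ) 0 E _ _
  have hw : φ.τ₂ ≫ ((godementComplex E).sc' 0 0 1).g = 0 := by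
    refine φ.comm₂₃.trans ?_
    exact (congrArg (· ≫ φ.τ₃) hg).trans zero_comp
  -- Both incoming maps are zero, so kernels serve as homology; on the side of `E` the outgoing map
  -- is zero too and the identity is its kernel.
  let γ := ShortComplex.LeftHomologyMapData.ofIsLimitKernelFork φ hf _
    (KernelFork.IsLimit.ofId _ hg) (godementComplex_d_zero E) _ (kerIsLimit _)
    (kerLift _ φ.τ₂ hw) ((Category.id_comp _).trans (kerLift_kerι _ _ hw).symm)
  rw [γ.quasiIso_iff]
  change IsIso (kerLift _ φ.τ₂ hw)
  have hτ : φ.τ₂ = _ := godementAug_f E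
  have hι := (isGodementEmbedding_godementι E).mono
  have hm : Mono φ.τ₂ := by
    rw [hτ]
    exact mono_comp' (HomologicalComplex.singleObjXSelf (ComplexShape.up ℕ) 0 E).isIso_hom.mono_of_iso hι
  refine isIso_of_stalkMap_bijective _ fun x => ⟨?_, fun a => ?_⟩
  · have : Mono (kerLift _ φ.τ₂ hw) := by
      have : Mono (kerLift _ φ.τ₂ hw ≫ kerι _) := by rwa [kerLift_kerι]
      exact mono_of_mono _ (kerι _)
    exact stalkMap_injective_of_mono _ x
  · have h1 : stalkMap (kerι ((godementComplex E).sc' 0 0 1).g ≫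
        ((godementComplex E).sc' 0 0 1).g).hom x a = 0 := by
      rw [kerι_comp]
      exact stalkMap_zero x a
    have h2 : stalkMap ((godementComplex E).d 0 (0 + 1)).hom x
        (stalkMap (kerι ((godementComplex E).sc' 0 0 1).g).hom x a) = 0 := h1
    rw [godementComplex_d] at h2
    obtain ⟨b, hb⟩ := (isGodementStep_godementι E).exists_of_eq_zero h2
    refine ⟨stalkMap (HomologicalComplex.singleObjXSelf (ComplexShape.up ℕ) 0 E).inv.hom x b,
      stalkMap_injective_of_mono (kerι _) x ?_⟩
    refine Eq.trans ?_ hb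
    exact congrArg (fun m : E ⟶ (godementMap E 0).right => stalkMap m.hom x b)
      ((congrArg ((HomologicalComplex.singleObjXSelf (ComplexShape.up ℕ) 0 E).inv ≫ ·)
        ((kerLift_kerι _ _ hw).trans hτ)).trans (Iso.inv_hom_id_assoc _ _))

/-- A Godement resolution. -/
noncomputable def godementResolution : InjectiveResolution E where
  cocomplex := godementComplex E
  injective n := by
    cases n with
    | zero => exact (isGodementEmbedding_godementι E).injective
    | succ n =>
      cases n with
      | zero => exact (isGodementStep_godementι E).injective
      | succ n => exact (isGodementStep_godementD E n).injective
  ι := godementAug E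
  quasiIso := by
    refine ⟨fun n => ?_⟩
    cases n with
    | zero => infer_instance
    | succ n =>
      rw [quasiIsoAt_iff_exactAt']
      · exact .of_isZero (HomologicalComplex.isZero_single_obj_X _ _ _ _ (by simp))
      · exact exactAt_godementComplex E n

theorem isGodementResolution_godementResolution : IsGodementResolution (godementResolution E) := by
  have hι : (HomologicalComplex.singleObjXSelf (ComplexShape.up ℕ) 0 E).inv ≫
      (godementAug E).f 0 = godementι E := by
    rw [godementAug_f]
    exact (HomologicalComplex.singleObjXSelf (ComplexShape.up ℕ) 0 E).inv_hom_id_assoc _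
  refine ⟨?_, ?_, fun n => ?_⟩
  · change IsGodementEmbedding ((HomologicalComplex.singleObjXSelf _ 0 E).inv ≫
      (godementAug E).f 0)
    rw [hι]
    exact isGodementEmbedding_godementι E
  · change IsGodementStep ((HomologicalComplex.singleObjXSelf _ 0 E).inv ≫
      (godementAug E).f 0) ((godementComplex E).d 0 (0 + 1))
    rw [hι, godementComplex_d]
    exact isGodementStep_godementι E
  · change IsGodementStep ((godementComplex E).d n (n + 1))
      ((godementComplex E).d (n + 1) (n + 1 + 1))
    rw [godementComplex_d, godementComplex_d]
    exact isGodementStep_godementD E n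

end Exactness

end WeylSheaves

theorem mainTheorem7 (R G : Type u) [Ring R] [Group G] [TopologicalSpace G]
    [IsTopologicalGroup G] [CompactSpace G] [TotallyDisconnectedSpace G] :
    (∀ (K : ClosedSubgroup G) (A : WeylSheaves.DiscMod R (WeylSheaves.WeylGroup K)),
      Injective A → Injective (WeylSheaves.weylSkyscraper K A)) ∧
    EnoughInjectives (WeylSheaves.WeylSheaf R G) ∧
    ∀ E : WeylSheaves.WeylSheaf R G, ∃ P : InjectiveResolution E,
      WeylSheaves.IsGodementResolution P :=
  ⟨fun K A _ => WeylSheaves.injective_weylSkyscraper K A, WeylSheaves.enoughInjectives,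
    fun E => ⟨WeylSheaves.godementResolution E,
      WeylSheaves.isGodementResolution_godementResolution E⟩⟩
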